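/- Manifolds are smooth, Hausdorff and finite-dimensional, and $M$ has positive dimension. **Definitions.** A *complex structure* on a manifold is a smooth endomorphism field $J$ of the tangent bundle with $J^2=-\mathrm{Id}$ which admits local holomorphic coordinates around each point. A *para-complex structure* is a smooth endomorphism field $J\neq \mathrm{Id}$ with $J^2=\mathrm{Id}$ whose eigendistributions $\ker(\mathrm{Id}\mp J)$ have the same rank and are both integrable (through each point there passes an integral manifold). A *para-hyper-Kähler structure* $(J_1,J_2,J_3,g)$ consists of three pairwise anticommuting endomorphism fields $J_1,J_2,J_3=J_1J_2$, two of which are para-complex structures and one of which is a complex structure, and a pseudo-Riemannian metric $g$ for which all $J_\alpha$ are skew-symmetric and the three two-forms $g(J_\alpha\cdot,\cdot)$ are closed. A *special (pseudo-)Kähler manifold* $(M,J,g,\nabla)$ is a manifold $M$ with a complex structure $J$, a pseudo-Riemannian metric $g$ (of any signature) for which $J$ is skew-symmetric and the Kähler form $\omega=g(J\cdot,\cdot)$ is closed, and a smooth flat torsion-free connection $\nabla$ on $TM$ with $\nabla\omega=0$ and $(\nabla_XJ)Y=(\nabla_YJ)X$ for all vector fields $X,Y$. **Theorem.** Let $(M,J,g,\nabla)$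 be a special (pseudo-)Kähler manifold with Kähler form $\omega$, and let $\pi:N=T^*M\to M$ be its cotangent bundle. For $\xi\in N$ and $p=\pi(\xi)$ identify $$T_\xi N=\mathcal H^\nabla_\xi\oplus \ker d\pi_\xi\cong T_pM\oplus T_p^*M ,$$ where $\mathcal H^\nabla_\xi$ is the horizontal space of the connection induced by $\nabla$ on $T^*M$, identified with $T_pM$ by $d\pi_\xi$, and $\ker d\pi_\xi=T_\xi(T^*_pM)\cong T_p^*M$ canonically. With respect to this identification put $$J_1=J^\nabla=\begin{pmatrix}J&0\\0&J^*\end{pmatrix},\quad J_2=J^\omega=\begin{pmatrix}0&\omega^{-1}\\ \omega&0\end{pmatrix},\quad J_3=J_1J_2,\quad g_N=\begin{pmatrix}g&0\\0&-g^{-1}\end{pmatrix},$$ where $J^*\alpha=\alpha\circ J$, $\omega:T_pM\to T_p^*M$ is the map $v\mapsto\omega(v,\cdot)$, and $g^{-1}$ is the metric on $T^*_pM$ induced by $g$. Then $(J_1,J_2,J_3,g_N)$ is a para-hyper-Kähler structure on $N$; $J_1$ is a complex structure, and $J_2$, $J_3$ are para-complex structures. Moreover, $J_1=J_N$ is the canonical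 complex structure of the cotangent bundle of $(M,J)$, that is, the unique endomorphism field of $TN$ such that for all local holomorphic coordinates $z$ of $(M,J)$ the induced local coordinates $(z,w)$ of $T^*M$ are holomorphic, where the complex structure of the fibre coordinates $w$ is the one given by $\alpha\mapsto\alpha\circ J$ on $T^*_pM$. -/

import Mathlib

open Bundle
open scoped Manifold ContDiff

noncomputable section

/-! ## Tensor fields on a manifold -/

section General

variable {E : Type*} [NormedAddCommGroup E] [NormedSpace ℝ E]
  {H : Type*} [TopologicalSpace H] (I : ModelWithCorners ℝ E H)
  (M : Type*) [TopologicalSpace M] [ChartedSpace H M]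

/-- Fields of endomorphisms of the tangent spaces (no regularity). -/
abbrev EndField := ∀ x : M, TangentSpace I x →L[ℝ] TangentSpace I x

/-- Fields of bilinear forms on the tangent spaces (no regularity). -/
abbrev BilinField := ∀ x : M, TangentSpace I x →L[ℝ] TangentSpace I x →L[ℝ] ℝ

variable {I M}

/-- Smoothness of an endomorphism field, as a section of `Hom(TM, TM)`. -/
def EndField.IsSmooth [IsManifold I ∞ M] (J : EndField I M) : Prop :=
  ContMDiff I (I.prod 𝓘(ℝ, E →L[ℝ] E)) ∞
    (fun x ↦ TotalSpace.mk' (E →L[ℝ] E) (E := fun x : M ↦ TangentSpace I x →L[ℝ] TangentSpace I x)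
      x (J x))

/-- Smoothness of a field of bilinear forms, as a section of `Hom(TM, Hom(TM, ℝ))`. -/
def BilinField.IsSmooth [IsManifold I ∞ M] (b : BilinField I M) : Prop :=
  ContMDiff I (I.prod 𝓘(ℝ, E →L[ℝ] E →L[ℝ] ℝ)) ∞
    (fun x ↦ TotalSpace.mk' (E →L[ℝ] E →L[ℝ] ℝ)
      (E := fun x : M ↦ TangentSpace I x →L[ℝ] TangentSpace I x →L[ℝ] ℝ) x (b x))

/-- A pseudo-Riemannian metric: smooth, symmetric and nondegenerate, of arbitrary signature. -/
structure IsPseudoRiemannian [IsManifold I ∞ M] (g : BilinField I M) : Prop where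
  smooth : g.IsSmooth
  symm : ∀ x v w, g x v w = g x w v
  nondegenerate : ∀ x v, (∀ w, g x v w = 0) → v = 0

/-- The endomorphism field `J` is skew-symmetric with respect to `g`. -/
def IsSkew (g : BilinField I M) (J : EndField I M) : Prop :=
  ∀ x v w, g x (J x v) w = - g x v (J x w)

/-- The fundamental two-form `g(J·, ·)`. -/
def fundamentalForm (g : BilinField I M) (J : EndField I M) : BilinField I M :=
  fun x ↦ g x ∘L J x

/-- Closedness of a field `Ω` of (skew-symmetric) bilinear forms: `dΩ = 0`, with `dΩ` given by
`dΩ(X,Y,Z) = X Ω(Y,Z) - Y Ω(X,Z) + Z Ω(X,Y) - Ω([X,Y],Z) + Ω([X,Z],Y) - Ω([Y,Z],X)`. -/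
def IsClosedForm [IsManifold I ∞ M] (Ω : BilinField I M) : Prop :=
  ∀ (x : M) (X Y Z : ∀ x : M, TangentSpace I x),
    MDiffAt (T% X) x → MDiffAt (T% Y) x → MDiffAt (T% Z) x →
    mvfderiv I (fun y ↦ Ω y (Y y) (Z y)) x (X x)
      - mvfderiv I (fun y ↦ Ω y (X y) (Z y)) x (Y x)
      + mvfderiv I (fun y ↦ Ω y (X y) (Y y)) x (Z x)
      - Ω x (VectorField.mlieBracket I X Y x) (Z x)
      + Ω x (VectorField.mlieBracket I X Z x) (Y x)
      - Ω x (VectorField.mlieBracket I Y Z x) (X x) = 0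

/-! ## Complex structures -/

/-- An almost complex structure: a smooth endomorphism field with `J² = -1`. -/
structure IsAlmostComplex [IsManifold I ∞ M] (J : EndField I M) : Prop where
  smooth : J.IsSmooth
  sq : ∀ x v, J x (J x v) = - v

/-- `e` is a local holomorphic coordinate system for `J`: a diffeomorphism between open subsets of
`M` and of the model vector space `E`, whose differential intertwines `J` with a constant linear
complex structure `j` on `E` (so that `(E, j)` is a copy of `ℂⁿ`). -/
structure IsHolomorphicChart (J : EndField I M) (e : OpenPartialHomeomorph M E)
    (j : E →L[ℝ] E) : Prop where
  contMDiffOn : ContMDiffOn I 𝓘(ℝ, E) ∞ e e.source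
  contMDiffOn_symm : ContMDiffOn 𝓘(ℝ, E) I ∞ e.symm e.target
  sq : ∀ v, j (j v) = - v
  mfderiv_comp : ∀ x ∈ e.source, ∀ v : TangentSpace I x,
    mvfderiv I e x (J x v) = j (mvfderiv I e x v)

/-- A complex structure: an almost complex structure which admits local holomorphic coordinates
around each point. -/
structure IsComplexStructure [IsManifold I ∞ M] (J : EndField I M) : Prop
    extends IsAlmostComplex J where
  exists_chart : ∀ x : M, ∃ (e : OpenPartialHomeomorph M E) (j : E →L[ℝ] E),
    x ∈ e.source ∧ IsHolomorphicChart J e j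

/-! ## Para-complex structures -/

/-- A distribution is integrable if through each point there passes an integral manifold, i.e. an
immersed submanifold whose tangent space at each of its points is given by the distribution. -/
def IsIntegrableDistribution (D : ∀ x : M, Submodule ℝ (TangentSpace I x)) : Prop :=
  ∀ x : M, ∃ (k : ℕ) (U : Set (EuclideanSpace ℝ (Fin k))) (f : EuclideanSpace ℝ (Fin k) → M),
    IsOpen U ∧ 0 ∈ U ∧ f 0 = x ∧ ContMDiffOn 𝓘(ℝ, EuclideanSpace ℝ (Fin k)) I ∞ f U ∧
    ∀ u ∈ U, Function.Injective (mfderiv 𝓘(ℝ, EuclideanSpace ℝ (Fin k)) I f u) ∧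
      (mfderiv 𝓘(ℝ, EuclideanSpace ℝ (Fin k)) I f u).range = D (f u)

/-- The eigendistribution `ker (Id - J)`. -/
def plusDistribution (J : EndField I M) (x : M) : Submodule ℝ (TangentSpace I x) :=
  (ContinuousLinearMap.id ℝ (TangentSpace I x) - J x).ker

/-- The eigendistribution `ker (Id + J)`. -/
def minusDistribution (J : EndField I M) (x : M) : Submodule ℝ (TangentSpace I x) :=
  (ContinuousLinearMap.id ℝ (TangentSpace I x) + J x).ker

/-- An almost para-complex structure: a smooth involution `J ≠ Id` of the tangent bundle whose two
eigendistributions have the same rank. -/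
structure IsAlmostParaComplex [IsManifold I ∞ M] (J : EndField I M) : Prop where
  smooth : J.IsSmooth
  ne_id : ∀ x, J x ≠ ContinuousLinearMap.id ℝ (TangentSpace I x)
  sq : ∀ x v, J x (J x v) = v
  finrank_eq : ∀ x,
    Module.finrank ℝ (plusDistribution J x) = Module.finrank ℝ (minusDistribution J x)

/-- A para-complex structure: an almost para-complex structure with integrable
eigendistributions. -/
structure IsParaComplexStructure [IsManifold I ∞ M] (J : EndField I M) : Prop
    extends IsAlmostParaComplex J where
  integrable_plus : IsIntegrableDistribution (plusDistribution J)
  integrable_minus : IsIntegrableDistribution (minusDistribution J)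

/-! ## Para-hyper-Kähler structures -/

/-- A para-hypercomplex structure: three pairwise anticommuting structures `J₁, J₂, J₃ = J₁J₂`, two
of them para-complex and one of them complex. -/
structure IsParaHypercomplex [IsManifold I ∞ M] (J₁ J₂ J₃ : EndField I M) : Prop where
  eq_comp : ∀ x v, J₃ x v = J₁ x (J₂ x v)
  anticomm₁₂ : ∀ x v, J₁ x (J₂ x v) = - J₂ x (J₁ x v)
  anticomm₁₃ : ∀ x v, J₁ x (J₃ x v) = - J₃ x (J₁ x v)
  anticomm₂₃ : ∀ x v, J₂ x (J₃ x v) = - J₃ x (J₂ x v)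
  types : (IsComplexStructure J₁ ∧ IsParaComplexStructure J₂ ∧ IsParaComplexStructure J₃) ∨
    (IsParaComplexStructure J₁ ∧ IsComplexStructure J₂ ∧ IsParaComplexStructure J₃) ∨
    (IsParaComplexStructure J₁ ∧ IsParaComplexStructure J₂ ∧ IsComplexStructure J₃)

/-- A para-hyper-Hermitian structure: a para-hypercomplex structure together with a
pseudo-Riemannian metric for which the three endomorphism fields are skew-symmetric. -/
structure IsParaHyperHermitian [IsManifold I ∞ M] (J₁ J₂ J₃ : EndField I M)
    (g : BilinField I M) : Prop extends IsParaHypercomplex J₁ J₂ J₃ where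
  metric : IsPseudoRiemannian g
  skew₁ : IsSkew g J₁
  skew₂ : IsSkew g J₂
  skew₃ : IsSkew g J₃

/-- A para-hyper-Kähler structure: a para-hyper-Hermitian structure whose three fundamental
two-forms are closed. -/
structure IsParaHyperKahler [IsManifold I ∞ M] (J₁ J₂ J₃ : EndField I M)
    (g : BilinField I M) : Prop extends IsParaHyperHermitian J₁ J₂ J₃ g where
  closed₁ : IsClosedForm (fundamentalForm g J₁)
  closed₂ : IsClosedForm (fundamentalForm g J₂)
  closed₃ : IsClosedForm (fundamentalForm g J₃)

/-! ## Special (pseudo-)Kähler manifolds -/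

/-- A (pseudo-)Kähler manifold `(M, J, g)`. -/
structure IsPseudoKahler [IsManifold I ∞ M] (J : EndField I M) (g : BilinField I M) : Prop where
  complex : IsComplexStructure J
  metric : IsPseudoRiemannian g
  skew : IsSkew g J
  closed : IsClosedForm (fundamentalForm g J)

/-- The linear connection `D` is flat: `D_X D_Y Z - D_Y D_X Z - D_{[X,Y]} Z = 0` for all smooth
vector fields. Recall that `D Y x (X x)` is `(D_X Y)_x`. -/
def IsFlatConnection [IsManifold I ∞ M]
    (D : CovariantDerivative I E (TangentSpace I : M → Type _)) : Prop :=
  ∀ X Y Z : ∀ x : M, TangentSpace I x,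
    CMDiff ∞ (T% X) → CMDiff ∞ (T% Y) → CMDiff ∞ (T% Z) → ∀ x : M,
    D (fun y ↦ D Z y (Y y)) x (X x) - D (fun y ↦ D Z y (X y)) x (Y x)
      - D Z x (VectorField.mlieBracket I X Y x) = 0

/-- The bilinear form field `Ω` is parallel for the linear connection `D`. -/
def IsParallelForm [IsManifold I ∞ M]
    (D : CovariantDerivative I E (TangentSpace I : M → Type _))
    (Ω : BilinField I M) : Prop :=
  ∀ (x : M) (v : TangentSpace I x) (Y Z : ∀ x : M, TangentSpace I x),
    MDiffAt (T% Y) x → MDiffAt (T% Z) x →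
    mvfderiv I (fun y ↦ Ω y (Y y) (Z y)) x v = Ω x (D Y x v) (Z x) + Ω x (Y x) (D Z x v)

/-- `DJ` is symmetric: `(D_X J) Y = (D_Y J) X`, where `(D_X J) Y = D_X (J Y) - J (D_X Y)`. -/
def HasSymmetricDerivative [IsManifold I ∞ M]
    (D : CovariantDerivative I E (TangentSpace I : M → Type _))
    (J : EndField I M) : Prop :=
  ∀ (x : M) (X Y : ∀ x : M, TangentSpace I x), MDiffAt (T% X) x → MDiffAt (T% Y) x →
    D (fun y ↦ J y (Y y)) x (X x) - J x (D Y x (X x)) =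
      D (fun y ↦ J y (X y)) x (Y x) - J x (D X x (Y x))

/-- An (affine) special (pseudo-)Kähler manifold `(M, J, g, D)`: a (pseudo-)Kähler manifold with a
smooth flat torsion-free connection `D` such that `Dω = 0` and `DJ` is symmetric. -/
structure IsSpecialPseudoKahler [IsManifold I ∞ M] [FiniteDimensional ℝ E]
    (J : EndField I M) (g : BilinField I M)
    (D : CovariantDerivative I E (TangentSpace I : M → Type _)) : Prop
    extends IsPseudoKahler J g where
  smooth_connection : D.ContMDiffCovariantDerivative ∞
  flat : IsFlatConnection D
  torsion_free : haveI := FiniteDimensional.complete ℝ E; D.torsion = 0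
  parallel : IsParallelForm D (fundamentalForm g J)
  symmetric : HasSymmetricDerivative D J

end General

/-! ## The cotangent bundle -/

section Cotangent

variable (E : Type*) [NormedAddCommGroup E] [NormedSpace ℝ E]
  (M : Type*) [TopologicalSpace M] [ChartedSpace E M]

variable {M} in
/-- The cotangent space `T*_x M`. -/
abbrev CotangentSpace (x : M) : Type _ := TangentSpace 𝓘(ℝ, E) x →L[ℝ] Trivial M ℝ x

/-- The cotangent bundle `T*M`. -/
abbrev CotangentBundle : Type _ := TotalSpace (E →L[ℝ] ℝ) (CotangentSpace E : M → Type _)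

/-- The model of the cotangent bundle as a manifold. -/
abbrev cotangentModel : ModelWithCorners ℝ (E × (E →L[ℝ] ℝ)) (ModelProd E (E →L[ℝ] ℝ)) :=
  𝓘(ℝ, E).prod 𝓘(ℝ, E →L[ℝ] ℝ)

variable {E M}
variable [IsManifold 𝓘(ℝ, E) ∞ M]

/-- The differential `dπ_ξ : T_ξ N → T_p M` of the projection `π : N = T*M → M`, `p = π ξ`. -/
def projDeriv (ξ : CotangentBundle E M) :
    TangentSpace (cotangentModel E) ξ →L[ℝ] TangentSpace 𝓘(ℝ, E) ξ.proj :=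
  mfderiv (cotangentModel E) 𝓘(ℝ, E) (TotalSpace.proj : CotangentBundle E M → M) ξ

/-- A vector field `Y` on `M`, seen as the fiberwise linear function `η ↦ η(Y)` on `N = T*M`. -/
def fiberLinear (Y : ∀ x : M, TangentSpace 𝓘(ℝ, E) x) (η : CotangentBundle E M) : ℝ :=
  η.2 (Y η.proj)

lemma mdifferentiableAt_fiberLinear {ξ : CotangentBundle E M}
    {Y : ∀ x : M, TangentSpace 𝓘(ℝ, E) x} (hY : MDiffAt (T% Y) ξ.proj) :
    MDifferentiableAt (cotangentModel E) 𝓘(ℝ, ℝ) (fiberLinear Y) ξ := by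
  have h1 : MDifferentiableAt (cotangentModel E) (𝓘(ℝ, E).prod 𝓘(ℝ, E →L[ℝ] ℝ))
      (fun η : CotangentBundle E M ↦ TotalSpace.mk' (E →L[ℝ] ℝ)
        (E := (CotangentSpace E : M → Type _)) η.proj η.2) ξ :=
    mdifferentiableAt_id
  have h2 : MDifferentiableAt (cotangentModel E) (𝓘(ℝ, E).prod 𝓘(ℝ, E))
      (fun η : CotangentBundle E M ↦ TotalSpace.mk' E
        (E := (TangentSpace 𝓘(ℝ, E) : M → Type _)) η.proj (Y η.proj)) ξ :=
    MDifferentiableAt.comp (I' := 𝓘(ℝ, E)) ξ hY (mdifferentiableAt_proj _)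
  have h3 := MDifferentiableAt.clm_bundle_apply h1 h2
  rw [mdifferentiableAt_totalSpace] at h3
  exact h3.2

/-- The vertical lift of `α ∈ T*_p M` to `T_ξ N`: the velocity of `t ↦ ξ + t α` at `t = 0`. -/
def verticalLift (ξ : CotangentBundle E M) (α : CotangentSpace E ξ.proj) :
    TangentSpace (cotangentModel E) ξ :=
  (mfderiv 𝓘(ℝ, ℝ) (cotangentModel E)
    (fun t : ℝ ↦ (⟨ξ.proj, ξ.2 + t • α⟩ : CotangentBundle E M)) 0 (1 : ℝ) : E × (E →L[ℝ] ℝ))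

lemma mdifferentiableAt_fiberLine (ξ : CotangentBundle E M) (α : CotangentSpace E ξ.proj) :
    MDifferentiableAt 𝓘(ℝ, ℝ) (cotangentModel E)
      (fun t : ℝ ↦ (⟨ξ.proj, ξ.2 + t • α⟩ : CotangentBundle E M)) 0 := by
  rw [mdifferentiableAt_totalSpace]
  refine ⟨mdifferentiableAt_const, ?_⟩
  have hb := FiberBundle.mem_baseSet_trivializationAt' (F := E →L[ℝ] ℝ)
    (E := (CotangentSpace E : M → Type _)) ξ.proj
  set e := trivializationAt (E →L[ℝ] ℝ) (CotangentSpace E : M → Type _) ξ.proj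
  have h : (fun t : ℝ ↦ (e (⟨ξ.proj, ξ.2 + t • α⟩ : CotangentBundle E M)).2) = fun t : ℝ ↦
      e.linearMapAt ℝ ξ.proj ξ.2 + t • e.linearMapAt ℝ ξ.proj α := by
    funext t
    rw [← map_smul, ← map_add, e.linearMapAt_apply, if_pos hb]
  change MDifferentiableAt _ _ (fun t : ℝ ↦ (e (⟨ξ.proj, ξ.2 + t • α⟩ : CotangentBundle E M)).2) 0
  rw [h]
  apply DifferentiableAt.mdifferentiableAt
  fun_prop

lemma projDeriv_verticalLift (ξ : CotangentBundle E M) (α : CotangentSpace E ξ.proj) :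
    projDeriv ξ (verticalLift ξ α) = 0 := by
  have h0 : (⟨ξ.proj, ξ.2 + (0 : ℝ) • α⟩ : CotangentBundle E M) = ξ := by simp
  have hp : MDifferentiableAt (cotangentModel E) 𝓘(ℝ, E)
      (TotalSpace.proj : CotangentBundle E M → M)
      (⟨ξ.proj, ξ.2 + (0 : ℝ) • α⟩ : CotangentBundle E M) := mdifferentiableAt_proj _
  have h := mfderiv_comp (0 : ℝ) hp (mdifferentiableAt_fiberLine ξ α)
  have hc : (TotalSpace.proj : CotangentBundle E M → M) ∘
      (fun t : ℝ ↦ (⟨ξ.proj, ξ.2 + t • α⟩ : CotangentBundle E M)) = fun _ ↦ ξ.proj := rfl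
  rw [hc, mfderiv_const] at h
  have h1 := congr($h (1 : ℝ))
  rw [h0] at h1
  exact h1.symm

lemma projDeriv_surjective (ξ : CotangentBundle E M) : Function.Surjective (projDeriv ξ) := by
  intro v
  let σ : ∀ x : M, CotangentSpace E x := FiberBundle.extend (E →L[ℝ] ℝ) ξ.2
  have hσ : MDifferentiableAt 𝓘(ℝ, E) (cotangentModel E)
      (fun x ↦ (⟨x, σ x⟩ : CotangentBundle E M)) ξ.proj :=
    FiberBundle.mdifferentiableAt_extend 𝓘(ℝ, E) (E →L[ℝ] ℝ) ξ.2
  have h0 : (⟨ξ.proj, σ ξ.proj⟩ : CotangentBundle E M) = ξ := by simp [σ]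
  have hp : MDifferentiableAt (cotangentModel E) 𝓘(ℝ, E)
      (TotalSpace.proj : CotangentBundle E M → M)
      (⟨ξ.proj, σ ξ.proj⟩ : CotangentBundle E M) := mdifferentiableAt_proj _
  have h := mfderiv_comp ξ.proj hp hσ
  have hc : (TotalSpace.proj : CotangentBundle E M → M) ∘
      (fun x ↦ (⟨x, σ x⟩ : CotangentBundle E M)) = id := rfl
  rw [hc, mfderiv_id] at h
  have h1 := congr($h v)
  rw [h0] at h1
  exact ⟨_, h1.symm⟩

variable (D : CovariantDerivative 𝓘(ℝ, E) E (TangentSpace 𝓘(ℝ, E) : M → Type _))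

lemma tensorialAt_connection (ξ : CotangentBundle E M)
    (w : TangentSpace (cotangentModel E) ξ) :
    TensorialAt 𝓘(ℝ, E) E
      (fun Y : ∀ x : M, TangentSpace 𝓘(ℝ, E) x ↦
        (mvfderiv (cotangentModel E) (fiberLinear Y) ξ w - ξ.2 (D Y ξ.proj (projDeriv ξ w)) : ℝ))
      ξ.proj where
  smul {f σ} hf hσ := by
    have h := mdifferentiableAt_fiberLinear hσ
    have hf' : MDifferentiableAt (cotangentModel E) 𝓘(ℝ, ℝ)
        (fun η : CotangentBundle E M ↦ f η.proj) ξ :=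
      MDifferentiableAt.comp (I' := 𝓘(ℝ, E)) ξ hf (mdifferentiableAt_proj _)
    have e : fiberLinear (f • σ) = fun η : CotangentBundle E M ↦ f η.proj * fiberLinear σ η := by
      funext η
      simp [fiberLinear]
    have hd : mvfderiv (cotangentModel E) (fun η : CotangentBundle E M ↦ f η.proj) ξ w
        = mvfderiv 𝓘(ℝ, E) f ξ.proj (projDeriv ξ w) := by
      have := mfderiv_comp (I' := 𝓘(ℝ, E)) ξ hf
        (mdifferentiableAt_proj (CotangentSpace E : M → Type _))
      exact congr($this w)
    rw [e, mvfderiv_fun_mul hf' h, D.isCovariantDerivativeOn.leibniz hσ hf]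
    simp [hd, fiberLinear]
    ring
  add {σ σ'} hσ hσ' := by
    have e : fiberLinear (σ + σ')
        = fun η : CotangentBundle E M ↦ fiberLinear σ η + fiberLinear σ' η := by
      funext η
      simp [fiberLinear]
    rw [e, mvfderiv_fun_add (mdifferentiableAt_fiberLinear hσ)
      (mdifferentiableAt_fiberLinear hσ'), D.isCovariantDerivativeOn.add hσ hσ']
    simp
    ring

variable [FiniteDimensional ℝ E]

/-- The connection map `K_ξ : T_ξ N → T*_p M` of the linear connection induced by `D` on `T*M`. It is
determined by `K_ξ(w)(Y_p) = w(η ↦ η(Y)) - ξ(D_{dπ w} Y)` for all vector fields `Y` on `M`. -/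
def connectionMap (ξ : CotangentBundle E M) :
    TangentSpace (cotangentModel E) ξ →ₗ[ℝ] CotangentSpace E ξ.proj where
  toFun w := TensorialAt.mkHom _ ξ.proj (tensorialAt_connection D ξ w)
  map_add' w w' := by
    ext v
    rw [add_apply]
    simp only [TensorialAt.mkHom_apply_eq_extend, ContinuousLinearMap.map_add]
    ring
  map_smul' c w := by
    ext v
    rw [smul_apply]
    simp only [TensorialAt.mkHom_apply_eq_extend, ContinuousLinearMap.map_smul, RingHom.id_apply,
      smul_eq_mul]
    ring

lemma connectionMap_apply (ξ : CotangentBundle E M) (w : TangentSpace (cotangentModel E) ξ)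
    {Y : ∀ x : M, TangentSpace 𝓘(ℝ, E) x} (hY : MDiffAt (T% Y) ξ.proj) :
    connectionMap D ξ w (Y ξ.proj) =
      mvfderiv (cotangentModel E) (fiberLinear Y) ξ w - ξ.2 (D Y ξ.proj (projDeriv ξ w)) :=
  TensorialAt.mkHom_apply _ hY

/-- The horizontal space of `D` at `ξ ∈ T*M`. -/
def horizontalSpace (ξ : CotangentBundle E M) :
    Submodule ℝ (TangentSpace (cotangentModel E) ξ) :=
  LinearMap.ker (connectionMap D ξ)

lemma connectionMap_verticalLift (ξ : CotangentBundle E M) (α : CotangentSpace E ξ.proj) :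
    connectionMap D ξ (verticalLift ξ α) = α := by
  ext v
  let Y : ∀ x : M, TangentSpace 𝓘(ℝ, E) x := FiberBundle.extend E v
  have hY : MDiffAt (T% Y) ξ.proj := FiberBundle.mdifferentiableAt_extend 𝓘(ℝ, E) E v
  have hv : Y ξ.proj = v := by simp [Y]
  have h0 : (⟨ξ.proj, ξ.2 + (0 : ℝ) • α⟩ : CotangentBundle E M) = ξ := by simp
  have hp : MDifferentiableAt (cotangentModel E) 𝓘(ℝ, ℝ) (fiberLinear Y)
      (⟨ξ.proj, ξ.2 + (0 : ℝ) • α⟩ : CotangentBundle E M) := mdifferentiableAt_fiberLinear hY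
  have h := mfderiv_comp (0 : ℝ) hp (mdifferentiableAt_fiberLine ξ α)
  have hc : (fiberLinear Y) ∘ (fun t : ℝ ↦ (⟨ξ.proj, ξ.2 + t • α⟩ : CotangentBundle E M))
      = fun t : ℝ ↦ (ξ.2 v : ℝ) + t * (α v : ℝ) := by
    funext t
    simp [fiberLinear, hv]
  have hd : HasDerivAt (fun t : ℝ ↦ (ξ.2 v : ℝ) + t * (α v : ℝ)) (α v : ℝ) 0 := by
    simpa using ((hasDerivAt_id (0 : ℝ)).mul_const (α v : ℝ)).const_add (ξ.2 v : ℝ)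
  rw [hc, mfderiv_eq_fderiv, hd.hasFDerivAt.fderiv] at h
  have h1 := congr($h (1 : ℝ))
  rw [h0] at h1
  have h2 : mvfderiv (cotangentModel E) (fiberLinear Y) ξ (verticalLift ξ α) = (α v : ℝ) := by
    refine Eq.trans h1.symm ?_
    simp
  have h3 := connectionMap_apply D ξ (verticalLift ξ α) hY
  rw [hv, h2, projDeriv_verticalLift] at h3
  rw [h3]
  simp

lemma splitting_bijective (ξ : CotangentBundle E M) :
    Function.Bijective ((projDeriv ξ).toLinearMap.prod (connectionMap D ξ)) := by
  have hs : Function.Surjective ((projDeriv ξ).toLinearMap.prod (connectionMap D ξ)) := by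
    rintro ⟨v, α⟩
    obtain ⟨w, rfl⟩ := projDeriv_surjective ξ v
    refine ⟨w + verticalLift ξ (α - connectionMap D ξ w), ?_⟩
    rw [LinearMap.prod_apply]
    refine Prod.ext ?_ ?_
    · exact ((projDeriv ξ).map_add _ _).trans (by rw [projDeriv_verticalLift, add_zero])
    · exact ((connectionMap D ξ).map_add _ _).trans
        (by rw [connectionMap_verticalLift, add_sub_cancel])
  refine ⟨?_, hs⟩
  have : FiniteDimensional ℝ (TangentSpace (cotangentModel E) ξ) :=
    inferInstanceAs (FiniteDimensional ℝ (E × (E →L[ℝ] ℝ)))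
  have : FiniteDimensional ℝ (TangentSpace 𝓘(ℝ, E) ξ.proj × CotangentSpace E ξ.proj) :=
    inferInstanceAs (FiniteDimensional ℝ (E × (E →L[ℝ] ℝ)))
  refine (LinearMap.injective_iff_surjective_of_finrank_eq_finrank ?_).2 hs
  rfl

/-- The canonical identification `T_ξ N ≅ T_p M ⊕ T*_p M` determined by the connection `D`: it
identifies the horizontal space with `T_p M` by means of `dπ`, and the vertical space `ker dπ` with
`T*_p M` by means of the vertical lift. -/
def splitting (ξ : CotangentBundle E M) :
    TangentSpace (cotangentModel E) ξ ≃L[ℝ]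
      TangentSpace 𝓘(ℝ, E) ξ.proj × CotangentSpace E ξ.proj :=
  haveI : FiniteDimensional ℝ (TangentSpace (cotangentModel E) ξ) :=
    inferInstanceAs (FiniteDimensional ℝ (E × (E →L[ℝ] ℝ)))
  haveI : T2Space (TangentSpace (cotangentModel E) ξ) :=
    inferInstanceAs (T2Space (E × (E →L[ℝ] ℝ)))
  haveI : T2Space (TangentSpace 𝓘(ℝ, E) ξ.proj × CotangentSpace E ξ.proj) :=
    inferInstanceAs (T2Space (E × (E →L[ℝ] ℝ)))
  (LinearEquiv.ofBijective _ (splitting_bijective D ξ)).toContinuousLinearEquiv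

lemma splitting_apply (ξ : CotangentBundle E M) (w : TangentSpace (cotangentModel E) ξ) :
    splitting D ξ w = (projDeriv ξ w, connectionMap D ξ w) := rfl

/-! ## The structures on the cotangent bundle -/

/-- The endomorphism field `J^D = diag(J, J*)` of `N = T*M`, with respect to the splitting of `TN`
determined by `D`; here `J* α = α ∘ J`. -/
def cotangentJ (J : EndField 𝓘(ℝ, E) M) : EndField (cotangentModel E) (CotangentBundle E M) :=
  fun ξ ↦ (splitting D ξ).symm.toContinuousLinearMap ∘L
    ((J ξ.proj).prodMap (ContinuousLinearMap.precomp ℝ (J ξ.proj))) ∘L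
    (splitting D ξ).toContinuousLinearMap

/-- The endomorphism field `(v, α) ↦ (Ω⁻¹ α, Ω v)` of `N = T*M` associated to a nondegenerate
two-form `Ω` on `M`, seen as the map `v ↦ Ω(v, ·)`, with respect to the splitting of `TN`
determined by `D`. -/
def cotangentOmega (Ω : BilinField 𝓘(ℝ, E) M) :
    EndField (cotangentModel E) (CotangentBundle E M) :=
  fun ξ ↦ (splitting D ξ).symm.toContinuousLinearMap ∘L
    (((Ω ξ.proj).inverse ∘L ContinuousLinearMap.snd ℝ _ _).prod
      (Ω ξ.proj ∘L ContinuousLinearMap.fst ℝ _ _)) ∘L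
    (splitting D ξ).toContinuousLinearMap

/-- The pull-back of a bilinear form under a linear map. -/
def pullbackForm {V W : Type*} [AddCommGroup V] [Module ℝ V] [TopologicalSpace V]
    [IsTopologicalAddGroup V] [ContinuousSMul ℝ V]
    [AddCommGroup W] [Module ℝ W] [TopologicalSpace W]
    [IsTopologicalAddGroup W] [ContinuousSMul ℝ W]
    (b : W →L[ℝ] W →L[ℝ] ℝ) (A : V →L[ℝ] W) : V →L[ℝ] V →L[ℝ] ℝ :=
  ContinuousLinearMap.precomp ℝ A ∘L b ∘L A

/-- The field of bilinear forms `g_N = diag(g, -g⁻¹)` on `N = T*M`, with respect to the splitting of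
`TN` determined by `D`; here `g⁻¹(α, β) = g(g⁻¹ α, g⁻¹ β)` is the form on `T*_p M` which corresponds
to `g` under the isomorphism `v ↦ g(v, ·)` of `T_p M` with `T*_p M`. -/
def cotangentMetric (g : BilinField 𝓘(ℝ, E) M) :
    BilinField (cotangentModel E) (CotangentBundle E M) :=
  fun ξ ↦ pullbackForm (g ξ.proj)
      (ContinuousLinearMap.fst ℝ _ _ ∘L (splitting D ξ).toContinuousLinearMap)
    - pullbackForm (g ξ.proj)
      ((g ξ.proj).inverse ∘L ContinuousLinearMap.snd ℝ _ _ ∘L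
        (splitting D ξ).toContinuousLinearMap)

end Cotangent

/-! ## The canonical complex structure of the cotangent bundle -/

section Canonical

variable {E : Type*} [NormedAddCommGroup E] [NormedSpace ℝ E]
  {M : Type*} [TopologicalSpace M] [ChartedSpace E M] [IsManifold 𝓘(ℝ, E) ∞ M]

/-- The local coordinates `η ↦ (e(π η), η ∘ (de)⁻¹)` of `T*M` induced by local coordinates `e` of
`M`. -/
def cotangentChart (e : OpenPartialHomeomorph M E) (η : CotangentBundle E M) :
    E × (E →L[ℝ] ℝ) :=
  (e η.proj, η.2 ∘L (mvfderiv 𝓘(ℝ, E) e η.proj).inverse)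

/-- `JN` is the canonical complex structure of the cotangent bundle of the complex manifold `(M, J)`:
for each local holomorphic coordinate system `z = e` on `M`, with values in `(E, j)`, the induced
coordinates `(z, w)` of `T*M` are holomorphic for `JN`, where the fiber coordinate `w` takes its
values in the complex vector space `(E*, j*)`, `j* β = β ∘ j`. -/
def IsCanonicalComplexStructure (J : EndField 𝓘(ℝ, E) M)
    (JN : EndField (cotangentModel E) (CotangentBundle E M)) : Prop :=
  ∀ (e : OpenPartialHomeomorph M E) (j : E →L[ℝ] E), IsHolomorphicChart J e j →
    ∀ ξ : CotangentBundle E M, ξ.proj ∈ e.source →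
    ∀ w : TangentSpace (cotangentModel E) ξ,
      mvfderiv (cotangentModel E) (cotangentChart e) ξ (JN ξ w) =
        (j (mvfderiv (cotangentModel E) (cotangentChart e) ξ w).1,
          (mvfderiv (cotangentModel E) (cotangentChart e) ξ w).2 ∘L j)

end Canonical

end

/-! ## Integrable total differential equations -/

section Frobenius

open Metric Set Filter Topology

variable {E : Type*} [NormedAddCommGroup E] [NormedSpace ℝ E]
  {W : Type*} [NormedAddCommGroup W] [NormedSpace ℝ W]
  {Q : Type*} [NormedAddCommGroup Q] [NormedSpace ℝ Q]

/-- Near a point where `f` is twice continuously differentiable, `f` and its derivative are bounded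
and the remainder of the first order Taylor expansion is quadratic, uniformly in the base point. -/
theorem ContDiffAt.exists_quadratic_remainder {f : Q → W} {q₀ : Q} (hf : ContDiffAt ℝ 2 f q₀)
    {O : Set Q} (hO : O ∈ 𝓝 q₀) :
    ∃ K > (0 : ℝ), ∃ R > (0 : ℝ), ∀ q ∈ closedBall q₀ R, q ∈ O ∧ DifferentiableAt ℝ f q ∧
      ‖f q‖ ≤ K ∧ ‖fderiv ℝ f q‖ ≤ K ∧
      ∀ q' ∈ closedBall q₀ R, ‖f q' - f q - fderiv ℝ f q (q' - q)‖ ≤ K * ‖q' - q‖ ^ 2 := by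
  have hd : ContDiffAt ℝ 1 (fderiv ℝ f) q₀ := hf.fderiv_right (by norm_num)
  obtain ⟨C, s, hs, hC⟩ := hd.exists_lipschitzOnWith
  have h1 : ∀ᶠ q in 𝓝 q₀, DifferentiableAt ℝ f q := by
    filter_upwards [hf.eventually (by simp)] with q hq
    exact hq.differentiableAt (by simp)
  have h2 : ∀ᶠ q in 𝓝 q₀, ‖f q‖ ≤ ‖f q₀‖ + 1 :=
    (hf.continuousAt.norm.eventually (gt_mem_nhds (lt_add_one _))).mono fun _ h ↦ le_of_lt h
  have h3 : ∀ᶠ q in 𝓝 q₀, ‖fderiv ℝ f q‖ ≤ ‖fderiv ℝ f q₀‖ + 1 :=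
    (hd.continuousAt.norm.eventually (gt_mem_nhds (lt_add_one _))).mono fun _ h ↦ le_of_lt h
  obtain ⟨R, hR, hball⟩ := nhds_basis_closedBall.eventually_iff.1
    (((h1.and h2).and h3).and ((eventually_mem_set.2 hs).and (eventually_mem_set.2 hO)))
  refine ⟨‖f q₀‖ + ‖fderiv ℝ f q₀‖ + 1 + C, by positivity, R, hR, fun q hq ↦ ?_⟩
  obtain ⟨⟨⟨hq1, hq2⟩, hq3⟩, hq4, hq5⟩ := hball hq
  have hC0 : (0 : ℝ) ≤ C := C.2
  refine ⟨hq5, hq1, ?_, ?_, fun q' hq' ↦ ?_⟩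
  · linarith [norm_nonneg (fderiv ℝ f q₀)]
  · linarith [norm_nonneg (f q₀)]
  have hseg : segment ℝ q q' ⊆ closedBall q₀ R := (convex_closedBall q₀ R).segment_subset hq hq'
  have key := (convex_segment (𝕜 := ℝ) q q').norm_image_sub_le_of_norm_hasFDerivWithin_le'
    (f := f) (f' := fderiv ℝ f) (φ := fderiv ℝ f q) (C := C * ‖q' - q‖)
    (fun z hz ↦ (hball (hseg hz)).1.1.1.hasFDerivAt.hasFDerivWithinAt)
    (fun z hz ↦ by
      refine (hC.norm_sub_le (hball (hseg hz)).2.1 hq4).trans ?_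
      gcongr
      obtain ⟨t, ht, rfl⟩ := (segment_eq_image' ℝ q q' ▸ hz :
        z ∈ (fun θ : ℝ ↦ q + θ • (q' - q)) '' Icc 0 1)
      simp only [add_sub_cancel_left, norm_smul, Real.norm_eq_abs, abs_of_nonneg ht.1]
      exact mul_le_of_le_one_left (norm_nonneg _) ht.2)
    (left_mem_segment ℝ q q') (right_mem_segment ℝ q q')
  refine key.trans ?_
  rw [mul_assoc, ← sq]
  gcongr
  have := norm_nonneg (f q₀)
  have := norm_nonneg (fderiv ℝ f q₀)
  linarith

/-- The Picard-Lindelöf theorem, together with the fact that the solution stays in the ball on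
which the vector field is controlled. -/
theorem IsPicardLindelof.exists_solution_mem_closedBall [CompleteSpace W] {f : ℝ → W → W}
    {tmin tmax : ℝ} {t₀ : Icc tmin tmax} {x₀ : W} {a L K : NNReal}
    (hf : IsPicardLindelof f t₀ x₀ a 0 L K) :
    ∃ α : ℝ → W, α t₀ = x₀ ∧ (∀ t, α t ∈ closedBall x₀ a) ∧
      ∀ t ∈ Icc tmin tmax, HasDerivWithinAt α (f t (α t)) (Icc tmin tmax) t := by
  have hx : x₀ ∈ closedBall x₀ ((0 : NNReal) : ℝ) := mem_closedBall_self le_rfl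
  obtain ⟨α, hα⟩ := ODE.FunSpace.exists_isFixedPt_next hf hx
  refine ⟨α.compProj, by rw [ODE.FunSpace.compProj_val, ← hα, ODE.FunSpace.next_apply₀],
    fun t ↦ α.compProj_mem_closedBall hf.mul_max_le, fun t ht ↦ ?_⟩
  apply ODE.hasDerivWithinAt_picard_Icc t₀.2 hf.continuousOn_uncurry
    α.continuous_compProj.continuousOn (fun _ ht' ↦ α.compProj_mem_closedBall hf.mul_max_le)
    x₀ ht |>.congr_of_mem _ ht
  intro t' ht'
  nth_rw 1 [← hα]
  rw [ODE.FunSpace.compProj_of_mem ht', ODE.FunSpace.next_apply]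

lemma gronwallBound_zero_mul (K ε c x : ℝ) :
    gronwallBound 0 K (ε * c) x = gronwallBound 0 K ε x * c := by
  unfold gronwallBound
  split_ifs <;> ring

/-- The total differential equation `dσ_x = φ(x, σ(x))` has a local solution with
`σ(x₀) = w₀`, provided that it satisfies the Frobenius integrability condition. -/
theorem exists_eventually_hasFDerivAt_of_integrable [CompleteSpace W] {φ : E × W → E →L[ℝ] W}
    {x₀ : E} {w₀ : W} (hφ : ContDiffAt ℝ 2 φ (x₀, w₀))
    (hint : ∀ᶠ q in 𝓝 (x₀, w₀), ∀ u v,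
      fderiv ℝ φ q (u, φ q u) v = fderiv ℝ φ q (v, φ q v) u) :
    ∃ σ : E → W, σ x₀ = w₀ ∧ ∀ᶠ x in 𝓝 x₀, HasFDerivAt σ (φ (x, σ x)) x := by
  obtain ⟨K, hK, R, hR, hbd⟩ := hφ.exists_quadratic_remainder hint
  have hmem : ∀ {x w}, ‖x - x₀‖ ≤ R → ‖w - w₀‖ ≤ R → (x, w) ∈ closedBall (x₀, w₀) R := by
    intro x w hx hw
    rw [mem_closedBall, dist_eq_norm, Prod.mk_sub_mk, Prod.norm_def]
    exact max_le hx hw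
  have hlip : LipschitzOnWith ⟨K, hK.le⟩ φ (closedBall (x₀, w₀) R) :=
    (convex_closedBall _ _).lipschitzOnWith_of_nnnorm_fderiv_le (fun q hq ↦ (hbd q hq).2.1)
      (fun q hq ↦ (hbd q hq).2.2.2.1)
  set r : ℝ := min R (min 1 (R / (2 * K))) with hr
  have hr0 : 0 < r := by positivity
  have hrR : r ≤ R := min_le_left _ _
  have hr1 : r ≤ 1 := (min_le_right _ _).trans (min_le_left _ _)
  have hrK : K * r ≤ R / 2 := by
    have : r ≤ R / (2 * K) := (min_le_right _ _).trans (min_le_right _ _)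
    calc K * r ≤ K * (R / (2 * K)) := by gcongr
      _ = R / 2 := by field_simp
  have hray : ∀ {x : E} {t : ℝ}, ‖x‖ ≤ r → t ∈ Icc (0 : ℝ) 1 → ‖x₀ + t • x - x₀‖ ≤ R := by
    intro x t hx ht
    rw [add_sub_cancel_left, norm_smul, Real.norm_eq_abs, abs_of_nonneg ht.1]
    nlinarith [norm_nonneg x, ht.2]
  have hlipt : ∀ {x : E} {t : ℝ}, ‖x‖ ≤ r → t ∈ Icc (0 : ℝ) 1 →
      LipschitzOnWith ⟨K, hK.le⟩ (fun w ↦ φ (x₀ + t • x, w) x) (closedBall w₀ R) := by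
    intro x t hx ht
    refine LipschitzOnWith.of_dist_le_mul fun w hw w' hw' ↦ ?_
    rw [mem_closedBall, dist_eq_norm] at hw hw'
    have h := hlip.norm_sub_le (hmem (hray hx ht) hw) (hmem (hray hx ht) hw')
    rw [dist_eq_norm, dist_eq_norm, ← _root_.sub_apply]
    refine ((φ (x₀ + t • x, w) - φ (x₀ + t • x, w')).le_opNorm x).trans ?_
    have e : ‖((x₀ + t • x, w) : E × W) - (x₀ + t • x, w')‖ = ‖w - w'‖ := by
      simp [Prod.norm_def]
    rw [e] at h
    calc _ ≤ (K * ‖w - w'‖) * 1 := by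
          gcongr
          · exact h
          · exact hx.trans hr1
      _ = _ := mul_one _
  have hode : ∀ x : E, ‖x‖ ≤ r → ∃ y : ℝ → W, y 0 = w₀ ∧ (∀ t, ‖y t - w₀‖ ≤ R / 2) ∧
      ∀ t ∈ Icc (0 : ℝ) 1, HasDerivWithinAt y (φ (x₀ + t • x, y t) x) (Icc 0 1) t := by
    intro x hx
    have hpl : IsPicardLindelof (fun t w ↦ φ (x₀ + t • x, w) x)
        (⟨0, by simp⟩ : Icc (0 : ℝ) 1) w₀ ⟨R / 2, by positivity⟩ 0 ⟨K * r, by positivity⟩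
        ⟨K, hK.le⟩ := by
      refine ⟨fun t ht ↦ (hlipt hx ht).mono (closedBall_subset_closedBall ?_), fun w hw ↦ ?_,
        fun t ht w hw ↦ ?_, ?_⟩
      · change R / 2 ≤ R
        linarith
      · refine ContinuousOn.clm_apply ?_ continuousOn_const
        refine hlip.continuousOn.comp (by fun_prop) fun t ht ↦ hmem (hray hx ht) ?_
        rw [← dist_eq_norm]
        refine (mem_closedBall.1 hw).trans ?_
        change R / 2 ≤ R
        linarith
      · have hw' : ‖w - w₀‖ ≤ R := by
          rw [← dist_eq_norm]
          refine (mem_closedBall.1 hw).trans ?_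
          change R / 2 ≤ R
          linarith
        refine ((φ _).le_opNorm x).trans ?_
        change _ ≤ K * r
        have := (hbd _ (hmem (hray hx ht) hw')).2.2.1
        gcongr
      · change K * r * max (1 - 0) (0 - 0) ≤ R / 2 - 0
        simpa using hrK
    obtain ⟨y, hy0, hy1, hy2⟩ := hpl.exists_solution_mem_closedBall
    exact ⟨y, hy0, fun t ↦ (dist_eq_norm (y t) w₀).symm.trans_le (hy1 t), hy2⟩
  choose! y hy0 hyR hy using hode
  have hyt : ∀ {x : E} {t : ℝ}, ‖x‖ ≤ r → t ∈ Icc (0 : ℝ) 1 →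
      (x₀ + t • x, y x t) ∈ closedBall (x₀, w₀) R := fun {x t} hx ht ↦
    hmem (hray hx ht) ((hyR x hx t).trans (by linarith))
  have main : ∀ x : E, ‖x‖ < r → ∀ v : E, ‖x + v‖ ≤ r → K * ‖v‖ ≤ R / 2 →
      ‖y (x + v) 1 - (y x 1 + φ (x₀ + x, y x 1) v)‖ ≤
        gronwallBound 0 K (K * (1 + K) ^ 2 + K * (1 + K)) 1 * ‖v‖ ^ 2 := by
    intro x hx v hxv hv
    set q : ℝ → E × W := fun t ↦ (x₀ + t • x, y x t) with hq
    set Φ : ℝ → W := fun t ↦ y x t + t • φ (q t) v with hΦ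
    set Φ' : ℝ → W := fun t ↦ φ (q t) x +
      (t • fderiv ℝ φ (q t) (x, φ (q t) x) v + (1 : ℝ) • φ (q t) v) with hΦ'
    have hqmem : ∀ t ∈ Icc (0 : ℝ) 1, q t ∈ closedBall (x₀, w₀) R := fun t ht ↦ hyt hx.le ht
    have hdq : ∀ t ∈ Icc (0 : ℝ) 1, HasDerivWithinAt q (x, φ (q t) x) (Icc 0 1) t := by
      intro t ht
      refine HasDerivWithinAt.prodMk ?_ (hy x hx.le t ht)
      simpa using (((hasDerivAt_id t).smul_const x).const_add x₀).hasDerivWithinAt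
    have hdΦ : ∀ t ∈ Icc (0 : ℝ) 1, HasDerivWithinAt Φ (Φ' t) (Icc 0 1) t := by
      intro t ht
      refine (hy x hx.le t ht).add ?_
      refine (hasDerivAt_id t).hasDerivWithinAt.smul ?_
      have h1 := (hbd _ (hqmem t ht)).2.1.hasFDerivAt.comp_hasDerivWithinAt t (hdq t ht)
      simpa using h1.clm_apply (hasDerivWithinAt_const t (Icc (0 : ℝ) 1) v)
    have hright : ∀ t ∈ Ico (0 : ℝ) 1, Icc (0 : ℝ) 1 ∈ 𝓝[≥] t := fun t ht ↦
      mem_of_superset (Icc_mem_nhdsGE ht.2) (Icc_subset_Icc_left ht.1)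
    have hφv : ∀ t ∈ Icc (0 : ℝ) 1, ‖φ (q t) v‖ ≤ K * ‖v‖ := fun t ht ↦
      ((φ (q t)).le_opNorm v).trans (by gcongr; exact (hbd _ (hqmem t ht)).2.2.1)
    have hΦR : ∀ t ∈ Icc (0 : ℝ) 1, ‖Φ t - w₀‖ ≤ R := by
      intro t ht
      have h1 := hyR x hx.le t
      have h2 : ‖t • φ (q t) v‖ ≤ K * ‖v‖ := by
        rw [norm_smul, Real.norm_eq_abs, abs_of_nonneg ht.1]
        exact (mul_le_of_le_one_left (norm_nonneg _) ht.2).trans (hφv t ht)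
      have h3 : Φ t - w₀ = (y x t - w₀) + t • φ (q t) v := by simp only [hΦ]; abel
      rw [h3]
      exact (norm_add_le _ _).trans (by linarith)
    have hbound : ∀ t ∈ Ico (0 : ℝ) 1, dist (Φ' t) (φ (x₀ + t • (x + v), Φ t) (x + v)) ≤
        (K * (1 + K) ^ 2 + K * (1 + K)) * ‖v‖ ^ 2 := by
      intro t ht'
      have ht := Ico_subset_Icc_self ht'
      set h : E × W := (v, φ (q t) v) with hh
      have hhn : ‖t • h‖ ≤ (1 + K) * ‖v‖ := by
        rw [norm_smul, Real.norm_eq_abs, abs_of_nonneg ht.1]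
        refine (mul_le_of_le_one_left (norm_nonneg _) ht.2).trans ?_
        rw [hh, Prod.norm_def]
        have := hφv t ht
        have := norm_nonneg v
        exact max_le (by nlinarith) (by nlinarith)
      have hq' : ((x₀ + t • (x + v), Φ t) : E × W) = q t + t • h := by
        simp only [hq, hh, hΦ, Prod.smul_mk, Prod.mk_add_mk, smul_add, add_assoc]
      have hq'mem : q t + t • h ∈ closedBall (x₀, w₀) R := by
        rw [← hq']
        exact hmem (hray hxv ht) (hΦR t ht)
      have hTay := (hbd _ (hqmem t ht)).2.2.2.2 _ hq'mem
      rw [add_sub_cancel_left] at hTay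
      have hsym := (hbd _ (hqmem t ht)).1 x v
      have e : Φ' t - φ (x₀ + t • (x + v), Φ t) (x + v) =
          -((φ (q t + t • h) - φ (q t) - fderiv ℝ φ (q t) (t • h)) (x + v))
            - fderiv ℝ φ (q t) (t • h) v := by
        rw [hq']
        simp only [hΦ', hsym, _root_.sub_apply, map_add, map_smul, _root_.smul_apply, ← hh]
        module
      rw [dist_eq_norm, e]
      refine (norm_sub_le _ _).trans ?_
      rw [norm_neg, add_mul]
      refine add_le_add ?_ ?_
      · refine (ContinuousLinearMap.le_opNorm _ _).trans ?_
        calc _ ≤ (K * ((1 + K) * ‖v‖) ^ 2) * 1 := by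
              gcongr
              · exact hTay.trans (by gcongr)
              · exact hxv.trans hr1
          _ = _ := by ring
      · refine (ContinuousLinearMap.le_opNorm _ _).trans ?_
        calc _ ≤ (K * ((1 + K) * ‖v‖)) * ‖v‖ := by
              gcongr
              refine (ContinuousLinearMap.le_opNorm _ _).trans ?_
              gcongr
              exact (hbd _ (hqmem t ht)).2.2.2.1
          _ = _ := by ring
    have hG := dist_le_of_approx_trajectories_ODE_of_mem (K := ⟨K, hK.le⟩)
      (v := fun t w ↦ φ (x₀ + t • (x + v), w) (x + v)) (s := fun _ ↦ closedBall w₀ R)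
      (f := y (x + v)) (g := Φ) (a := 0) (b := 1) (δ := 0) (εf := 0)
      (f' := fun t ↦ φ (x₀ + t • (x + v), y (x + v) t) (x + v)) (g' := Φ')
      (fun t ht ↦ hlipt hxv (Ico_subset_Icc_self ht))
      (HasDerivWithinAt.continuousOn (hy _ hxv))
      (fun t ht ↦ (hy _ hxv t (Ico_subset_Icc_self ht)).mono_of_mem_nhdsWithin (hright t ht))
      (fun t ht ↦ by simp)
      (fun t ht ↦ by
        rw [mem_closedBall, dist_eq_norm]
        exact (hyR _ hxv t).trans (by linarith))
      (HasDerivWithinAt.continuousOn hdΦ)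
      (fun t ht ↦ (hdΦ t (Ico_subset_Icc_self ht)).mono_of_mem_nhdsWithin (hright t ht))
      hbound
      (fun t ht ↦ by
        rw [mem_closedBall, dist_eq_norm]
        exact hΦR t (Ico_subset_Icc_self ht))
      (by simp [hΦ, hy0 _ hxv, hy0 _ hx.le]) 1 (by simp)
    rw [zero_add, sub_zero, dist_eq_norm, gronwallBound_zero_mul] at hG
    have e : Φ 1 = y x 1 + φ (x₀ + x, y x 1) v := by simp [hΦ, hq]
    rw [e] at hG
    exact hG
  refine ⟨fun z ↦ y (z - x₀) 1, ?_, ?_⟩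
  · have h0 : ‖(0 : E)‖ ≤ r := by simpa using hr0.le
    have hconst := dist_le_of_trajectories_ODE_of_mem (K := ⟨K, hK.le⟩)
      (v := fun t w ↦ φ (x₀ + t • (0 : E), w) 0) (s := fun _ ↦ closedBall w₀ R)
      (f := y 0) (g := fun _ ↦ w₀) (a := 0) (b := 1) (δ := 0)
      (fun t ht ↦ hlipt h0 (Ico_subset_Icc_self ht))
      (HasDerivWithinAt.continuousOn (hy _ h0))
      (fun t ht ↦ (hy _ h0 t (Ico_subset_Icc_self ht)).mono_of_mem_nhdsWithin
        (mem_of_superset (Icc_mem_nhdsGE ht.2) (Icc_subset_Icc_left ht.1)))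
      (fun t ht ↦ by
        rw [mem_closedBall, dist_eq_norm]
        exact (hyR _ h0 t).trans (by linarith))
      continuousOn_const
      (fun t ht ↦ by simpa using hasDerivWithinAt_const t (Ici t) w₀)
      (fun t ht ↦ mem_closedBall_self hR.le)
      (by simp [hy0 _ h0]) 1 (by simp)
    simpa using hconst
  · filter_upwards [ball_mem_nhds x₀ hr0] with z hz
    rw [mem_ball, dist_eq_norm] at hz
    rw [hasFDerivAt_iff_isLittleO_nhds_zero]
    refine Asymptotics.IsBigO.trans_isLittleO (g := fun v : E ↦ ‖v‖ ^ 2) ?_ ?_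
    · refine Asymptotics.IsBigO.of_bound
        (gronwallBound 0 K (K * (1 + K) ^ 2 + K * (1 + K)) 1) ?_
      have hε : 0 < min (r - ‖z - x₀‖) (R / (2 * K)) :=
        lt_min (by linarith) (by positivity)
      filter_upwards [ball_mem_nhds (0 : E) hε] with v hv
      rw [mem_ball_zero_iff, lt_min_iff] at hv
      have hKv : K * ‖v‖ ≤ R / 2 := by
        calc K * ‖v‖ ≤ K * (R / (2 * K)) := by gcongr; exact hv.2.le
          _ = R / 2 := by field_simp
      have h := main (z - x₀) hz v ((norm_add_le _ _).trans (by linarith [hv.1])) hKv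
      rw [add_sub_cancel, ← sub_sub, show z - x₀ + v = z + v - x₀ by abel] at h
      simpa using h
    · simpa using (Asymptotics.isLittleO_norm_pow_id (E' := E) one_lt_two)

/-- A local solution of a smooth integrable total differential equation is smooth. -/
theorem exists_contDiffOn_hasFDerivAt_of_integrable [CompleteSpace W] {φ : E × W → E →L[ℝ] W}
    {O : Set (E × W)} (hO : IsOpen O) (hφ : ContDiffOn ℝ ∞ φ O)
    (hint : ∀ q ∈ O, ∀ u v, fderiv ℝ φ q (u, φ q u) v = fderiv ℝ φ q (v, φ q v) u)
    {x₀ : E} {w₀ : W} (h₀ : (x₀, w₀) ∈ O) :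
    ∃ (σ : E → W) (U : Set E), IsOpen U ∧ x₀ ∈ U ∧ σ x₀ = w₀ ∧ ContDiffOn ℝ ∞ σ U ∧
      ∀ x ∈ U, (x, σ x) ∈ O ∧ HasFDerivAt σ (φ (x, σ x)) x := by
  obtain ⟨σ, hσ₀, hσ⟩ := exists_eventually_hasFDerivAt_of_integrable
    ((hφ.contDiffAt (hO.mem_nhds h₀)).of_le (by norm_cast))
    (by filter_upwards [hO.mem_nhds h₀] with q hq using hint q hq)
  have hmem : ∀ᶠ x in 𝓝 x₀, (x, σ x) ∈ O := by
    have hc : ContinuousAt (fun x ↦ (x, σ x)) x₀ :=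
      continuousAt_id.prodMk hσ.self_of_nhds.continuousAt
    exact hc.eventually_mem (by rw [hσ₀]; exact hO.mem_nhds h₀)
  obtain ⟨U, hU, hUo, hxU⟩ := _root_.eventually_nhds_iff.1 (hmem.and hσ)
  refine ⟨σ, U, hUo, hxU, hσ₀, ?_, hU⟩
  rw [contDiffOn_infty]
  intro n
  induction n with
  | zero =>
    rw [Nat.cast_zero, contDiffOn_zero]
    exact fun x hx ↦ (hU x hx).2.continuousAt.continuousWithinAt
  | succ n ih =>
    rw [Nat.cast_succ, contDiffOn_succ_iff_fderiv_of_isOpen hUo]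
    refine ⟨fun x hx ↦ (hU x hx).2.differentiableAt.differentiableWithinAt, by simp, ?_⟩
    refine ContDiffOn.congr (f := fun x ↦ φ (x, σ x)) ?_ fun x hx ↦ (hU x hx).2.fderiv
    exact (hφ.of_le (by norm_cast; exact le_top)).comp (contDiffOn_id.prodMk ih)
      fun x hx ↦ (hU x hx).1

lemma DifferentiableAt.fderiv_clm_apply_const {f : Q → E →L[ℝ] W} {q : Q}
    (hf : DifferentiableAt ℝ f q) (v : E) (h : Q) :
    fderiv ℝ (fun q ↦ f q v) q h = fderiv ℝ f q h v := by
  rw [fderiv_clm_apply hf (differentiableAt_const v)]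
  simp

end Frobenius


noncomputable section

/-! ## Calculus in smooth charts -/

section SmoothChart

open Set Filter Topology

variable {E : Type*} [NormedAddCommGroup E] [NormedSpace ℝ E]
  {H : Type*} [TopologicalSpace H] {I : ModelWithCorners ℝ E H}
  {M : Type*} [TopologicalSpace M] [ChartedSpace H M]

variable (I) in
/-- A smooth chart: a diffeomorphism between open subsets of `M` and of the model vector space. -/
structure IsSmoothChart (e : OpenPartialHomeomorph M E) : Prop where
  contMDiffOn : ContMDiffOn I 𝓘(ℝ, E) ∞ e e.source
  contMDiffOn_symm : ContMDiffOn 𝓘(ℝ, E) I ∞ e.symm e.target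

lemma IsHolomorphicChart.isSmoothChart {J : EndField I M} {e : OpenPartialHomeomorph M E}
    {j : E →L[ℝ] E} (he : IsHolomorphicChart J e j) : IsSmoothChart I e :=
  ⟨he.contMDiffOn, he.contMDiffOn_symm⟩

variable (I) in
/-- The vector field which is constant equal to `u` in the chart `e`. -/
def chartField (e : OpenPartialHomeomorph M E) (u : E) (x : M) : TangentSpace I x :=
  (mvfderiv I e x).inverse u

/-- Chain rule for the composition of a function on a normed space with a function on a manifold. -/
lemma mvfderiv_fderiv_comp {F G : Type*} [NormedAddCommGroup F] [NormedSpace ℝ F]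
    [NormedAddCommGroup G] [NormedSpace ℝ G] {x : M} {f : M → F} {h : F → G}
    (hh : DifferentiableAt ℝ h (f x)) (hf : MDifferentiableAt I 𝓘(ℝ, F) f x) :
    mvfderiv I (fun y ↦ h (f y)) x = fderiv ℝ h (f x) ∘L mvfderiv I f x := by
  have h1 := mfderiv_comp x hh.mdifferentiableAt hf
  rw [mfderiv_eq_fderiv] at h1
  exact h1

lemma mvfderiv_congr {F : Type*} [NormedAddCommGroup F] [NormedSpace ℝ F] {x : M} {f g : M → F}
    (h : f =ᶠ[𝓝 x] g) : mvfderiv I f x = mvfderiv I g x := by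
  have h1 : (mfderiv I 𝓘(ℝ, F) f x : TangentSpace I x →L[ℝ] F) = mfderiv I 𝓘(ℝ, F) g x :=
    h.mfderiv_eq
  exact h1

namespace IsSmoothChart

variable {e : OpenPartialHomeomorph M E} (he : IsSmoothChart I e) {x : M}
include he

lemma contMDiffAt (hx : x ∈ e.source) : ContMDiffAt I 𝓘(ℝ, E) ∞ e x :=
  he.contMDiffOn.contMDiffAt (e.open_source.mem_nhds hx)

lemma contMDiffAt_symm {z : E} (hz : z ∈ e.target) : ContMDiffAt 𝓘(ℝ, E) I ∞ e.symm z :=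
  he.contMDiffOn_symm.contMDiffAt (e.open_target.mem_nhds hz)

lemma mdifferentiableAt (hx : x ∈ e.source) : MDifferentiableAt I 𝓘(ℝ, E) e x :=
  (he.contMDiffAt hx).mdifferentiableAt (by simp)

lemma mdifferentiableAt_symm {z : E} (hz : z ∈ e.target) :
    MDifferentiableAt 𝓘(ℝ, E) I e.symm z :=
  (he.contMDiffAt_symm hz).mdifferentiableAt (by simp)

lemma mvfderiv_mfderiv_symm {z : E} (hz : z ∈ e.target) (u : E) :
    mvfderiv I e (e.symm z) (mfderiv 𝓘(ℝ, E) I e.symm z u) = u := by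
  have h := mfderiv_comp z (he.mdifferentiableAt (e.map_target hz)) (he.mdifferentiableAt_symm hz)
  have h1 : (e ∘ e.symm) =ᶠ[𝓝 z] id := by
    filter_upwards [e.open_target.mem_nhds hz] with y hy using e.right_inv hy
  rw [h1.mfderiv_eq, mfderiv_id] at h
  exact congr($h u).symm

lemma mfderiv_symm_mvfderiv (hx : x ∈ e.source) (v : TangentSpace I x) :
    mfderiv 𝓘(ℝ, E) I e.symm (e x) (mvfderiv I e x v) = v := by
  have h := mfderiv_comp x (he.mdifferentiableAt_symm (e.map_source hx)) (he.mdifferentiableAt hx)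
  have h1 : (e.symm ∘ e) =ᶠ[𝓝 x] id := by
    filter_upwards [e.open_source.mem_nhds hx] with y hy using e.left_inv hy
  rw [h1.mfderiv_eq, mfderiv_id] at h
  exact congr($h v).symm

lemma isInvertible (hx : x ∈ e.source) : (mvfderiv I e x).IsInvertible := by
  refine ContinuousLinearMap.IsInvertible.of_inverse
    (g := (mfderiv 𝓘(ℝ, E) I e.symm (e x) : E →L[ℝ] E)) ?_ ?_
  · ext u
    have h := he.mvfderiv_mfderiv_symm (e.map_source hx) u
    rw [e.left_inv hx] at h
    exact h
  · ext v
    exact he.mfderiv_symm_mvfderiv hx v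

lemma mvfderiv_chartField (hx : x ∈ e.source) (u : E) :
    mvfderiv I e x (chartField I e u x) = u :=
  (he.isInvertible hx).self_apply_inverse u

lemma chartField_mvfderiv (hx : x ∈ e.source) (v : TangentSpace I x) :
    chartField I e (mvfderiv I e x v) x = v :=
  (he.isInvertible hx).inverse_apply_self v

lemma mvfderiv_injective (hx : x ∈ e.source) {v w : TangentSpace I x}
    (h : mvfderiv I e x v = mvfderiv I e x w) : v = w :=
  (he.isInvertible hx).injective h

variable [IsManifold I ∞ M]

/-- The differential of a smooth chart, read in the trivialization of the tangent bundle at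
`x`, is smooth. -/
lemma contMDiffAt_mvfderiv_comp_symmL (hx : x ∈ e.source) :
    ContMDiffAt I 𝓘(ℝ, E →L[ℝ] E) ∞ (fun y ↦
      (mvfderiv I e y ∘L (trivializationAt E (TangentSpace I) x).symmL ℝ y : E →L[ℝ] E)) x := by
  have h := (he.contMDiffAt hx).mfderiv_const (m := ∞) (by simp)
  refine h.congr_of_eventuallyEq (Eventually.of_forall fun y ↦ ?_)
  ext u
  simp only [inTangentCoordinates, ContinuousLinearMap.inCoordinates]
  rw [TangentBundle.continuousLinearMapAt_model_space]
  rfl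

/-- The differential of a smooth chart, read in the trivialization of the tangent bundle at
`x`, is invertible. -/
lemma isInvertible_mvfderiv_comp_symmL {y : M} (hy : y ∈ e.source)
    (hy' : y ∈ (trivializationAt E (TangentSpace I) x).baseSet) :
    (mvfderiv I e y ∘L (trivializationAt E (TangentSpace I) x).symmL ℝ y :
      E →L[ℝ] E).IsInvertible := by
  refine (he.isInvertible hy).comp
    ⟨((trivializationAt E (TangentSpace I) x).continuousLinearEquivAt ℝ y hy').symm, ?_⟩
  ext u
  exact congrFun (Trivialization.symm_continuousLinearEquivAt_eq _ hy') u

lemma contMDiffAt_inverse_mvfderiv_comp_symmL [CompleteSpace E] (hx : x ∈ e.source) :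
    ContMDiffAt I 𝓘(ℝ, E →L[ℝ] E) ∞ (fun y ↦
      (mvfderiv I e y ∘L (trivializationAt E (TangentSpace I) x).symmL ℝ y :
        E →L[ℝ] E).inverse) x := by
  obtain ⟨A, hA⟩ := he.isInvertible_mvfderiv_comp_symmL hx
    (FiberBundle.mem_baseSet_trivializationAt' x)
  have h := contDiffAt_map_inverse (n := ∞) A
  rw [hA] at h
  exact h.contMDiffAt.comp x (he.contMDiffAt_mvfderiv_comp_symmL hx)

omit he in
lemma eventually_mem_baseSet : ∀ᶠ y in 𝓝 x,
    y ∈ (trivializationAt E (TangentSpace I : M → Type _) x).baseSet :=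
  (trivializationAt E (TangentSpace I : M → Type _) x).open_baseSet.mem_nhds
    (FiberBundle.mem_baseSet_trivializationAt' x)

omit he in
lemma mvfderiv_comp_symmL_trivialization {y : M}
    (hy : y ∈ (trivializationAt E (TangentSpace I : M → Type _) x).baseSet)
    (v : TangentSpace I y) :
    (mvfderiv I e y ∘L (trivializationAt E (TangentSpace I) x).symmL ℝ y : E →L[ℝ] E)
      (trivializationAt E (TangentSpace I : M → Type _) x ⟨y, v⟩).2 = mvfderiv I e y v := by
  have h := (trivializationAt E (TangentSpace I : M → Type _) x).symmL_continuousLinearMapAt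
    (R := ℝ) hy v
  rw [Trivialization.continuousLinearMapAt_apply, Trivialization.linearMapAt_apply,
    if_pos hy] at h
  rw [ContinuousLinearMap.comp_apply]
  exact congrArg _ h

/-- A vector field is smooth iff its representation in a smooth chart is smooth. -/
lemma contMDiffAt_section_iff [CompleteSpace E] (hx : x ∈ e.source)
    {Y : ∀ y : M, TangentSpace I y} :
    ContMDiffAt I (I.prod 𝓘(ℝ, E)) ∞ (T% Y) x ↔
      ContMDiffAt I 𝓘(ℝ, E) ∞ (fun y ↦ mvfderiv I e y (Y y)) x := by
  rw [contMDiffAt_section]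
  constructor
  · intro h
    refine ((he.contMDiffAt_mvfderiv_comp_symmL hx).clm_apply h).congr_of_eventuallyEq ?_
    filter_upwards [eventually_mem_baseSet (I := I)] with y hy
    exact (mvfderiv_comp_symmL_trivialization hy _).symm
  · intro h
    refine ((he.contMDiffAt_inverse_mvfderiv_comp_symmL hx).clm_apply h).congr_of_eventuallyEq ?_
    filter_upwards [eventually_mem_baseSet (I := I), e.open_source.mem_nhds hx] with y hy hy'
    rw [← mvfderiv_comp_symmL_trivialization (x := x) hy,
      (he.isInvertible_mvfderiv_comp_symmL hy' hy).inverse_apply_self]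

/-- A vector field is differentiable iff its representation in a smooth chart is. -/
lemma mdifferentiableAt_section_iff [CompleteSpace E] (hx : x ∈ e.source)
    {Y : ∀ y : M, TangentSpace I y} :
    MDifferentiableAt I (I.prod 𝓘(ℝ, E)) (T% Y) x ↔
      MDifferentiableAt I 𝓘(ℝ, E) (fun y ↦ mvfderiv I e y (Y y)) x := by
  rw [mdifferentiableAt_section]
  constructor
  · intro h
    refine (((he.contMDiffAt_mvfderiv_comp_symmL hx).mdifferentiableAt
      (by simp)).clm_apply h).congr_of_eventuallyEq ?_
    filter_upwards [eventually_mem_baseSet (I := I)] with y hy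
    exact (mvfderiv_comp_symmL_trivialization hy _).symm
  · intro h
    refine (((he.contMDiffAt_inverse_mvfderiv_comp_symmL hx).mdifferentiableAt
      (by simp)).clm_apply h).congr_of_eventuallyEq ?_
    filter_upwards [eventually_mem_baseSet (I := I), e.open_source.mem_nhds hx] with y hy hy'
    rw [← mvfderiv_comp_symmL_trivialization (x := x) hy,
      (he.isInvertible_mvfderiv_comp_symmL hy' hy).inverse_apply_self]

lemma contMDiffAt_chartField_comp [CompleteSpace E] (hx : x ∈ e.source) {f : M → E}
    (hf : ContMDiffAt I 𝓘(ℝ, E) ∞ f x) :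
    ContMDiffAt I (I.prod 𝓘(ℝ, E)) ∞ (T% fun y ↦ chartField I e (f y) y) x := by
  rw [he.contMDiffAt_section_iff hx]
  refine hf.congr_of_eventuallyEq ?_
  filter_upwards [e.open_source.mem_nhds hx] with y hy using he.mvfderiv_chartField hy _

lemma contMDiffAt_chartField [CompleteSpace E] (hx : x ∈ e.source) (u : E) :
    ContMDiffAt I (I.prod 𝓘(ℝ, E)) ∞ (T% (chartField I e u)) x :=
  he.contMDiffAt_chartField_comp hx contMDiffAt_const

lemma mdifferentiableAt_chartField [CompleteSpace E] (hx : x ∈ e.source) (u : E) :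
    MDifferentiableAt I (I.prod 𝓘(ℝ, E)) (T% (chartField I e u)) x :=
  (he.contMDiffAt_chartField hx u).mdifferentiableAt (by simp)

lemma mdifferentiableAt_chartField_comp [CompleteSpace E] (hx : x ∈ e.source) {f : M → E}
    (hf : MDifferentiableAt I 𝓘(ℝ, E) f x) :
    MDifferentiableAt I (I.prod 𝓘(ℝ, E)) (T% fun y ↦ chartField I e (f y) y) x := by
  rw [he.mdifferentiableAt_section_iff hx]
  refine hf.congr_of_eventuallyEq ?_
  filter_upwards [e.open_source.mem_nhds hx] with y hy using he.mvfderiv_chartField hy _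

/-- An endomorphism field with a smooth representation in a smooth chart is smooth. -/
lemma contMDiffAt_endField [CompleteSpace E] (hx : x ∈ e.source) {J : EndField I M}
    {A : E → E →L[ℝ] E} (hA : ContDiffAt ℝ ∞ A (e x))
    (hJ : ∀ y ∈ e.source, ∀ v, mvfderiv I e y (J y v) = A (e y) (mvfderiv I e y v)) :
    ContMDiffAt I (I.prod 𝓘(ℝ, E →L[ℝ] E)) ∞ (fun y ↦ TotalSpace.mk' (E →L[ℝ] E)
      (E := fun x : M ↦ TangentSpace I x →L[ℝ] TangentSpace I x) y (J y)) x := by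
  rw [contMDiffAt_hom_bundle]
  refine ⟨contMDiffAt_id, ?_⟩
  have h1 := he.contMDiffAt_mvfderiv_comp_symmL hx
  have h2 := he.contMDiffAt_inverse_mvfderiv_comp_symmL hx
  have h3 : ContMDiffAt I 𝓘(ℝ, E →L[ℝ] E) ∞ (fun y ↦ A (e y)) x :=
    hA.contMDiffAt.comp x (he.contMDiffAt hx)
  refine (h2.clm_comp (h3.clm_comp h1)).congr_of_eventuallyEq ?_
  filter_upwards [eventually_mem_baseSet (I := I), e.open_source.mem_nhds hx] with y hy hy'
  ext u
  refine (he.isInvertible_mvfderiv_comp_symmL hy' hy).injective ?_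
  refine Eq.trans ?_
    ((he.isInvertible_mvfderiv_comp_symmL hy' hy).self_apply_inverse _).symm
  simp only [ContinuousLinearMap.inCoordinates, ContinuousLinearMap.comp_apply]
  rw [Trivialization.symmL_continuousLinearMapAt _ hy, hJ y hy']
  rfl

omit he in
lemma trivializationAt_dual_apply {y : M}
    (L : TangentSpace I y →L[ℝ] Trivial M ℝ y) (v : E) :
    (trivializationAt (E →L[ℝ] ℝ) (fun x : M ↦ TangentSpace I x →L[ℝ] Trivial M ℝ x) x
      ⟨y, L⟩).2 v = L ((trivializationAt E (TangentSpace I) x).symmL ℝ y v) := by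
  rw [hom_trivializationAt_apply]
  simp only [ContinuousLinearMap.inCoordinates]
  exact congr($(Trivial.continuousLinearMapAt_trivialization (𝕜 := ℝ) (B := M) (F := ℝ) y) _)

/-- A field of bilinear forms with a smooth representation in a smooth chart is smooth. -/
lemma contMDiffAt_bilinField [CompleteSpace E] (hx : x ∈ e.source) {b : BilinField I M}
    {B : E → E →L[ℝ] E →L[ℝ] ℝ} (hB : ContDiffAt ℝ ∞ B (e x))
    (hb : ∀ y ∈ e.source, ∀ v w, b y v w = B (e y) (mvfderiv I e y v) (mvfderiv I e y w)) :
    ContMDiffAt I (I.prod 𝓘(ℝ, E →L[ℝ] E →L[ℝ] ℝ)) ∞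
      (fun y ↦ TotalSpace.mk' (E →L[ℝ] E →L[ℝ] ℝ)
      (E := fun x : M ↦ TangentSpace I x →L[ℝ] TangentSpace I x →L[ℝ] ℝ) y (b y)) x := by
  rw [contMDiffAt_hom_bundle]
  refine ⟨contMDiffAt_id, ?_⟩
  have h1 := he.contMDiffAt_mvfderiv_comp_symmL hx
  have h3 : ContMDiffAt I 𝓘(ℝ, E →L[ℝ] E →L[ℝ] ℝ) ∞ (fun y ↦ B (e y)) x :=
    hB.contMDiffAt.comp x (he.contMDiffAt hx)
  refine ((h1.clm_precomp (F₃ := ℝ)).clm_comp (h3.clm_comp h1)).congr_of_eventuallyEq ?_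
  filter_upwards [eventually_mem_baseSet (I := I), e.open_source.mem_nhds hx] with y hy hy'
  ext u v
  have hy2 : y ∈ (trivializationAt (E →L[ℝ] ℝ)
      (fun x : M ↦ TangentSpace I x →L[ℝ] Trivial M ℝ x) x).baseSet := ⟨hy, trivial⟩
  have key : ∀ L : TangentSpace I y →L[ℝ] Trivial M ℝ y,
      (trivializationAt (E →L[ℝ] ℝ)
        (fun x : M ↦ TangentSpace I x →L[ℝ] Trivial M ℝ x) x).continuousLinearMapAt ℝ y L v =
      L ((trivializationAt E (TangentSpace I) x).symmL ℝ y v) := by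
    intro L
    rw [Trivialization.continuousLinearMapAt_apply, Trivialization.linearMapAt_apply,
      if_pos hy2]
    exact trivializationAt_dual_apply L v
  exact (key _).trans (hb y hy' _ _)

omit [IsManifold I ∞ M] in
lemma contDiffOn_comp_symm {G : Type*} [NormedAddCommGroup G] [NormedSpace ℝ G] {f : M → G}
    (hf : ∀ x ∈ e.source, ContMDiffAt I 𝓘(ℝ, G) ∞ f x) :
    ContDiffOn ℝ ∞ (fun z ↦ f (e.symm z)) e.target := by
  intro z hz
  have h := (hf _ (e.map_target hz)).comp z (he.contMDiffAt_symm hz)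
  exact h.contDiffAt.contDiffWithinAt

end IsSmoothChart

/-- The representation of an endomorphism field in a chart. -/
def chartEnd (e : OpenPartialHomeomorph M E) (J : EndField I M) (z : E) : E →L[ℝ] E :=
  mvfderiv I e (e.symm z) ∘L J (e.symm z) ∘L (mvfderiv I e (e.symm z)).inverse

/-- The representation of a field of bilinear forms in a chart. -/
def chartBilin (e : OpenPartialHomeomorph M E) (b : BilinField I M) (z : E) :
    E →L[ℝ] E →L[ℝ] ℝ :=
  pullbackForm (b (e.symm z)) (mvfderiv I e (e.symm z)).inverse

namespace IsSmoothChart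

variable {e : OpenPartialHomeomorph M E} (he : IsSmoothChart I e) {x : M}
include he

lemma mvfderiv_endField (J : EndField I M) (hx : x ∈ e.source) (v : TangentSpace I x) :
    mvfderiv I e x (J x v) = chartEnd e J (e x) (mvfderiv I e x v) := by
  have h : ∀ y, y = x → mvfderiv I e x (J x v) =
      mvfderiv I e y (J y ((mvfderiv I e y).inverse (mvfderiv I e x v))) := by
    rintro _ rfl
    rw [(he.isInvertible hx).inverse_apply_self]
  exact h _ (e.left_inv hx)

lemma bilinField_apply (b : BilinField I M) (hx : x ∈ e.source) (v w : TangentSpace I x) :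
    b x v w = chartBilin e b (e x) (mvfderiv I e x v) (mvfderiv I e x w) := by
  have h : ∀ y, y = x → b x v w = b y ((mvfderiv I e y).inverse (mvfderiv I e x v))
      ((mvfderiv I e y).inverse (mvfderiv I e x w)) := by
    rintro _ rfl
    rw [(he.isInvertible hx).inverse_apply_self, (he.isInvertible hx).inverse_apply_self]
  exact h _ (e.left_inv hx)

variable [IsManifold I ∞ M] [FiniteDimensional ℝ E]

lemma contDiffOn_chartEnd {J : EndField I M}
    (hJ : ∀ x ∈ e.source, ContMDiffAt I (I.prod 𝓘(ℝ, E →L[ℝ] E)) ∞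
      (fun x ↦ TotalSpace.mk' (E →L[ℝ] E)
        (E := fun x : M ↦ TangentSpace I x →L[ℝ] TangentSpace I x) x (J x)) x) :
    ContDiffOn ℝ ∞ (chartEnd e J) e.target := by
  have : CompleteSpace E := FiniteDimensional.complete ℝ E
  rw [contDiffOn_clm_apply]
  intro u
  refine (he.contDiffOn_comp_symm (f := fun y ↦ mvfderiv I e y (J y (chartField I e u y)))
    fun x hx ↦ ?_).congr fun z _ ↦ rfl
  exact (he.contMDiffAt_section_iff hx).1
    (ContMDiffAt.clm_bundle_apply (hJ x hx) (he.contMDiffAt_chartField hx u))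

lemma contDiffOn_chartBilin {b : BilinField I M} (hb : b.IsSmooth) :
    ContDiffOn ℝ ∞ (chartBilin e b) e.target := by
  have : CompleteSpace E := FiniteDimensional.complete ℝ E
  rw [contDiffOn_clm_apply]
  intro u
  rw [contDiffOn_clm_apply]
  intro v
  refine (he.contDiffOn_comp_symm
    (f := fun y ↦ b y (chartField I e u y) (chartField I e v y)) fun x hx ↦ ?_).congr
    fun z _ ↦ rfl
  have h := ContMDiffAt.clm_bundle_apply₂ (F₃ := ℝ) (E₃ := Trivial M ℝ) (hb x)
    (he.contMDiffAt_chartField hx u) (he.contMDiffAt_chartField hx v)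
  rw [contMDiffAt_totalSpace] at h
  exact h.2

omit [FiniteDimensional ℝ E] in
/-- The Lie bracket of vector fields, read in a smooth chart. -/
lemma mvfderiv_mlieBracket [CompleteSpace E] (hx : x ∈ e.source) {X Y : ∀ y : M, TangentSpace I y}
    {X' Y' : E → E} (hX : DifferentiableAt ℝ X' (e x)) (hY : DifferentiableAt ℝ Y' (e x))
    (hXX' : ∀ᶠ y in 𝓝 x, mvfderiv I e y (X y) = X' (e y))
    (hYY' : ∀ᶠ y in 𝓝 x, mvfderiv I e y (Y y) = Y' (e y)) :
    mvfderiv I e x (VectorField.mlieBracket I X Y x) =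
      fderiv ℝ Y' (e x) (X' (e x)) - fderiv ℝ X' (e x) (Y' (e x)) := by
  have : IsManifold I (minSmoothness ℝ 2) M := by
    rw [minSmoothness_of_isRCLikeNormedField]
    exact IsManifold.of_le (n := ∞) (by norm_cast)
  let VX : ∀ z : E, TangentSpace 𝓘(ℝ, E) z := X'
  let VY : ∀ z : E, TangentSpace 𝓘(ℝ, E) z := Y'
  have hVX : MDiffAt (T% VX) (e x) := by
    rw [mdifferentiableAt_section]
    simp only [trivializationAt_model_space_apply]
    exact hX.mdifferentiableAt
  have hVY : MDiffAt (T% VY) (e x) := by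
    rw [mdifferentiableAt_section]
    simp only [trivializationAt_model_space_apply]
    exact hY.mdifferentiableAt
  have h := VectorField.mpullback_mlieBracket hVX hVY (he.contMDiffAt hx)
    (by rw [minSmoothness_of_isRCLikeNormedField]; norm_cast)
  have e1 : VectorField.mpullback I 𝓘(ℝ, E) e VX =ᶠ[𝓝 x] X := by
    filter_upwards [hXX', e.open_source.mem_nhds hx] with y hy hy'
    have h1 : (mvfderiv I e y).inverse (X' (e y)) = X y := by
      rw [← hy, (he.isInvertible hy').inverse_apply_self]
    exact h1
  have e2 : VectorField.mpullback I 𝓘(ℝ, E) e VY =ᶠ[𝓝 x] Y := by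
    filter_upwards [hYY', e.open_source.mem_nhds hx] with y hy hy'
    have h1 : (mvfderiv I e y).inverse (Y' (e y)) = Y y := by
      rw [← hy, (he.isInvertible hy').inverse_apply_self]
    exact h1
  rw [e1.mlieBracket_vectorField_eq e2] at h
  rw [← h]
  refine ((he.isInvertible hx).self_apply_inverse _).trans ?_
  rw [← VectorField.mlieBracketWithin_univ, VectorField.mlieBracketWithin_eq_lieBracketWithin,
    VectorField.lieBracketWithin_univ]
  rfl

end IsSmoothChart

/-- A field of skew-symmetric bilinear forms is closed if around each point there is a chart in
which the alternation of its derivative vanishes. -/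
theorem isClosedForm_of_chart [IsManifold I ∞ M] [CompleteSpace E] {Ω : BilinField I M}
    (h : ∀ x : M, ∃ (e : OpenPartialHomeomorph M E) (B : E → E →L[ℝ] E →L[ℝ] ℝ),
      IsSmoothChart I e ∧ x ∈ e.source ∧ DifferentiableAt ℝ B (e x) ∧
      (∀ y ∈ e.source, ∀ v w, Ω y v w = B (e y) (mvfderiv I e y v) (mvfderiv I e y w)) ∧
      (∀ u v, B (e x) u v = - B (e x) v u) ∧
      (∀ u v w, fderiv ℝ B (e x) u v w - fderiv ℝ B (e x) v u w + fderiv ℝ B (e x) w u v = 0)) :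
    IsClosedForm Ω := by
  intro x X Y Z hX hY hZ
  obtain ⟨e, B, he, hx, hB, hΩ, hskew, hd⟩ := h x
  have coord : ∀ {X : ∀ y : M, TangentSpace I y}, MDiffAt (T% X) x →
      ∃ X' : E → E, DifferentiableAt ℝ X' (e x) ∧
        ∀ᶠ y in 𝓝 x, mvfderiv I e y (X y) = X' (e y) := by
    intro X hX
    refine ⟨fun z ↦ mvfderiv I e (e.symm z) (X (e.symm z)), ?_, ?_⟩
    · have h1 := (he.mdifferentiableAt_section_iff hx).1 hX
      have h2 := he.mdifferentiableAt_symm (e.map_source hx)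
      rw [← e.left_inv hx] at h1
      exact (h1.comp (e x) h2).differentiableAt
    · filter_upwards [e.open_source.mem_nhds hx] with y hy
      rw [e.left_inv hy]
  obtain ⟨X', hX', hXX'⟩ := coord hX
  obtain ⟨Y', hY', hYY'⟩ := coord hY
  obtain ⟨Z', hZ', hZZ'⟩ := coord hZ
  have deriv : ∀ {Y Z X : ∀ y : M, TangentSpace I y} {Y' Z' X' : E → E},
      DifferentiableAt ℝ Y' (e x) → DifferentiableAt ℝ Z' (e x) →
      (∀ᶠ y in 𝓝 x, mvfderiv I e y (Y y) = Y' (e y)) →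
      (∀ᶠ y in 𝓝 x, mvfderiv I e y (Z y) = Z' (e y)) →
      (∀ᶠ y in 𝓝 x, mvfderiv I e y (X y) = X' (e y)) →
      mvfderiv I (fun y ↦ Ω y (Y y) (Z y)) x (X x) =
        fderiv ℝ B (e x) (X' (e x)) (Y' (e x)) (Z' (e x))
          + B (e x) (fderiv ℝ Y' (e x) (X' (e x))) (Z' (e x))
          + B (e x) (Y' (e x)) (fderiv ℝ Z' (e x) (X' (e x))) := by
    intro Y Z X Y' Z' X' hY' hZ' hYY' hZZ' hXX'
    have e1 : (fun y ↦ Ω y (Y y) (Z y)) =ᶠ[𝓝 x] fun y ↦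
        (fun z ↦ B z (Y' z) (Z' z)) (e y) := by
      filter_upwards [hYY', hZZ', e.open_source.mem_nhds hx] with y h1 h2 h3
      rw [hΩ y h3, h1, h2]
    have hBY := hB.hasFDerivAt.clm_apply hY'.hasFDerivAt
    have hBYZ := hBY.clm_apply hZ'.hasFDerivAt
    rw [mvfderiv_congr e1, mvfderiv_fderiv_comp hBYZ.differentiableAt (he.mdifferentiableAt hx),
      hBYZ.fderiv, ContinuousLinearMap.comp_apply, hXX'.self_of_nhds]
    simp
    ring
  rw [deriv hY' hZ' hYY' hZZ' hXX', deriv hX' hZ' hXX' hZZ' hYY', deriv hX' hY' hXX' hYY' hZZ',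
    hΩ x hx, hΩ x hx, hΩ x hx, he.mvfderiv_mlieBracket hx hX' hY' hXX' hYY',
    he.mvfderiv_mlieBracket hx hX' hZ' hXX' hZZ', he.mvfderiv_mlieBracket hx hY' hZ' hYY' hZZ',
    hXX'.self_of_nhds, hYY'.self_of_nhds, hZZ'.self_of_nhds]
  have h1 := hd (X' (e x)) (Y' (e x)) (Z' (e x))
  simp only [map_sub, _root_.sub_apply]
  rw [hskew (X' (e x)) (fderiv ℝ Z' (e x) (Y' (e x))),
    hskew (X' (e x)) (fderiv ℝ Y' (e x) (Z' (e x))),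
    hskew (Y' (e x)) (fderiv ℝ Z' (e x) (X' (e x)))]
  linarith

/-- A distribution is integrable if, in a suitable chart around each point, it is tangent to a
parametrized submanifold through that point. -/
theorem isIntegrableDistribution_of_chart {V : Type*} [NormedAddCommGroup V] [NormedSpace ℝ V]
    [FiniteDimensional ℝ V] {D : ∀ x : M, Submodule ℝ (TangentSpace I x)}
    (h : ∀ x : M, ∃ (e : OpenPartialHomeomorph M E) (O : Set V) (v₀ : V) (f : V → E),
      IsSmoothChart I e ∧ x ∈ e.source ∧ IsOpen O ∧ v₀ ∈ O ∧ f v₀ = e x ∧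
      ContDiffOn ℝ ∞ f O ∧ MapsTo f O e.target ∧
      ∀ v ∈ O, Function.Injective (fderiv ℝ f v) ∧
        ∀ w : TangentSpace I (e.symm (f v)), w ∈ D (e.symm (f v)) ↔
          ∃ a, fderiv ℝ f v a = mvfderiv I e (e.symm (f v)) w) :
    IsIntegrableDistribution D := by
  intro x
  obtain ⟨e, O, v₀, f, he, hx, hO, hv₀, hfv₀, hf, hft, hD⟩ := h x
  let L : EuclideanSpace ℝ (Fin (Module.finrank ℝ V)) ≃L[ℝ] V :=
    ContinuousLinearEquiv.ofFinrankEq (by simp)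
  have hLc : ContDiff ℝ ∞ fun u ↦ v₀ + L u := by fun_prop
  refine ⟨Module.finrank ℝ V, (fun u ↦ v₀ + L u) ⁻¹' O, fun u ↦ e.symm (f (v₀ + L u)),
    hO.preimage hLc.continuous, by simpa using hv₀, by simp [hfv₀, e.left_inv hx], ?_, ?_⟩
  · exact he.contMDiffOn_symm.comp (hf.comp hLc.contDiffOn fun u hu ↦ hu).contMDiffOn
      fun u hu ↦ hft hu
  · intro u hu
    have hfu : DifferentiableAt ℝ f (v₀ + L u) :=
      (hf.contDiffAt (hO.mem_nhds hu)).differentiableAt (by simp)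
    have hg : HasFDerivAt (fun u ↦ f (v₀ + L u)) (fderiv ℝ f (v₀ + L u) ∘L (L : _ →L[ℝ] V)) u :=
      hfu.hasFDerivAt.comp u (L.hasFDerivAt.const_add v₀)
    have hd : ∀ a, mfderiv 𝓘(ℝ, EuclideanSpace ℝ (Fin (Module.finrank ℝ V))) I
        (fun u ↦ e.symm (f (v₀ + L u))) u a =
        mfderiv 𝓘(ℝ, E) I e.symm (f (v₀ + L u)) (fderiv ℝ f (v₀ + L u) (L a)) := by
      intro a
      have h1 := mfderiv_comp u (he.mdifferentiableAt_symm (hft hu))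
        hg.differentiableAt.mdifferentiableAt
      rw [mfderiv_eq_fderiv, hg.fderiv] at h1
      exact congr($h1 a)
    have hde : ∀ a, mvfderiv I e (e.symm (f (v₀ + L u)))
        (mfderiv 𝓘(ℝ, EuclideanSpace ℝ (Fin (Module.finrank ℝ V))) I
          (fun u ↦ e.symm (f (v₀ + L u))) u a) = fderiv ℝ f (v₀ + L u) (L a) := by
      intro a
      rw [hd]
      exact he.mvfderiv_mfderiv_symm (hft hu) _
    obtain ⟨hinj, hw⟩ := hD _ hu
    constructor
    · intro a b hab
      apply L.injective
      apply hinj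
      rw [← hde, ← hde, hab]
    · ext w
      rw [hw w]
      constructor
      · rintro ⟨a, rfl⟩
        exact ⟨L a, (hde a).symm⟩
      · rintro ⟨a, ha⟩
        refine ⟨L.symm a, he.mvfderiv_injective (e.map_target (hft hu)) ?_⟩
        refine (hde _).trans ?_
        rw [L.apply_symm_apply, ha]

end SmoothChart
end


noncomputable section

/-! ## Linear connections in smooth charts -/

section Connection

open Set Filter Topology

variable {E : Type*} [NormedAddCommGroup E] [NormedSpace ℝ E] [FiniteDimensional ℝ E]
  {H : Type*} [TopologicalSpace H] {I : ModelWithCorners ℝ E H}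
  {M : Type*} [TopologicalSpace M] [ChartedSpace H M] [IsManifold I ∞ M]

/-- A vector field which is smooth near `x` coincides near `x` with a smooth vector field. -/
lemma exists_contMDiff_section_eventuallyEq [T2Space M] {Y : ∀ y : M, TangentSpace I y} {U : Set M}
    (hU : IsOpen U) (hY : ∀ y ∈ U, ContMDiffAt I (I.prod 𝓘(ℝ, E)) ∞ (T% Y) y) {x : M}
    (hx : x ∈ U) :
    ∃ Y' : ∀ y : M, TangentSpace I y, CMDiff ∞ (T% Y') ∧ ∀ᶠ y in 𝓝 x, Y' y = Y y := by
  obtain ⟨f, hf⟩ := (SmoothBumpFunction.nhds_basis_tsupport (I := I) x).mem_iff.1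
    (hU.mem_nhds hx)
  refine ⟨fun y ↦ f y • Y y, ?_, ?_⟩
  · exact ContMDiffOn.smul_section_of_tsupport f.contMDiff.contMDiffOn hU hf.2
      fun y hy ↦ (hY y hy).contMDiffWithinAt
  · filter_upwards [f.eventuallyEq_one] with y hy
    rw [hy, Pi.one_apply, one_smul]

variable (D : CovariantDerivative I E (TangentSpace I : M → Type _))

/-- `Γ` are the Christoffel symbols of the connection `D` in the chart `e`. -/
def IsChristoffel (e : OpenPartialHomeomorph M E) (Γ : E → E →L[ℝ] E →L[ℝ] E) : Prop :=
  ∀ x ∈ e.source, ∀ (u : E) (v : TangentSpace I x),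
    D (chartField I e u) x v = chartField I e (Γ (e x) (mvfderiv I e x v) u) x

variable {D} {e : OpenPartialHomeomorph M E}

omit [FiniteDimensional ℝ E] in
lemma CovariantDerivative.congr_of_eventuallyEq {x : M} {Y Y' : ∀ y : M, TangentSpace I y}
    (hY : MDiffAt (T% Y) x) (h : ∀ᶠ y in 𝓝 x, Y' y = Y y) : D Y' x = D Y x := by
  have hY' : MDiffAt (T% Y') x := by
    refine hY.congr_of_eventuallyEq ?_
    filter_upwards [h] with y hy
    rw [hy]
  exact D.isCovariantDerivativeOnUniv.congr_of_eventuallyEq hY' hY univ_mem h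

omit [FiniteDimensional ℝ E] [IsManifold I ∞ M] in
lemma chartField_add (u v : E) : chartField I e (u + v) = chartField I e u + chartField I e v := by
  funext x
  exact map_add (mvfderiv I e x).inverse u v

omit [FiniteDimensional ℝ E] [IsManifold I ∞ M] in
lemma chartField_smul (c : ℝ) (u : E) : chartField I e (c • u) = c • chartField I e u := by
  funext x
  exact map_smul (mvfderiv I e x).inverse c u

/-- A smooth connection has smooth Christoffel symbols. -/
theorem exists_isChristoffel [T2Space M] (hD : D.ContMDiffCovariantDerivative ∞)
    (he : IsSmoothChart I e) :
    ∃ Γ : E → E →L[ℝ] E →L[ℝ] E, ContDiffOn ℝ ∞ Γ e.target ∧ IsChristoffel D e Γ := by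
  have : CompleteSpace E := FiniteDimensional.complete ℝ E
  let b := Module.finBasis ℝ E
  let c : Fin (Module.finrank ℝ E) → E →L[ℝ] ℝ := fun i ↦
    LinearMap.toContinuousLinearMap (b.coord i)
  refine ⟨fun z ↦ ∑ i, ContinuousLinearMap.smulRightL ℝ E E (c i) ∘L
    chartEnd e (fun y ↦ D (chartField I e (b i)) y) z, ?_, ?_⟩
  · refine ContDiffOn.sum fun i _ ↦ contDiffOn_const.clm_comp ?_
    refine he.contDiffOn_chartEnd fun x hx ↦ ?_
    obtain ⟨Y, hY, hYe⟩ := exists_contMDiff_section_eventuallyEq e.open_source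
      (fun y hy ↦ he.contMDiffAt_chartField hy (b i)) hx
    have h := hD.contMDiff.contMDiff (σ := Y) (by simpa using hY.contMDiffOn)
    refine (h.contMDiffAt univ_mem).congr_of_eventuallyEq ?_
    filter_upwards [hYe.eventually_nhds, e.open_source.mem_nhds hx] with y hy hy'
    rw [CovariantDerivative.congr_of_eventuallyEq (he.mdifferentiableAt_chartField hy' (b i)) hy]
  · intro x hx u v
    let L : E →ₗ[ℝ] (TangentSpace I x →L[ℝ] TangentSpace I x) :=
      { toFun := fun u ↦ D (chartField I e u) x
        map_add' := fun u u' ↦ by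
          rw [chartField_add, D.isCovariantDerivativeOnUniv.add
            (he.mdifferentiableAt_chartField hx u) (he.mdifferentiableAt_chartField hx u')]
        map_smul' := fun a u ↦ by
          rw [chartField_smul, D.isCovariantDerivativeOnUniv.smul_const a
            (he.mdifferentiableAt_chartField hx u)]
          rfl }
    apply he.mvfderiv_injective hx
    rw [he.mvfderiv_chartField hx]
    change mvfderiv I e x (L u v) = _
    conv_lhs => rw [← b.sum_repr u]
    simp only [map_sum, map_smul, _root_.sum_apply, _root_.smul_apply,
      ContinuousLinearMap.comp_apply, ← he.mvfderiv_endField _ hx]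
    rfl

/-- The covariant derivative of a vector field, read in a smooth chart. -/
theorem IsChristoffel.mvfderiv_apply {Γ : E → E →L[ℝ] E →L[ℝ] E} (hΓ : IsChristoffel D e Γ)
    (he : IsSmoothChart I e) {x : M} (hx : x ∈ e.source) {Y : ∀ y : M, TangentSpace I y}
    (hY : MDiffAt (T% Y) x) (v : TangentSpace I x) :
    mvfderiv I e x (D Y x v) = mvfderiv I (fun y ↦ mvfderiv I e y (Y y)) x v
      + Γ (e x) (mvfderiv I e x v) (mvfderiv I e x (Y x)) := by
  have : CompleteSpace E := FiniteDimensional.complete ℝ E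
  have hten : TensorialAt I E (fun Y : ∀ y : M, TangentSpace I y ↦
      (mvfderiv I e x (D Y x v) - mvfderiv I (fun y ↦ mvfderiv I e y (Y y)) x v : E)) x := by
    constructor
    · intro f σ hf hσ
      have h1 := (he.mdifferentiableAt_section_iff hx).1 hσ
      have e1 : (fun y ↦ mvfderiv I e y ((f • σ) y)) = fun y ↦ f y • mvfderiv I e y (σ y) := by
        funext y
        exact map_smul _ _ _
      rw [e1, mvfderiv_fun_smul hf h1, D.isCovariantDerivativeOnUniv.leibniz hσ hf]
      simp only [_root_.add_apply, _root_.smul_apply, ContinuousLinearMap.smulRight_apply, map_add,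
        map_smul]
      module
    · intro σ σ' hσ hσ'
      have h1 := (he.mdifferentiableAt_section_iff hx).1 hσ
      have h1' := (he.mdifferentiableAt_section_iff hx).1 hσ'
      have e1 : (fun y ↦ mvfderiv I e y ((σ + σ') y)) =
          fun y ↦ mvfderiv I e y (σ y) + mvfderiv I e y (σ' y) := by
        funext y
        exact map_add _ _ _
      rw [e1, mvfderiv_fun_add h1 h1', D.isCovariantDerivativeOnUniv.add hσ hσ']
      simp only [_root_.add_apply, map_add]
      abel
  set u : E := mvfderiv I e x (Y x) with hu
  have h := hten.pointwise hY (he.mdifferentiableAt_chartField hx u)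
    (by rw [hu, he.chartField_mvfderiv hx])
  have hc : mvfderiv I (fun y ↦ mvfderiv I e y (chartField I e u y)) x = 0 := by
    rw [mvfderiv_congr (g := fun _ ↦ u), mvfderiv_const]
    filter_upwards [e.open_source.mem_nhds hx] with y hy using he.mvfderiv_chartField hy u
  simp only [hc, hΓ x hx, he.mvfderiv_chartField hx, _root_.zero_apply, sub_zero] at h
  rw [← h]
  abel

/-- The Christoffel symbols of a torsion-free connection are symmetric. -/
theorem IsChristoffel.symm_of_torsion_eq_zero [CompleteSpace E]
    {Γ : E → E →L[ℝ] E →L[ℝ] E} (hΓ : IsChristoffel D e Γ)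
    (he : IsSmoothChart I e) (hD : D.torsion = 0) {z : E} (hz : z ∈ e.target) (u v : E) :
    Γ z u v = Γ z v u := by
  have hx := e.map_target hz
  have h := (D.torsion_eq_zero_iff.1 hD) (he.mdifferentiableAt_chartField hx u)
    (he.mdifferentiableAt_chartField hx v)
  have hb := he.mvfderiv_mlieBracket hx (X := chartField I e u) (Y := chartField I e v)
    (differentiableAt_const u) (differentiableAt_const v)
    (by filter_upwards [e.open_source.mem_nhds hx] with y hy using he.mvfderiv_chartField hy u)
    (by filter_upwards [e.open_source.mem_nhds hx] with y hy using he.mvfderiv_chartField hy v)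
  rw [← h, map_sub, hΓ _ hx, hΓ _ hx, he.mvfderiv_chartField hx, he.mvfderiv_chartField hx,
    he.mvfderiv_chartField hx, he.mvfderiv_chartField hx, e.right_inv hz] at hb
  simpa [sub_eq_zero] using hb

/-- The curvature of a flat connection vanishes, expressed through the Christoffel symbols. -/
theorem IsChristoffel.curvature_eq_zero [T2Space M]
    {Γ : E → E →L[ℝ] E →L[ℝ] E} (hΓ : IsChristoffel D e Γ) (hΓs : ContDiffOn ℝ ∞ Γ e.target)
    (he : IsSmoothChart I e) (hD : IsFlatConnection D) {z : E} (hz : z ∈ e.target) (u v w : E) :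
    fderiv ℝ Γ z u v w + Γ z u (Γ z v w) = fderiv ℝ Γ z v u w + Γ z v (Γ z u w) := by
  have : CompleteSpace E := FiniteDimensional.complete ℝ E
  have hx := e.map_target hz
  set x := e.symm z with hxdef
  have hzx : e x = z := e.right_inv hz
  have hΓd : DifferentiableAt ℝ Γ (e x) :=
    (hΓs.contDiffAt (e.open_target.mem_nhds (e.map_source hx))).differentiableAt (by simp)
  have ext : ∀ a : E, ∃ Y : ∀ y : M, TangentSpace I y, CMDiff ∞ (T% Y) ∧
      ∀ᶠ y in 𝓝 x, Y y = chartField I e a y := fun a ↦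
    exists_contMDiff_section_eventuallyEq e.open_source
      (fun y hy ↦ he.contMDiffAt_chartField hy a) hx
  obtain ⟨X, hX, hXe⟩ := ext u
  obtain ⟨Y, hY, hYe⟩ := ext v
  obtain ⟨Z, hZ, hZe⟩ := ext w
  have key : ∀ {Y : ∀ y : M, TangentSpace I y} {v : E}, (∀ᶠ y in 𝓝 x, Y y = chartField I e v y) →
      ∀ u : E, mvfderiv I e x (D (fun y ↦ D Z y (Y y)) x (chartField I e u x)) =
        fderiv ℝ Γ z u v w + Γ z u (Γ z v w) := by
    intro Y v hYe u
    have hS : MDiffAt (fun y ↦ Γ (e y) v w) x := by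
      have h1 : DifferentiableAt ℝ (fun z ↦ Γ z v w) (e x) := by fun_prop
      exact h1.mdifferentiableAt.comp x (he.mdifferentiableAt hx)
    have h1 : D (fun y ↦ D Z y (Y y)) x = D (fun y ↦ chartField I e (Γ (e y) v w) y) x := by
      refine CovariantDerivative.congr_of_eventuallyEq
        (he.mdifferentiableAt_chartField_comp hx hS) ?_
      filter_upwards [hZe.eventually_nhds, hYe, e.open_source.mem_nhds hx] with y h1 h2 h3
      rw [CovariantDerivative.congr_of_eventuallyEq (he.mdifferentiableAt_chartField h3 w) h1, h2,
        hΓ y h3, he.mvfderiv_chartField h3]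
    rw [h1, hΓ.mvfderiv_apply he hx (he.mdifferentiableAt_chartField_comp hx hS),
      he.mvfderiv_chartField hx, he.mvfderiv_chartField hx, hzx]
    congr 1
    have h2 : (fun y ↦ mvfderiv I e y (chartField I e (Γ (e y) v w) y)) =ᶠ[𝓝 x]
        fun y ↦ (fun z ↦ Γ z v w) (e y) := by
      filter_upwards [e.open_source.mem_nhds hx] with y hy using he.mvfderiv_chartField hy _
    have h3 : DifferentiableAt ℝ (fun z ↦ Γ z v) (e x) := hΓd.clm_apply (differentiableAt_const v)
    rw [mvfderiv_congr h2, mvfderiv_fderiv_comp (h3.clm_apply (differentiableAt_const w))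
      (he.mdifferentiableAt hx), ContinuousLinearMap.comp_apply, he.mvfderiv_chartField hx,
      h3.fderiv_clm_apply_const, hΓd.fderiv_clm_apply_const, hzx]
  have hflat := hD X Y Z hX hY hZ x
  have hb : VectorField.mlieBracket I X Y x = 0 := by
    apply he.mvfderiv_injective hx
    rw [he.mvfderiv_mlieBracket hx (differentiableAt_const u) (differentiableAt_const v)
      (by filter_upwards [e.open_source.mem_nhds hx, hXe] with y hy h1
          rw [h1, he.mvfderiv_chartField hy u])
      (by filter_upwards [e.open_source.mem_nhds hx, hYe] with y hy h1
          rw [h1, he.mvfderiv_chartField hy v])]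
    simp
  rw [hb, map_zero, sub_zero, sub_eq_zero, hXe.self_of_nhds, hYe.self_of_nhds] at hflat
  rw [← key hYe u, ← key hXe v, hflat]

/-- A chart is flat if its coordinate vector fields are parallel. -/
def IsFlatChart (D : CovariantDerivative I E (TangentSpace I : M → Type _))
    (e : OpenPartialHomeomorph M E) : Prop :=
  ∀ x ∈ e.source, ∀ u, D (chartField I e u) x = 0

omit [FiniteDimensional ℝ E] in
lemma IsFlatChart.isChristoffel (h : IsFlatChart D e) : IsChristoffel D e 0 := by
  intro x hx u v
  rw [h x hx, Pi.zero_apply]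
  exact (map_zero (mvfderiv I e x).inverse).symm

omit [FiniteDimensional ℝ E] [IsManifold I ∞ M] in
/-- A smooth chart can be shrunk so that its image is a ball. -/
lemma IsSmoothChart.exists_restr (he : IsSmoothChart I e) {x : M} (hx : x ∈ e.source) :
    ∃ e' : OpenPartialHomeomorph M E, IsSmoothChart I e' ∧ x ∈ e'.source ∧
      (e' : M → E) = e ∧ e'.source ⊆ e.source ∧ ∃ r, e'.target = Metric.ball (e x) r := by
  obtain ⟨r, hr, hball⟩ := Metric.mem_nhds_iff.1 (e.open_target.mem_nhds (e.map_source hx))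
  let e' := (e.symm.restrOpen (Metric.ball (e x) r) Metric.isOpen_ball).symm
  have hs : e'.source ⊆ e.source := by
    intro y hy
    have h1 := e'.map_source hy
    have h2 : e' y ∈ e.target ∩ Metric.ball (e x) r := h1
    have h3 := e'.left_inv hy
    rw [← h3]
    exact e.map_target h2.1
  refine ⟨e', ⟨?_, ?_⟩, ?_, rfl, hs, r, ?_⟩
  · exact he.contMDiffOn.mono hs
  · exact he.contMDiffOn_symm.mono inter_subset_left
  · have : e x ∈ e'.target := ⟨e.map_source hx, Metric.mem_ball_self hr⟩
    have h1 := e'.map_target this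
    have h2 : e'.symm (e x) = x := e.left_inv hx
    rwa [h2] at h1
  · exact inter_eq_right.2 hball

section FlatChart

variable {Γ : E → E →L[ℝ] E →L[ℝ] E} {O : Set E}

/-- Flat affine coordinates, in a vector space: if `Γ` is symmetric and has no curvature,
there is a local solution of `df = P`, `dP = P ∘ Γ`. -/
lemma exists_affine_coordinates (hO : IsOpen O) (hΓ : ContDiffOn ℝ ∞ Γ O)
    (hsymm : ∀ z ∈ O, ∀ u v, Γ z u v = Γ z v u)
    (hcurv : ∀ z ∈ O, ∀ u v w,
      fderiv ℝ Γ z u v w + Γ z u (Γ z v w) = fderiv ℝ Γ z v u w + Γ z v (Γ z u w))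
    {z₀ : E} (hz₀ : z₀ ∈ O) :
    ∃ (f : E → E) (P : E → E →L[ℝ] E) (U : Set E), IsOpen U ∧ z₀ ∈ U ∧ U ⊆ O ∧
      P z₀ = ContinuousLinearMap.id ℝ E ∧ ContDiffOn ℝ ∞ f U ∧ ContDiffOn ℝ ∞ P U ∧
      ∀ z ∈ U, HasFDerivAt f (P z) z ∧ ∀ u, fderiv ℝ P z u = P z ∘L Γ z u := by
  have : CompleteSpace E := FiniteDimensional.complete ℝ E
  let φ : E × (E × (E →L[ℝ] E)) → E →L[ℝ] E × (E →L[ℝ] E) := fun q ↦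
    (q.2.2).prod (ContinuousLinearMap.compL ℝ E E E q.2.2 ∘L Γ q.1)
  have hφs : ContDiffOn ℝ ∞ φ (O ×ˢ univ) := by
    rw [contDiffOn_clm_apply]
    intro v
    refine ContDiffOn.prodMk (f := fun q : E × (E × (E →L[ℝ] E)) ↦ q.2.2 v)
      (g := fun q : E × (E × (E →L[ℝ] E)) ↦ q.2.2 ∘L Γ q.1 v) ?_ ?_
    · exact contDiffOn_snd.snd.clm_apply contDiffOn_const
    · exact contDiffOn_snd.snd.clm_comp
        ((hΓ.clm_apply contDiffOn_const).comp contDiffOn_fst fun q hq ↦ hq.1)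
  have hφd : ∀ q ∈ O ×ˢ (univ : Set (E × (E →L[ℝ] E))), ∀ (h : E × (E × (E →L[ℝ] E))) (v : E),
      fderiv ℝ φ q h v = (h.2.2 v, q.2.2 ∘L fderiv ℝ Γ q.1 h.1 v + h.2.2 ∘L Γ q.1 v) := by
    intro q hq h v
    have hφq : DifferentiableAt ℝ φ q := (hφs.contDiffAt
      ((hO.prod isOpen_univ).mem_nhds hq)).differentiableAt (by simp)
    have hΓq : DifferentiableAt ℝ Γ q.1 :=
      (hΓ.contDiffAt (hO.mem_nhds hq.1)).differentiableAt (by simp)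
    have hΓv : HasFDerivAt (fun q : E × (E × (E →L[ℝ] E)) ↦ Γ q.1 v)
        (fderiv ℝ (fun z ↦ Γ z v) q.1 ∘L ContinuousLinearMap.fst ℝ E (E × (E →L[ℝ] E))) q :=
      (hΓq.clm_apply (differentiableAt_const v)).hasFDerivAt.comp q hasFDerivAt_fst
    have hP : HasFDerivAt (fun q : E × (E × (E →L[ℝ] E)) ↦ q.2.2)
        (ContinuousLinearMap.snd ℝ E (E →L[ℝ] E) ∘L
          ContinuousLinearMap.snd ℝ E (E × (E →L[ℝ] E))) q :=
      (ContinuousLinearMap.snd ℝ E (E →L[ℝ] E) ∘L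
          ContinuousLinearMap.snd ℝ E (E × (E →L[ℝ] E))).hasFDerivAt
    have h1 : HasFDerivAt (fun q ↦ φ q v) _ q :=
      (hP.clm_apply (hasFDerivAt_const v q)).prodMk (hP.clm_comp hΓv)
    rw [← hφq.fderiv_clm_apply_const, h1.fderiv, ← hΓq.fderiv_clm_apply_const]
    simp
  obtain ⟨σ, U, hU, hzU, hσ₀, hσs, hσ⟩ := exists_contDiffOn_hasFDerivAt_of_integrable
    (hO.prod isOpen_univ) hφs (fun q hq u v ↦ by
      rw [hφd q hq, hφd q hq]
      refine Prod.ext ?_ ?_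
      · change q.2.2 (Γ q.1 u v) = q.2.2 (Γ q.1 v u)
        rw [hsymm _ hq.1]
      · ext w
        change q.2.2 (fderiv ℝ Γ q.1 u v w) + q.2.2 (Γ q.1 u (Γ q.1 v w)) =
          q.2.2 (fderiv ℝ Γ q.1 v u w) + q.2.2 (Γ q.1 v (Γ q.1 u w))
        rw [← map_add, ← map_add, hcurv _ hq.1])
    (x₀ := z₀) (w₀ := (0, ContinuousLinearMap.id ℝ E)) ⟨hz₀, trivial⟩
  refine ⟨fun z ↦ (σ z).1, fun z ↦ (σ z).2, U, hU, hzU, fun z hz ↦ (hσ z hz).1.1, congr($hσ₀.2),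
    hσs.fst, hσs.snd, fun z hz ↦ ⟨(hσ z hz).2.fst, fun u ↦ ?_⟩⟩
  rw [(hσ z hz).2.snd.fderiv]
  rfl

/-- A smooth flat torsion-free connection admits flat charts. -/
theorem exists_isFlatChart [T2Space M] [CompleteSpace E]
    (hDs : D.ContMDiffCovariantDerivative ∞) (hDf : IsFlatConnection D) (hDt : D.torsion = 0)
    {e₀ : OpenPartialHomeomorph M E} (he₀ : IsSmoothChart I e₀) {x₀ : M} (hx₀ : x₀ ∈ e₀.source) :
    ∃ e : OpenPartialHomeomorph M E, IsSmoothChart I e ∧ x₀ ∈ e.source ∧ IsFlatChart D e ∧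
      ∃ r, e.target = Metric.ball (e x₀) r := by
  obtain ⟨Γ, hΓs, hΓ⟩ := exists_isChristoffel hDs he₀
  obtain ⟨f, P, U, hU, hzU, hUt, hP₀, hfs, hPs, hfP⟩ := exists_affine_coordinates e₀.open_target hΓs
    (fun z hz ↦ hΓ.symm_of_torsion_eq_zero he₀ hDt hz)
    (fun z hz ↦ hΓ.curvature_eq_zero hΓs he₀ hDf hz) (e₀.map_source hx₀)
  have hf₀ : HasFDerivAt f ((ContinuousLinearEquiv.refl ℝ E : E ≃L[ℝ] E) : E →L[ℝ] E) (e₀ x₀) := by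
    have h := (hfP _ hzU).1
    rw [hP₀] at h
    exact h
  let F := (hfs.contDiffAt (hU.mem_nhds hzU)).toOpenPartialHomeomorph f hf₀ (by simp)
  let S : Set E := U ∩ P ⁻¹' range ((↑) : (E ≃L[ℝ] E) → E →L[ℝ] E)
  have hS : IsOpen S := hPs.continuousOn.isOpen_inter_preimage hU (ContinuousLinearEquiv.isOpen)
  have hzS : e₀ x₀ ∈ S := ⟨hzU, ContinuousLinearEquiv.refl ℝ E, hP₀.symm⟩
  let G := F.restrOpen S hS
  have hGs : G.source ⊆ S := inter_subset_right
  have hGf : ∀ z, G z = f z := fun z ↦ rfl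
  have hGsymm : ContDiffOn ℝ ∞ G.symm G.target := by
    intro z hz
    obtain ⟨A, hA⟩ := (hGs (G.map_target hz)).2
    have hU' := (hGs (G.map_target hz)).1
    refine (G.contDiffAt_symm (f₀' := A) hz ?_ ?_).contDiffWithinAt
    · rw [hA]
      exact (hfP _ hU').1
    · exact hfs.contDiffAt (hU.mem_nhds hU')
  let e₁ := e₀.trans G
  have he₁s : ∀ x ∈ e₁.source, x ∈ e₀.source ∧ e₀ x ∈ S := by
    intro x hx
    rw [OpenPartialHomeomorph.trans_source] at hx
    exact ⟨hx.1, hGs hx.2⟩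
  have he₁ : IsSmoothChart I e₁ := by
    constructor
    · exact hfs.contMDiffOn.comp (he₀.contMDiffOn.mono fun x hx ↦ (he₁s x hx).1)
        fun x hx ↦ (he₁s x hx).2.1
    · exact he₀.contMDiffOn_symm.comp (hGsymm.contMDiffOn.mono fun z hz ↦ hz.1) fun z hz ↦ hz.2
  have hx₁ : x₀ ∈ e₁.source := by
    rw [OpenPartialHomeomorph.trans_source]
    exact ⟨hx₀, ContDiffAt.mem_toOpenPartialHomeomorph_source _ _ _, hzS⟩
  obtain ⟨e, he, hx, hee, hes, r, hr⟩ := he₁.exists_restr hx₁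
  refine ⟨e, he, hx, ?_, r, by rw [hr, hee]⟩
  have hd : ∀ y ∈ e.source, ∀ v, mvfderiv I e y v = P (e₀ y) (mvfderiv I e₀ y v) := by
    intro y hy v
    have h1 := he₁s y (hes hy)
    have h2 := mvfderiv_fderiv_comp (hfP _ h1.2.1).1.differentiableAt
      (he₀.mdifferentiableAt h1.1)
    rw [(hfP _ h1.2.1).1.fderiv] at h2
    rw [hee]
    exact congr($h2 v)
  intro x hx u
  ext v
  have h1 := he₁s x (hes hx)
  have hY := he.mdifferentiableAt_chartField hx u
  have hs := (he₀.mdifferentiableAt_section_iff h1.1).1 hY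
  let s : E → E := fun z ↦ mvfderiv I e₀ (e₀.symm z) (chartField I e u (e₀.symm z))
  have hsd : DifferentiableAt ℝ s (e₀ x) := by
    have h2 := he₀.mdifferentiableAt_symm (e₀.map_source h1.1)
    rw [← e₀.left_inv h1.1] at hs
    exact (hs.comp (e₀ x) h2).differentiableAt
  have hse : (fun y ↦ mvfderiv I e₀ y (chartField I e u y)) =ᶠ[𝓝 x] fun y ↦ s (e₀ y) := by
    filter_upwards [e₀.open_source.mem_nhds h1.1] with y hy
    simp only [s]
    rw [e₀.left_inv hy]
  have hPd : DifferentiableAt ℝ P (e₀ x) :=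
    (hPs.contDiffAt (hU.mem_nhds h1.2.1)).differentiableAt (by simp)
  have hconst : ∀ w, P (e₀ x) (fderiv ℝ s (e₀ x) w + Γ (e₀ x) w (s (e₀ x))) = 0 := by
    intro w
    have h2 : (fun z ↦ P z (s z)) =ᶠ[𝓝 (e₀ x)] fun _ ↦ u := by
      have h3 : ∀ᶠ z in 𝓝 (e₀ x), e₀.symm z ∈ e.source ∧ z ∈ e₀.target := by
        refine Eventually.and ?_ (e₀.open_target.mem_nhds (e₀.map_source h1.1))
        refine (e₀.continuousAt_symm (e₀.map_source h1.1)).eventually_mem ?_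
        rw [e₀.left_inv h1.1]
        exact e.open_source.mem_nhds hx
      filter_upwards [h3] with z hz
      have h4 := hd _ hz.1 (chartField I e u (e₀.symm z))
      rw [he.mvfderiv_chartField hz.1, e₀.right_inv hz.2] at h4
      exact h4.symm
    have h3 := h2.fderiv_eq (𝕜 := ℝ)
    rw [fderiv_clm_apply hPd hsd, fderiv_fun_const] at h3
    have h4 := congr($h3 w)
    simp only [_root_.add_apply, ContinuousLinearMap.comp_apply, ContinuousLinearMap.flip_apply,
      (hfP _ h1.2.1).2, Pi.zero_apply, _root_.zero_apply] at h4
    rw [map_add]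
    exact h4
  have hD := hΓ.mvfderiv_apply he₀ h1.1 hY v
  have hsx : mvfderiv I e₀ x (chartField I e u x) = s (e₀ x) := hse.self_of_nhds
  rw [mvfderiv_congr hse, mvfderiv_fderiv_comp hsd (he₀.mdifferentiableAt h1.1),
    ContinuousLinearMap.comp_apply, hsx] at hD
  apply he.mvfderiv_injective hx
  rw [hd x hx, hD, hconst]
  exact (map_zero (mvfderiv I e x)).symm

end FlatChart

/-- In a flat chart, a parallel form has constant coefficients. -/
theorem IsFlatChart.chartBilin_eq (hflat : IsFlatChart D e) (he : IsSmoothChart I e)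
    (hc : Convex ℝ e.target) {b : BilinField I M} (hb : b.IsSmooth) (hpar : IsParallelForm D b)
    {z z' : E} (hz : z ∈ e.target) (hz' : z' ∈ e.target) :
    chartBilin e b z = chartBilin e b z' := by
  have : CompleteSpace E := FiniteDimensional.complete ℝ E
  have hs := he.contDiffOn_chartBilin hb
  ext u v
  have hd : DifferentiableOn ℝ (fun z ↦ chartBilin e b z u v) e.target :=
    ((hs.differentiableOn (by simp)).clm_apply (differentiableOn_const u)).clm_apply
      (differentiableOn_const v)
  refine e.open_target.is_const_of_fderiv_eq_zero hc.isPreconnected hd ?_ hz hz'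
  intro y hy
  have hx := e.map_target hy
  ext w
  have h := hpar _ (chartField I e w (e.symm y)) _ _ (he.mdifferentiableAt_chartField hx u)
    (he.mdifferentiableAt_chartField hx v)
  rw [hflat _ hx, hflat _ hx] at h
  have e1 : (fun x ↦ b x (chartField I e u x) (chartField I e v x)) =ᶠ[𝓝 (e.symm y)]
      fun x ↦ (fun z ↦ chartBilin e b z u v) (e x) := by
    filter_upwards [e.open_source.mem_nhds hx] with x hx'
    rw [he.bilinField_apply b hx', he.mvfderiv_chartField hx', he.mvfderiv_chartField hx']
  rw [mvfderiv_congr e1, mvfderiv_fderiv_comp (h := fun z ↦ chartBilin e b z u v)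
    (by rw [e.right_inv hy]; exact (hd y hy).differentiableAt (e.open_target.mem_nhds hy))
    (he.mdifferentiableAt hx), ContinuousLinearMap.comp_apply, he.mvfderiv_chartField hx,
    e.right_inv hy] at h
  rw [h]
  simp

/-- In a flat chart, the derivative of the coefficients of an endomorphism field `J` with symmetric
`DJ` is symmetric. -/
theorem IsFlatChart.fderiv_chartEnd_symm (hflat : IsFlatChart D e) (he : IsSmoothChart I e)
    {J : EndField I M} (hJ : J.IsSmooth) (hsymm : HasSymmetricDerivative D J)
    {z : E} (hz : z ∈ e.target) (u v : E) :
    fderiv ℝ (chartEnd e J) z u v = fderiv ℝ (chartEnd e J) z v u := by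
  have : CompleteSpace E := FiniteDimensional.complete ℝ E
  have hx := e.map_target hz
  have hd : DifferentiableAt ℝ (chartEnd e J) z :=
    ((he.contDiffOn_chartEnd fun x _ ↦ hJ x).contDiffAt
      (e.open_target.mem_nhds hz)).differentiableAt (by simp)
  have key : ∀ u v, mvfderiv I e (e.symm z)
      (D (fun y ↦ J y (chartField I e v y)) (e.symm z) (chartField I e u (e.symm z))) =
      fderiv ℝ (chartEnd e J) z u v := by
    intro u v
    have hY : MDiffAt (T% fun y ↦ J y (chartField I e v y)) (e.symm z) :=
      (ContMDiffAt.clm_bundle_apply (hJ _) (he.contMDiffAt_chartField hx v)).mdifferentiableAt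
        (by simp)
    have e1 : (fun y ↦ mvfderiv I e y (J y (chartField I e v y))) =ᶠ[𝓝 (e.symm z)]
        fun y ↦ (fun z ↦ chartEnd e J z v) (e y) := by
      filter_upwards [e.open_source.mem_nhds hx] with y hy
      rw [he.mvfderiv_endField J hy, he.mvfderiv_chartField hy]
    rw [hflat.isChristoffel.mvfderiv_apply he hx hY, mvfderiv_congr e1,
      mvfderiv_fderiv_comp (h := fun z ↦ chartEnd e J z v)
      (by rw [e.right_inv hz]; exact hd.clm_apply (differentiableAt_const v))
      (he.mdifferentiableAt hx), ContinuousLinearMap.comp_apply, he.mvfderiv_chartField hx,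
      e.right_inv hz, hd.fderiv_clm_apply_const, Pi.zero_apply, _root_.zero_apply,
      _root_.zero_apply, add_zero]
  have h := hsymm (e.symm z) _ _ (he.mdifferentiableAt_chartField hx u)
    (he.mdifferentiableAt_chartField hx v)
  rw [hflat _ hx, hflat _ hx, _root_.zero_apply, _root_.zero_apply, map_zero, sub_zero,
    sub_zero] at h
  rw [← key, ← key, h]

/-- In a holomorphic chart, the Christoffel symbols of a torsion-free connection with symmetric
`DJ` are complex symmetric. -/
theorem IsChristoffel.apply_complex [CompleteSpace E] {Γ : E → E →L[ℝ] E →L[ℝ] E}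
    (hΓ : IsChristoffel D e Γ)
    {J : EndField I M} {j : E →L[ℝ] E} (he : IsHolomorphicChart J e j) (hD : D.torsion = 0)
    (hsymm : HasSymmetricDerivative D J) {z : E} (hz : z ∈ e.target) (u v : E) :
    Γ z (j u) v = Γ z u (j v) := by
  have he' := he.isSmoothChart
  have hx := e.map_target hz
  have hS := fun u v ↦ hΓ.symm_of_torsion_eq_zero he' hD hz u v
  have hJ : ∀ u, ∀ y ∈ e.source, J y (chartField I e u y) = chartField I e (j u) y := by
    intro u y hy
    apply he'.mvfderiv_injective hy
    rw [he.mfderiv_comp y hy, he'.mvfderiv_chartField hy, he'.mvfderiv_chartField hy]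
  have key : ∀ u v, mvfderiv I e (e.symm z)
      (D (fun y ↦ J y (chartField I e v y)) (e.symm z) (chartField I e u (e.symm z)) -
        J (e.symm z) (D (chartField I e v) (e.symm z) (chartField I e u (e.symm z)))) =
      Γ z u (j v) - j (Γ z u v) := by
    intro u v
    rw [CovariantDerivative.congr_of_eventuallyEq (he'.mdifferentiableAt_chartField hx (j v))
      (by filter_upwards [e.open_source.mem_nhds hx] with y hy using hJ v y hy), map_sub,
      he.mfderiv_comp _ hx, hΓ _ hx, hΓ _ hx, he'.mvfderiv_chartField hx,
      he'.mvfderiv_chartField hx, he'.mvfderiv_chartField hx, e.right_inv hz]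
  have h := hsymm (e.symm z) _ _ (he'.mdifferentiableAt_chartField hx u)
    (he'.mdifferentiableAt_chartField hx v)
  have h2 := key u v
  rw [h, key v u, hS v u, sub_left_inj] at h2
  rw [hS, h2]

end Connection
end


noncomputable section

/-! ## Induced charts of the cotangent bundle -/

section CotangentChart

open Set Filter Topology

variable {E : Type*} [NormedAddCommGroup E] [NormedSpace ℝ E] [CompleteSpace E]
  {M : Type*} [TopologicalSpace M] [ChartedSpace E M] [IsManifold 𝓘(ℝ, E) ∞ M]
  {e : OpenPartialHomeomorph M E}

lemma contMDiffAt_cotangentChart (he : IsSmoothChart 𝓘(ℝ, E) e) {ξ : CotangentBundle E M}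
    (hξ : ξ.proj ∈ e.source) :
    ContMDiffAt (cotangentModel E) 𝓘(ℝ, E × (E →L[ℝ] ℝ)) ∞ (cotangentChart e) ξ := by
  have hp : ContMDiffAt (cotangentModel E) 𝓘(ℝ, E) ∞
      (TotalSpace.proj : CotangentBundle E M → M) ξ := contMDiffAt_proj _
  have hid : ContMDiffAt (cotangentModel E) (cotangentModel E) ∞
      (fun η : CotangentBundle E M ↦ η) ξ := contMDiffAt_id
  rw [contMDiffAt_totalSpace] at hid
  have h1 : ContMDiffAt (cotangentModel E) 𝓘(ℝ, E) ∞
      (fun η : CotangentBundle E M ↦ e η.proj) ξ :=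
    ContMDiffAt.comp (I' := 𝓘(ℝ, E)) ξ (he.contMDiffAt hξ) hp
  have h2 := ContMDiffAt.comp (I' := 𝓘(ℝ, E)) ξ
    (he.contMDiffAt_inverse_mvfderiv_comp_symmL hξ) hp
  refine (ContMDiffAt.prodMk_space h1 (hid.2.clm_comp h2)).congr_of_eventuallyEq ?_
  filter_upwards [hp.continuousAt.preimage_mem_nhds (e.open_source.mem_nhds hξ),
    hp.continuousAt.preimage_mem_nhds
      (IsSmoothChart.eventually_mem_baseSet (I := 𝓘(ℝ, E)) (x := ξ.proj))] with η h3 h4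
  refine Prod.ext rfl ?_
  ext u
  have h5 := he.isInvertible_mvfderiv_comp_symmL h3 h4
  obtain ⟨u, rfl⟩ := h5.surjective u
  simp only [cotangentChart, ContinuousLinearMap.comp_apply, Function.comp_apply]
  have h6 := h5.inverse_apply_self u
  simp only [ContinuousLinearMap.comp_apply] at h6
  erw [h6, (he.isInvertible h3).inverse_apply_self]
  exact (IsSmoothChart.trivializationAt_dual_apply η.2 u).symm

omit [CompleteSpace E] in
lemma contMDiffAt_cotangentChart_symm (he : IsSmoothChart 𝓘(ℝ, E) e) {z : E × (E →L[ℝ] ℝ)}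
    (hz : z.1 ∈ e.target) :
    ContMDiffAt 𝓘(ℝ, E × (E →L[ℝ] ℝ)) (cotangentModel E) ∞
      (fun z : E × (E →L[ℝ] ℝ) ↦
        (⟨e.symm z.1, z.2 ∘L mvfderiv 𝓘(ℝ, E) e (e.symm z.1)⟩ : CotangentBundle E M)) z := by
  have h1 : ContMDiffAt 𝓘(ℝ, E × (E →L[ℝ] ℝ)) 𝓘(ℝ, E) ∞
      (fun z : E × (E →L[ℝ] ℝ) ↦ e.symm z.1) z :=
    (he.contMDiffAt_symm hz).comp z contDiffAt_fst.contMDiffAt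
  rw [contMDiffAt_totalSpace]
  refine ⟨h1, ?_⟩
  have h2 : ContMDiffAt 𝓘(ℝ, E × (E →L[ℝ] ℝ)) 𝓘(ℝ, E →L[ℝ] ℝ) ∞
      (fun z : E × (E →L[ℝ] ℝ) ↦ z.2) z := contDiffAt_snd.contMDiffAt
  have h3 := ContMDiffAt.comp (I' := 𝓘(ℝ, E)) z
    (he.contMDiffAt_mvfderiv_comp_symmL (e.map_target hz)) h1
  refine (h2.clm_comp h3).congr_of_eventuallyEq (Eventually.of_forall fun y ↦ ?_)
  ext u
  exact IsSmoothChart.trivializationAt_dual_apply _ u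

/-- The chart of the cotangent bundle induced by a smooth chart. -/
def IsSmoothChart.cotangent (he : IsSmoothChart 𝓘(ℝ, E) e) :
    OpenPartialHomeomorph (CotangentBundle E M) (E × (E →L[ℝ] ℝ)) where
  toFun := cotangentChart e
  invFun z := ⟨e.symm z.1, z.2 ∘L mvfderiv 𝓘(ℝ, E) e (e.symm z.1)⟩
  source := TotalSpace.proj ⁻¹' e.source
  target := e.target ×ˢ univ
  map_source' ξ hξ := ⟨e.map_source hξ, trivial⟩
  map_target' z hz := e.map_target hz.1
  left_inv' ξ hξ := by
    obtain ⟨p, α⟩ := ξ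
    have h : ∀ y, y = p → (⟨y, (α ∘L (mvfderiv 𝓘(ℝ, E) e p).inverse) ∘L
        mvfderiv 𝓘(ℝ, E) e y⟩ : CotangentBundle E M) = ⟨p, α⟩ := by
      rintro _ rfl
      congr 1
      ext v
      exact congrArg α ((he.isInvertible hξ).inverse_apply_self v)
    exact h _ (e.left_inv hξ)
  right_inv' z hz := by
    refine Prod.ext (e.right_inv hz.1) ?_
    ext u
    exact congrArg z.2 ((he.isInvertible (e.map_target hz.1)).self_apply_inverse u)
  open_source := e.open_source.preimage (FiberBundle.continuous_proj _ _)
  open_target := e.open_target.prod isOpen_univ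
  continuousOn_toFun ξ hξ :=
    (contMDiffAt_cotangentChart he hξ).continuousAt.continuousWithinAt
  continuousOn_invFun z hz :=
    (contMDiffAt_cotangentChart_symm he hz.1).continuousAt.continuousWithinAt

lemma IsSmoothChart.isSmoothChart_cotangent (he : IsSmoothChart 𝓘(ℝ, E) e) :
    IsSmoothChart (cotangentModel E) he.cotangent where
  contMDiffOn _ hξ := (contMDiffAt_cotangentChart he hξ).contMDiffWithinAt
  contMDiffOn_symm _ hz := (contMDiffAt_cotangentChart_symm he hz.1).contMDiffWithinAt

lemma mvfderiv_cotangentChart_fst (he : IsSmoothChart 𝓘(ℝ, E) e) {ξ : CotangentBundle E M}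
    (hξ : ξ.proj ∈ e.source) (w : TangentSpace (cotangentModel E) ξ) :
    (mvfderiv (cotangentModel E) (cotangentChart e) ξ w).1 =
      mvfderiv 𝓘(ℝ, E) e ξ.proj (projDeriv ξ w) := by
  have h1 := mvfderiv_fderiv_comp (h := Prod.fst) differentiableAt_fst
    ((contMDiffAt_cotangentChart he hξ).mdifferentiableAt (by simp))
  have h2 := mfderiv_comp (I' := 𝓘(ℝ, E)) ξ (he.mdifferentiableAt hξ)
    (mdifferentiableAt_proj (CotangentSpace E : M → Type _))
  rw [fderiv_fst] at h1
  exact congr($h1 w).symm.trans congr($h2 w)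

lemma mvfderiv_cotangentChart_snd (he : IsSmoothChart 𝓘(ℝ, E) e) {ξ : CotangentBundle E M}
    (hξ : ξ.proj ∈ e.source) (w : TangentSpace (cotangentModel E) ξ) (u : E) :
    (mvfderiv (cotangentModel E) (cotangentChart e) ξ w).2 u =
      mvfderiv (cotangentModel E) (fiberLinear (chartField 𝓘(ℝ, E) e u)) ξ w := by
  let L : E × (E →L[ℝ] ℝ) →L[ℝ] ℝ := ContinuousLinearMap.apply ℝ ℝ u ∘L
    ContinuousLinearMap.snd ℝ E (E →L[ℝ] ℝ)
  have h1 := mvfderiv_fderiv_comp (h := L) L.differentiableAt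
    ((contMDiffAt_cotangentChart he hξ).mdifferentiableAt (by simp))
  rw [L.fderiv] at h1
  exact congr($h1 w).symm

variable {D : CovariantDerivative 𝓘(ℝ, E) E (TangentSpace 𝓘(ℝ, E) : M → Type _)}

/-- The connection map in the chart induced by a smooth chart. -/
lemma IsChristoffel.connectionMap_chartField [FiniteDimensional ℝ E] {Γ : E → E →L[ℝ] E →L[ℝ] E}
    (hΓ : IsChristoffel D e Γ) (he : IsSmoothChart 𝓘(ℝ, E) e) {ξ : CotangentBundle E M}
    (hξ : ξ.proj ∈ e.source) (w : TangentSpace (cotangentModel E) ξ) (u : E) :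
    connectionMap D ξ w (chartField 𝓘(ℝ, E) e u ξ.proj) =
      (mvfderiv (cotangentModel E) (cotangentChart e) ξ w).2 u - (cotangentChart e ξ).2
        (Γ (e ξ.proj) (mvfderiv (cotangentModel E) (cotangentChart e) ξ w).1 u) := by
  rw [connectionMap_apply D ξ w (he.mdifferentiableAt_chartField hξ u), hΓ _ hξ,
    mvfderiv_cotangentChart_snd he hξ, mvfderiv_cotangentChart_fst he hξ]
  rfl

end CotangentChart
end


noncomputable section

/-! ## The linear model -/

section LinearModel

variable {E : Type*} [NormedAddCommGroup E] [NormedSpace ℝ E]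

/-- A nondegenerate continuous bilinear form on a finite-dimensional space is an isomorphism onto
the dual space. -/
lemma ContinuousLinearMap.isInvertible_of_nondegenerate [FiniteDimensional ℝ E]
    {b : E →L[ℝ] E →L[ℝ] ℝ} (h : ∀ v, (∀ w, b v w = 0) → v = 0) : b.IsInvertible := by
  have hinj : Function.Injective b.toLinearMap := by
    rw [← LinearMap.ker_eq_bot, LinearMap.ker_eq_bot']
    intro v hv
    exact h v fun w ↦ congr($hv w)
  have hr : Module.finrank ℝ E = Module.finrank ℝ (E →L[ℝ] ℝ) := by
    rw [← (LinearMap.toContinuousLinearMap (𝕜 := ℝ) (E := E) (F' := ℝ)).finrank_eq]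
    exact (Subspace.dual_finrank_eq (K := ℝ) (V := E)).symm
  refine ⟨(LinearEquiv.ofBijective b.toLinearMap
    ⟨hinj, (LinearMap.injective_iff_surjective_of_finrank_eq_finrank
      hr).1 hinj⟩).toContinuousLinearEquiv, ?_⟩
  ext v w
  rfl

/-- A complex structure `j` and a symplectic form `Ω` such that `Ω(j·, ·)` is symmetric. -/
structure IsLinearKahler (j : E →L[ℝ] E) (Ω : E →L[ℝ] E →L[ℝ] ℝ) : Prop where
  sq : ∀ v, j (j v) = - v
  skew : ∀ v w, Ω v w = - Ω w v
  apply_complex : ∀ v w, Ω (j v) w = - Ω v (j w)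
  isInvertible : Ω.IsInvertible

/-- The endomorphism `(a, β) ↦ (j a, β ∘ j)`. -/
def linearJ (j : E →L[ℝ] E) : E × (E →L[ℝ] ℝ) →L[ℝ] E × (E →L[ℝ] ℝ) :=
  j.prodMap (ContinuousLinearMap.precomp ℝ j)

/-- The endomorphism `(a, β) ↦ (Ω⁻¹ β, Ω a)`. -/
def linearOmega (Ω : E →L[ℝ] E →L[ℝ] ℝ) : E × (E →L[ℝ] ℝ) →L[ℝ] E × (E →L[ℝ] ℝ) :=
  (Ω.inverse ∘L ContinuousLinearMap.snd ℝ E (E →L[ℝ] ℝ)).prod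
    (Ω ∘L ContinuousLinearMap.fst ℝ E (E →L[ℝ] ℝ))

/-- The bilinear form `(y, y') ↦ - Ω(j (p y), p y') - q y (j Ω⁻¹ (q y'))`. -/
def diagonalForm {V : Type*} [NormedAddCommGroup V] [NormedSpace ℝ V] (p : V →L[ℝ] E)
    (q : V →L[ℝ] E →L[ℝ] ℝ) (j : E →L[ℝ] E) (Ω : E →L[ℝ] E →L[ℝ] ℝ) : V →L[ℝ] V →L[ℝ] ℝ :=
  ContinuousLinearMap.precomp ℝ p ∘L Ω ∘L (-j) ∘L p
    + ContinuousLinearMap.precomp ℝ ((-j) ∘L Ω.inverse ∘L q) ∘L q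

lemma diagonalForm_apply {V : Type*} [NormedAddCommGroup V] [NormedSpace ℝ V] (p : V →L[ℝ] E)
    (q : V →L[ℝ] E →L[ℝ] ℝ) (j : E →L[ℝ] E) (Ω : E →L[ℝ] E →L[ℝ] ℝ) (y y' : V) :
    diagonalForm p q j Ω y y' = - Ω (j (p y)) (p y') - q y (j (Ω.inverse (q y'))) := by
  have h : diagonalForm p q j Ω y y' = Ω (- j (p y)) (p y') + q y (- j (Ω.inverse (q y'))) := rfl
  rw [h, map_neg, map_neg, _root_.neg_apply, sub_eq_add_neg]

/-- The metric `((a, β), (a', β')) ↦ - Ω(j a, a') - β(j Ω⁻¹ β')`. -/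
abbrev linearMetric (j : E →L[ℝ] E) (Ω : E →L[ℝ] E →L[ℝ] ℝ) :=
  diagonalForm (ContinuousLinearMap.fst ℝ E (E →L[ℝ] ℝ)) (ContinuousLinearMap.snd ℝ E (E →L[ℝ] ℝ))
    j Ω

variable {j : E →L[ℝ] E} {Ω : E →L[ℝ] E →L[ℝ] ℝ}

lemma linearJ_apply (j : E →L[ℝ] E) (y : E × (E →L[ℝ] ℝ)) :
    linearJ j y = (j y.1, y.2 ∘L j) := rfl

lemma linearOmega_apply (Ω : E →L[ℝ] E →L[ℝ] ℝ) (y : E × (E →L[ℝ] ℝ)) :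
    linearOmega Ω y = (Ω.inverse y.2, Ω y.1) := rfl

lemma linearMetric_apply (j : E →L[ℝ] E) (Ω : E →L[ℝ] E →L[ℝ] ℝ) (y y' : E × (E →L[ℝ] ℝ)) :
    linearMetric j Ω y y' = - Ω (j y.1) y'.1 - y.2 (j (Ω.inverse y'.2)) :=
  diagonalForm_apply _ _ _ _ _ _

namespace IsLinearKahler

variable (h : IsLinearKahler j Ω)
include h

lemma exists_eq (y : E × (E →L[ℝ] ℝ)) : ∃ a b, y = (a, Ω b) :=
  ⟨y.1, Ω.inverse y.2, Prod.ext rfl (h.isInvertible.self_apply_inverse _).symm⟩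

lemma linearJ_mk (a b : E) : linearJ j (a, Ω b) = (j a, - Ω (j b)) := by
  refine Prod.ext rfl ?_
  ext v
  simp [linearJ_apply, h.apply_complex]

lemma linearOmega_mk (a b : E) : linearOmega Ω (a, Ω b) = (b, Ω a) :=
  Prod.ext (h.isInvertible.inverse_apply_self b) rfl

lemma linearMetric_mk (a b a' b' : E) :
    linearMetric j Ω (a, Ω b) (a', Ω b') = - Ω (j a) a' + Ω (j b) b' := by
  rw [linearMetric_apply, h.isInvertible.inverse_apply_self, h.apply_complex b]
  ring

lemma linearJ_sq (y : E × (E →L[ℝ] ℝ)) : linearJ j (linearJ j y) = - y := by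
  refine Prod.ext (h.sq _) ?_
  ext v
  simp [linearJ_apply, h.sq]

lemma linearOmega_sq (y : E × (E →L[ℝ] ℝ)) : linearOmega Ω (linearOmega Ω y) = y := by
  obtain ⟨a, b, rfl⟩ := h.exists_eq y
  rw [h.linearOmega_mk, h.linearOmega_mk]

lemma linearJ_linearOmega (y : E × (E →L[ℝ] ℝ)) :
    linearJ j (linearOmega Ω y) = - linearOmega Ω (linearJ j y) := by
  obtain ⟨a, b, rfl⟩ := h.exists_eq y
  rw [h.linearOmega_mk, h.linearJ_mk, h.linearJ_mk, ← map_neg Ω (j b), h.linearOmega_mk,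
    Prod.neg_mk, neg_neg]

lemma symm_complex (v w : E) : Ω (j v) w = Ω (j w) v := by
  rw [h.apply_complex, h.skew, neg_neg]

lemma linearMetric_symm (y y' : E × (E →L[ℝ] ℝ)) :
    linearMetric j Ω y y' = linearMetric j Ω y' y := by
  obtain ⟨a, b, rfl⟩ := h.exists_eq y
  obtain ⟨a', b', rfl⟩ := h.exists_eq y'
  rw [h.linearMetric_mk, h.linearMetric_mk, h.symm_complex a, h.symm_complex b]

lemma eq_zero_of_apply {v : E} (hv : ∀ w, Ω (j v) w = 0) : v = 0 := by
  have h1 : j v = 0 := h.isInvertible.injective (by ext w; simpa using hv w)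
  simpa [h1] using h.sq v

lemma linearMetric_nondegenerate {y : E × (E →L[ℝ] ℝ)} (hy : ∀ y', linearMetric j Ω y y' = 0) :
    y = 0 := by
  obtain ⟨a, b, rfl⟩ := h.exists_eq y
  have ha : a = 0 := h.eq_zero_of_apply fun w ↦ by
    have h1 := hy (w, Ω 0)
    rw [h.linearMetric_mk] at h1
    simpa using h1
  have hb : b = 0 := h.eq_zero_of_apply fun w ↦ by
    have h1 := hy (0, Ω w)
    rw [h.linearMetric_mk] at h1
    simpa using h1
  simp [ha, hb]

lemma linearMetric_linearJ (y y' : E × (E →L[ℝ] ℝ)) :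
    linearMetric j Ω (linearJ j y) y' = Ω y.1 y'.1 + y.2 (Ω.inverse y'.2) := by
  obtain ⟨a, b, rfl⟩ := h.exists_eq y
  obtain ⟨a', b', rfl⟩ := h.exists_eq y'
  rw [h.linearJ_mk, ← map_neg, h.linearMetric_mk, h.isInvertible.inverse_apply_self]
  simp [h.sq]

lemma linearMetric_linearOmega (y y' : E × (E →L[ℝ] ℝ)) :
    linearMetric j Ω (linearOmega Ω y) y' = y.2 (j y'.1) - y'.2 (j y.1) := by
  obtain ⟨a, b, rfl⟩ := h.exists_eq y
  obtain ⟨a', b', rfl⟩ := h.exists_eq y'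
  rw [h.linearOmega_mk, h.linearMetric_mk, h.apply_complex b, h.symm_complex a, h.apply_complex b']
  ring

lemma linearMetric_linearJ_linearOmega (y y' : E × (E →L[ℝ] ℝ)) :
    linearMetric j Ω (linearJ j (linearOmega Ω y)) y' = y.2 y'.1 - y'.2 y.1 := by
  obtain ⟨a, b, rfl⟩ := h.exists_eq y
  obtain ⟨a', b', rfl⟩ := h.exists_eq y'
  rw [h.linearMetric_linearJ, h.linearOmega_mk, h.isInvertible.inverse_apply_self]
  rw [h.skew a b']
  ring

lemma inverse_skew (α β : E →L[ℝ] ℝ) : α (Ω.inverse β) = - β (Ω.inverse α) := by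
  obtain ⟨a, rfl⟩ := h.isInvertible.surjective α
  obtain ⟨b, rfl⟩ := h.isInvertible.surjective β
  rw [h.isInvertible.inverse_apply_self, h.isInvertible.inverse_apply_self, h.skew]

lemma linearMetric_linearJ_skew (y y' : E × (E →L[ℝ] ℝ)) :
    linearMetric j Ω (linearJ j y) y' = - linearMetric j Ω y (linearJ j y') := by
  rw [h.linearMetric_symm y, h.linearMetric_linearJ, h.linearMetric_linearJ, h.skew,
    h.inverse_skew]
  ring

lemma linearMetric_linearOmega_skew (y y' : E × (E →L[ℝ] ℝ)) :
    linearMetric j Ω (linearOmega Ω y) y' = - linearMetric j Ω y (linearOmega Ω y') := by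
  rw [h.linearMetric_symm y, h.linearMetric_linearOmega, h.linearMetric_linearOmega]
  ring

lemma linearOmega_eq_iff (y : E × (E →L[ℝ] ℝ)) : linearOmega Ω y = y ↔ y.2 = Ω y.1 := by
  obtain ⟨a, b, rfl⟩ := h.exists_eq y
  rw [h.linearOmega_mk, Prod.mk.injEq, h.isInvertible.injective.eq_iff,
    h.isInvertible.injective.eq_iff]
  exact ⟨fun h ↦ h.1, fun h ↦ ⟨h, h.symm⟩⟩

lemma linearOmega_eq_neg_iff (y : E × (E →L[ℝ] ℝ)) :
    linearOmega Ω y = - y ↔ y.2 = Ω (- y.1) := by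
  obtain ⟨a, b, rfl⟩ := h.exists_eq y
  rw [h.linearOmega_mk, Prod.neg_mk, Prod.mk.injEq, ← map_neg,
    h.isInvertible.injective.eq_iff, h.isInvertible.injective.eq_iff]
  exact ⟨fun h ↦ h.1, fun h ↦ ⟨h, by rw [h, neg_neg]⟩⟩

lemma linearJ_linearOmega_eq_iff (y : E × (E →L[ℝ] ℝ)) :
    linearJ j (linearOmega Ω y) = y ↔ y.2 = Ω (- j y.1) := by
  obtain ⟨a, b, rfl⟩ := h.exists_eq y
  rw [h.linearOmega_mk, h.linearJ_mk, Prod.mk.injEq,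
    ← map_neg, h.isInvertible.injective.eq_iff, h.isInvertible.injective.eq_iff]
  exact ⟨fun h ↦ h.2.symm, fun h' ↦ ⟨by rw [h', map_neg, h.sq, neg_neg], h'.symm⟩⟩

lemma linearJ_linearOmega_eq_neg_iff (y : E × (E →L[ℝ] ℝ)) :
    linearJ j (linearOmega Ω y) = - y ↔ y.2 = Ω (j y.1) := by
  obtain ⟨a, b, rfl⟩ := h.exists_eq y
  rw [h.linearOmega_mk, h.linearJ_mk, Prod.neg_mk, Prod.mk.injEq,
    neg_inj, h.isInvertible.injective.eq_iff, h.isInvertible.injective.eq_iff]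
  exact ⟨fun h ↦ h.2.symm, fun h' ↦ ⟨by rw [h', h.sq], h'.symm⟩⟩

end IsLinearKahler

end LinearModel
end


noncomputable section

/-! ## Special charts -/

section SpecialChart

open Set Filter Topology

variable {E : Type*} [NormedAddCommGroup E] [NormedSpace ℝ E] [FiniteDimensional ℝ E]
  {H : Type*} [TopologicalSpace H] {I : ModelWithCorners ℝ E H}
  {M : Type*} [TopologicalSpace M] [ChartedSpace H M] [IsManifold I ∞ M]
  {J : EndField I M} {g : BilinField I M}
  {D : CovariantDerivative I E (TangentSpace I : M → Type _)}

lemma BilinField.IsSmooth.fundamentalForm (hg : g.IsSmooth) (hJ : J.IsSmooth)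
    (hc : ∀ x : M, ∃ e : OpenPartialHomeomorph M E, x ∈ e.source ∧ IsSmoothChart I e) :
    (fundamentalForm g J).IsSmooth := by
  have : CompleteSpace E := FiniteDimensional.complete ℝ E
  intro x
  obtain ⟨e, hx, he⟩ := hc x
  have h1 := (he.contDiffOn_chartBilin hg).contDiffAt (e.open_target.mem_nhds (e.map_source hx))
  have h2 := (he.contDiffOn_chartEnd fun x _ ↦ hJ x).contDiffAt
    (e.open_target.mem_nhds (e.map_source hx))
  refine he.contMDiffAt_bilinField hx (h1.clm_comp h2) fun y hy v w ↦ ?_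
  rw [ContinuousLinearMap.comp_apply, ← he.mvfderiv_endField J hy]
  exact he.bilinField_apply g hy _ _

namespace IsPseudoKahler

variable (h : IsPseudoKahler J g)
include h

omit [FiniteDimensional ℝ E] in
lemma fundamentalForm_skew (x : M) (v w : TangentSpace I x) :
    fundamentalForm g J x v w = - fundamentalForm g J x w v :=
  (h.skew x v w).trans (congrArg _ (h.metric.symm x _ _))

omit [FiniteDimensional ℝ E] in
lemma fundamentalForm_apply_complex (x : M) (v w : TangentSpace I x) :
    fundamentalForm g J x (J x v) w = - fundamentalForm g J x v (J x w) :=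
  h.skew x _ _

lemma fundamentalForm_isInvertible (x : M) : (fundamentalForm g J x).IsInvertible := by
  refine ContinuousLinearMap.isInvertible_of_nondegenerate (E := E) fun v hv ↦ ?_
  have h1 : J x v = 0 := h.metric.nondegenerate x _ hv
  have h2 := h.complex.sq x v
  rw [h1, map_zero] at h2
  exact neg_eq_zero.1 h2.symm

lemma metric_isInvertible (x : M) : (g x).IsInvertible :=
  ContinuousLinearMap.isInvertible_of_nondegenerate (E := E) (h.metric.nondegenerate x)

/-- The inverse of the metric in terms of the inverse of the Kähler form. -/
lemma metric_inverse_apply (x : M) (α : TangentSpace I x →L[ℝ] ℝ) :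
    (g x).inverse α = J x ((fundamentalForm g J x).inverse α) := by
  rw [(h.metric_isInvertible x).inverse_apply_eq]
  exact ((h.fundamentalForm_isInvertible x).self_apply_inverse α).symm

end IsPseudoKahler

variable (J g D) in
/-- A chart in which the connection `D` is trivial and the Kähler form is constant, equal to `Ω`. -/
structure IsSpecialChart (e : OpenPartialHomeomorph M E) (Ω : E →L[ℝ] E →L[ℝ] ℝ) : Prop
    extends IsSmoothChart I e where
  flat : IsFlatChart D e
  fundamentalForm_apply : ∀ x ∈ e.source, ∀ v w,
    fundamentalForm g J x v w = Ω (mvfderiv I e x v) (mvfderiv I e x w)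
  isLinearKahler : ∀ z ∈ e.target, IsLinearKahler (chartEnd e J z) Ω
  contDiffOn_chartEnd' : ContDiffOn ℝ ∞ (chartEnd e J) e.target
  fderiv_symm : ∀ z ∈ e.target, ∀ u v,
    fderiv ℝ (chartEnd e J) z u v = fderiv ℝ (chartEnd e J) z v u

theorem IsSpecialPseudoKahler.exists_isSpecialChart [T2Space M] (h : IsSpecialPseudoKahler J g D)
    (x : M) : ∃ e Ω, x ∈ e.source ∧ IsSpecialChart J g D e Ω := by
  have : CompleteSpace E := FiniteDimensional.complete ℝ E
  have hc : ∀ x : M, ∃ e : OpenPartialHomeomorph M E, x ∈ e.source ∧ IsSmoothChart I e := by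
    intro x
    obtain ⟨e, j, hx, he⟩ := h.complex.exists_chart x
    exact ⟨e, hx, he.isSmoothChart⟩
  obtain ⟨e₀, hx₀, he₀⟩ := hc x
  obtain ⟨e, he, hx, hflat, r, hr⟩ :=
    exists_isFlatChart h.smooth_connection h.flat h.torsion_free he₀ hx₀
  have hω : ∀ y ∈ e.source, ∀ v w, fundamentalForm g J y v w =
      chartBilin e (fundamentalForm g J) (e x) (mvfderiv I e y v) (mvfderiv I e y w) := by
    intro y hy v w
    rw [he.bilinField_apply _ hy, hflat.chartBilin_eq he (hr ▸ convex_ball _ _)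
      (h.metric.smooth.fundamentalForm h.complex.smooth hc) h.parallel (e.map_source hy)
      (e.map_source hx)]
  refine ⟨e, chartBilin e (fundamentalForm g J) (e x), hx, he, hflat, hω, fun z hz ↦ ?_,
    he.contDiffOn_chartEnd fun x _ ↦ h.complex.smooth x,
    fun z hz u v ↦ hflat.fderiv_chartEnd_symm he h.complex.smooth h.symmetric hz u v⟩
  have hy := e.map_target hz
  have hJ : ∀ v, chartEnd e J z (mvfderiv I e (e.symm z) v) = mvfderiv I e (e.symm z) (J _ v) := by
    intro v
    rw [he.mvfderiv_endField J hy, e.right_inv hz]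
  refine ⟨fun v ↦ ?_, fun v w ↦ ?_, fun v w ↦ ?_, ?_⟩
  · obtain ⟨v, rfl⟩ := (he.isInvertible hy).surjective v
    rw [hJ, hJ, h.complex.sq, map_neg]
  · obtain ⟨v, rfl⟩ := (he.isInvertible hy).surjective v
    obtain ⟨w, rfl⟩ := (he.isInvertible hy).surjective w
    rw [← hω _ hy, ← hω _ hy, h.fundamentalForm_skew]
  · obtain ⟨v, rfl⟩ := (he.isInvertible hy).surjective v
    obtain ⟨w, rfl⟩ := (he.isInvertible hy).surjective w
    rw [hJ, hJ, ← hω _ hy, ← hω _ hy, h.fundamentalForm_apply_complex]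
  · refine ContinuousLinearMap.isInvertible_of_nondegenerate fun v hv ↦ ?_
    obtain ⟨v, rfl⟩ := (he.isInvertible hy).surjective v
    have h1 : v = 0 := by
      refine (h.fundamentalForm_isInvertible (e.symm z)).injective ?_
      ext w
      rw [hω _ hy, hv, map_zero]
      rfl
    rw [h1, map_zero]

end SpecialChart
end


noncomputable section

/-! ## The structures on the cotangent bundle in induced charts -/

section CotangentCoordinates

open Set Filter Topology

variable {E : Type*} [NormedAddCommGroup E] [NormedSpace ℝ E] [FiniteDimensional ℝ E]
  {M : Type*} [TopologicalSpace M] [ChartedSpace E M] [IsManifold 𝓘(ℝ, E) ∞ M]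
  {e : OpenPartialHomeomorph M E}
  {D : CovariantDerivative 𝓘(ℝ, E) E (TangentSpace 𝓘(ℝ, E) : M → Type _)}
  {J : EndField 𝓘(ℝ, E) M} {g b : BilinField 𝓘(ℝ, E) M}

lemma splitting_cotangentJ (ξ : CotangentBundle E M) (w : TangentSpace (cotangentModel E) ξ) :
    splitting D ξ (cotangentJ D J ξ w) =
      (J ξ.proj (projDeriv ξ w), connectionMap D ξ w ∘L J ξ.proj) :=
  (splitting D ξ).apply_symm_apply _

lemma splitting_cotangentOmega (ξ : CotangentBundle E M) (w : TangentSpace (cotangentModel E) ξ) :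
    splitting D ξ (cotangentOmega D b ξ w) =
      ((b ξ.proj).inverse (connectionMap D ξ w), b ξ.proj (projDeriv ξ w)) :=
  (splitting D ξ).apply_symm_apply _

/-- The endomorphism field `cotangentJ D J` in the chart induced by a chart in which the
Christoffel symbols are complex symmetric. -/
lemma IsChristoffel.mvfderiv_cotangentJ [CompleteSpace E] {Γ : E → E →L[ℝ] E →L[ℝ] E}
    (hΓ : IsChristoffel D e Γ) (he : IsSmoothChart 𝓘(ℝ, E) e) {ξ : CotangentBundle E M}
    (hξ : ξ.proj ∈ e.source) {j : E →L[ℝ] E}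
    (hJ : ∀ v, mvfderiv 𝓘(ℝ, E) e ξ.proj (J ξ.proj v) = j (mvfderiv 𝓘(ℝ, E) e ξ.proj v))
    (hj : ∀ u v, Γ (e ξ.proj) (j u) v = Γ (e ξ.proj) u (j v))
    (w : TangentSpace (cotangentModel E) ξ) :
    mvfderiv (cotangentModel E) (cotangentChart e) ξ (cotangentJ D J ξ w) =
      linearJ j (mvfderiv (cotangentModel E) (cotangentChart e) ξ w) := by
  have h := splitting_cotangentJ (D := D) (J := J) ξ w
  rw [splitting_apply, Prod.mk.injEq] at h
  have h1 : (mvfderiv (cotangentModel E) (cotangentChart e) ξ (cotangentJ D J ξ w)).1 =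
      j (mvfderiv (cotangentModel E) (cotangentChart e) ξ w).1 := by
    rw [mvfderiv_cotangentChart_fst he hξ, mvfderiv_cotangentChart_fst he hξ, h.1, hJ]
  refine Prod.ext h1 ?_
  ext u
  have h2 := hΓ.connectionMap_chartField he hξ (cotangentJ D J ξ w) u
  have h3 := hΓ.connectionMap_chartField he hξ w (j u)
  have h4 : J ξ.proj (chartField 𝓘(ℝ, E) e u ξ.proj) = chartField 𝓘(ℝ, E) e (j u) ξ.proj :=
    he.mvfderiv_injective hξ (by rw [hJ, he.mvfderiv_chartField hξ, he.mvfderiv_chartField hξ])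
  rw [h.2, ContinuousLinearMap.comp_apply, h4, h3, h1, hj, sub_left_inj] at h2
  exact h2.symm

lemma IsFlatChart.connectionMap_chartField [CompleteSpace E] (hflat : IsFlatChart D e)
    (he : IsSmoothChart 𝓘(ℝ, E) e) {ξ : CotangentBundle E M}
    (hξ : ξ.proj ∈ e.source) (w : TangentSpace (cotangentModel E) ξ) (u : E) :
    connectionMap D ξ w (chartField 𝓘(ℝ, E) e u ξ.proj) =
      (mvfderiv (cotangentModel E) (cotangentChart e) ξ w).2 u := by
  rw [hflat.isChristoffel.connectionMap_chartField he hξ w u]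
  simp

namespace IsSpecialChart

variable {Ω : E →L[ℝ] E →L[ℝ] ℝ} (he : IsSpecialChart J g D e Ω) {ξ : CotangentBundle E M}
  (hξ : ξ.proj ∈ e.source)
include he hξ

lemma connectionMap_apply [CompleteSpace E] (w : TangentSpace (cotangentModel E) ξ)
    (v : TangentSpace 𝓘(ℝ, E) ξ.proj) :
    connectionMap D ξ w v = (mvfderiv (cotangentModel E) (cotangentChart e) ξ w).2
      (mvfderiv 𝓘(ℝ, E) e ξ.proj v) := by
  rw [← he.flat.connectionMap_chartField he.toIsSmoothChart hξ, he.chartField_mvfderiv hξ]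

lemma mvfderiv_cotangentJ [CompleteSpace E] (w : TangentSpace (cotangentModel E) ξ) :
    mvfderiv (cotangentModel E) (cotangentChart e) ξ (cotangentJ D J ξ w) =
      linearJ (chartEnd e J (e ξ.proj)) (mvfderiv (cotangentModel E) (cotangentChart e) ξ w) :=
  he.flat.isChristoffel.mvfderiv_cotangentJ he.toIsSmoothChart hξ
    (fun v ↦ he.mvfderiv_endField J hξ v) (fun _ _ ↦ rfl) w

omit [FiniteDimensional ℝ E] in
lemma mvfderiv_inverse_fundamentalForm (hω : (fundamentalForm g J ξ.proj).IsInvertible)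
    {α : TangentSpace 𝓘(ℝ, E) ξ.proj →L[ℝ] ℝ} {β : E →L[ℝ] ℝ}
    (hα : ∀ v, α v = β (mvfderiv 𝓘(ℝ, E) e ξ.proj v)) :
    mvfderiv 𝓘(ℝ, E) e ξ.proj ((fundamentalForm g J ξ.proj).inverse α) = Ω.inverse β := by
  have hΩ := (he.isLinearKahler _ (e.map_source hξ)).isInvertible
  refine hΩ.injective ?_
  rw [hΩ.self_apply_inverse]
  ext u
  obtain ⟨v, rfl⟩ := (he.isInvertible hξ).surjective u
  rw [← he.fundamentalForm_apply _ hξ, hω.self_apply_inverse, hα]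

lemma mvfderiv_cotangentOmega [CompleteSpace E] (hω : (fundamentalForm g J ξ.proj).IsInvertible)
    (w : TangentSpace (cotangentModel E) ξ) :
    mvfderiv (cotangentModel E) (cotangentChart e) ξ
        (cotangentOmega D (fundamentalForm g J) ξ w) =
      linearOmega Ω (mvfderiv (cotangentModel E) (cotangentChart e) ξ w) := by
  have h := splitting_cotangentOmega (D := D) (b := fundamentalForm g J) ξ w
  rw [splitting_apply, Prod.mk.injEq] at h
  refine Prod.ext ?_ ?_
  · rw [mvfderiv_cotangentChart_fst he.toIsSmoothChart hξ, h.1]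
    exact he.mvfderiv_inverse_fundamentalForm hξ hω (he.connectionMap_apply hξ w)
  · ext u
    rw [← he.flat.connectionMap_chartField he.toIsSmoothChart hξ, h.2, linearOmega_apply,
      mvfderiv_cotangentChart_fst he.toIsSmoothChart hξ]
    refine (he.fundamentalForm_apply _ hξ _ _).trans ?_
    rw [he.mvfderiv_chartField hξ]

lemma cotangentMetric_apply [CompleteSpace E] (hK : IsPseudoKahler J g)
    (w w' : TangentSpace (cotangentModel E) ξ) :
    cotangentMetric D g ξ w w' = linearMetric (chartEnd e J (e ξ.proj)) Ω
      (mvfderiv (cotangentModel E) (cotangentChart e) ξ w)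
      (mvfderiv (cotangentModel E) (cotangentChart e) ξ w') := by
  have h1 : cotangentMetric D g ξ w w' = g ξ.proj (projDeriv ξ w) (projDeriv ξ w') -
      g ξ.proj ((g ξ.proj).inverse (connectionMap D ξ w))
        ((g ξ.proj).inverse (connectionMap D ξ w')) := rfl
  have h2 : ∀ v v', g ξ.proj v v' = - fundamentalForm g J ξ.proj (J ξ.proj v) v' := by
    intro v v'
    have h : fundamentalForm g J ξ.proj (J ξ.proj v) v' = g ξ.proj (J ξ.proj (J ξ.proj v)) v' := rfl
    rw [h, hK.complex.sq, map_neg, _root_.neg_apply, neg_neg]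
  rw [h1, linearMetric_apply]
  congr 1
  · rw [h2, he.fundamentalForm_apply _ hξ, he.mvfderiv_endField J hξ,
      mvfderiv_cotangentChart_fst he.toIsSmoothChart hξ,
      mvfderiv_cotangentChart_fst he.toIsSmoothChart hξ]
  · rw [(hK.metric_isInvertible _).self_apply_inverse]
    refine (he.connectionMap_apply hξ w _).trans ?_
    refine congrArg _ ?_
    refine (congrArg _ (hK.metric_inverse_apply _ _)).trans ?_
    rw [he.mvfderiv_endField J hξ]
    exact congrArg _ (he.mvfderiv_inverse_fundamentalForm hξ (hK.fundamentalForm_isInvertible _)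
      (he.connectionMap_apply hξ w'))

end IsSpecialChart

end CotangentCoordinates
end


noncomputable section

section ParaComplex

variable {E : Type*} [NormedAddCommGroup E] [NormedSpace ℝ E]
  {H : Type*} [TopologicalSpace H] {I : ModelWithCorners ℝ E H}
  {M : Type*} [TopologicalSpace M] [ChartedSpace H M]

lemma mem_plusDistribution_iff {J : EndField I M} {x : M} {v : TangentSpace I x} :
    v ∈ plusDistribution J x ↔ J x v = v :=
  (LinearMap.mem_ker.trans sub_eq_zero).trans eq_comm

lemma mem_minusDistribution_iff {J : EndField I M} {x : M} {v : TangentSpace I x} :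
    v ∈ minusDistribution J x ↔ J x v = - v :=
  LinearMap.mem_ker.trans (add_eq_zero_iff_eq_neg'.trans Iff.rfl)

/-- A smooth involution which anticommutes with an almost complex structure is almost
para-complex. -/
lemma isAlmostParaComplex_of_anticommute [IsManifold I ∞ M] [Nontrivial E] {K J : EndField I M}
    (hJ : J.IsSmooth) (hK : ∀ x v, K x (K x v) = - v) (hJJ : ∀ x v, J x (J x v) = v)
    (hKJ : ∀ x v, K x (J x v) = - J x (K x v)) : IsAlmostParaComplex J where
  smooth := hJ
  ne_id x hx := by
    have : Nontrivial (TangentSpace I x) := inferInstanceAs (Nontrivial E)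
    obtain ⟨v, hv⟩ := exists_ne (0 : TangentSpace I x)
    have h1 : ∀ w, J x w = w := fun w ↦ congr($hx w)
    have h2 := hKJ x v
    rw [h1, h1, eq_neg_iff_add_eq_zero, ← two_smul ℝ] at h2
    have h3 := hK x v
    rw [(smul_eq_zero.1 h2).resolve_left two_ne_zero, map_zero] at h3
    exact hv (neg_eq_zero.1 h3.symm)
  sq := hJJ
  finrank_eq x := by
    refine LinearEquiv.finrank_eq (LinearEquiv.ofLinearMap
      (((K x).toLinearMap.restrict (p := plusDistribution J x) (q := minusDistribution J x) ?_))
      (-((K x).toLinearMap.restrict (p := minusDistribution J x) (q := plusDistribution J x) ?_))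
      ?_ ?_)
    · intro v hv
      rw [mem_plusDistribution_iff] at hv
      rw [mem_minusDistribution_iff]
      have h := hKJ x v
      rw [hv] at h
      exact neg_eq_iff_eq_neg.1 h.symm
    · intro v hv
      rw [mem_minusDistribution_iff] at hv
      rw [mem_plusDistribution_iff]
      have h := hKJ x v
      rw [hv, map_neg, neg_inj] at h
      exact h.symm
    · ext v
      have h := hK x v
      change K x (- K x v) = v
      rw [map_neg, h, neg_neg]
    · ext v
      have h := hK x v
      change - K x (K x v) = v
      rw [h, neg_neg]

end ParaComplex

section Graph

open Set Filter Topology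

/-- Integration of a closed one-form with values in a normed space. -/
lemma exists_hasFDerivAt_of_fderiv_symm {E W : Type*} [NormedAddCommGroup E] [NormedSpace ℝ E]
    [FiniteDimensional ℝ E] [NormedAddCommGroup W] [NormedSpace ℝ W] [CompleteSpace W]
    {L : E →L[ℝ] W} {ψ : E → E →L[ℝ] E} {O : Set E} (hO : IsOpen O) (hψ : ContDiffOn ℝ ∞ ψ O)
    (hs : ∀ z ∈ O, ∀ u v, fderiv ℝ ψ z u v = fderiv ℝ ψ z v u) {x₀ : E} (hx₀ : x₀ ∈ O) (w₀ : W) :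
    ∃ (σ : E → W) (U : Set E), IsOpen U ∧ x₀ ∈ U ∧ σ x₀ = w₀ ∧ ContDiffOn ℝ ∞ σ U ∧
      ∀ x ∈ U, x ∈ O ∧ HasFDerivAt σ (L ∘L ψ x) x := by
  have hd : ∀ z ∈ O, DifferentiableAt ℝ ψ z := fun z hz ↦
    (hψ.contDiffAt (hO.mem_nhds hz)).differentiableAt (by simp)
  obtain ⟨σ, U, hU, hxU, hσ, hσs, h⟩ := exists_contDiffOn_hasFDerivAt_of_integrable
    (φ := fun q : E × W ↦ L ∘L ψ q.1) (O := O ×ˢ univ) (x₀ := x₀) (w₀ := w₀)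
    (hO.prod isOpen_univ)
    (contDiffOn_const.clm_comp (hψ.comp contDiffOn_fst fun q hq ↦ hq.1))
    (fun q hq u v ↦ by
      have h1 : HasFDerivAt (fun q : E × W ↦ L ∘L ψ q.1)
          (ContinuousLinearMap.compL ℝ E E W L ∘L fderiv ℝ ψ q.1 ∘L
            ContinuousLinearMap.fst ℝ E W) q :=
        HasFDerivAt.comp (g := ContinuousLinearMap.compL ℝ E E W L) q
          (ContinuousLinearMap.compL ℝ E E W L).hasFDerivAt
          ((hd _ hq.1).hasFDerivAt.comp q hasFDerivAt_fst)
      rw [h1.fderiv]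
      exact congrArg L (hs _ hq.1 u v)) ⟨hx₀, trivial⟩
  exact ⟨σ, U, hU, hxU, hσ, hσs, fun x hx ↦ ⟨(h x hx).1.1, (h x hx).2⟩⟩

variable {E : Type*} [NormedAddCommGroup E] [NormedSpace ℝ E] [FiniteDimensional ℝ E]
  {M : Type*} [TopologicalSpace M] [ChartedSpace E M] [IsManifold 𝓘(ℝ, E) ∞ M]

/-- A distribution on the cotangent bundle, which in induced charts consists of the graphs of a
closed one-form, is integrable. -/
theorem isIntegrableDistribution_cotangent
    {F : ∀ ξ : CotangentBundle E M, Submodule ℝ (TangentSpace (cotangentModel E) ξ)}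
    (h : ∀ p : M, ∃ (e : OpenPartialHomeomorph M E) (Ω : E →L[ℝ] E →L[ℝ] ℝ) (ψ : E → E →L[ℝ] E),
      p ∈ e.source ∧ IsSmoothChart 𝓘(ℝ, E) e ∧ ContDiffOn ℝ ∞ ψ e.target ∧
      (∀ z ∈ e.target, ∀ u v, fderiv ℝ ψ z u v = fderiv ℝ ψ z v u) ∧
      ∀ ξ : CotangentBundle E M, ξ.proj ∈ e.source → ∀ w, w ∈ F ξ ↔
        (mvfderiv (cotangentModel E) (cotangentChart e) ξ w).2 =
          Ω (ψ (e ξ.proj) (mvfderiv (cotangentModel E) (cotangentChart e) ξ w).1)) :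
    IsIntegrableDistribution F := by
  have : CompleteSpace E := FiniteDimensional.complete ℝ E
  refine isIntegrableDistribution_of_chart (V := E) fun ξ ↦ ?_
  obtain ⟨e, Ω, ψ, hξ, he, hψ, hs, hF⟩ := h ξ.proj
  obtain ⟨σ, U, hU, hxU, hσ, hσs, hσd⟩ := exists_hasFDerivAt_of_fderiv_symm (L := Ω) e.open_target
    hψ hs (e.map_source hξ) (cotangentChart e ξ).2
  have hfd : ∀ x ∈ U, HasFDerivAt (fun x ↦ (x, σ x))
      ((ContinuousLinearMap.id ℝ E).prod (Ω ∘L ψ x)) x :=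
    fun x hx ↦ (hasFDerivAt_id x).prodMk (hσd x hx).2
  refine ⟨he.cotangent, U, e ξ.proj, fun x ↦ (x, σ x), he.isSmoothChart_cotangent, hξ, hU, hxU,
    Prod.ext rfl hσ, contDiffOn_id.prodMk hσs, fun x hx ↦ ⟨(hσd x hx).1, trivial⟩,
    fun x hx ↦ ⟨?_, fun w ↦ ?_⟩⟩
  · rw [(hfd x hx).fderiv]
    exact fun a b hab ↦ congrArg Prod.fst hab
  · rw [(hfd x hx).fderiv, hF _ (e.map_target (hσd x hx).1)]
    have h1 : e (e.symm x) = x := e.right_inv (hσd x hx).1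
    change _ = Ω (ψ (e (e.symm x)) _) ↔ _
    rw [h1]
    constructor
    · intro h
      exact ⟨_, Prod.ext rfl h.symm⟩
    · rintro ⟨a, ha⟩
      have ha' : (a, Ω (ψ x a)) = mvfderiv (cotangentModel E) (cotangentChart e)
        (he.cotangent.symm (x, σ x)) w := ha
      rw [← ha']

end Graph
end


noncomputable section

section ModelSmoothness

open Set Filter Topology

variable {E : Type*} [NormedAddCommGroup E] [NormedSpace ℝ E]
  {V : Type*} [NormedAddCommGroup V] [NormedSpace ℝ V]

lemma contDiff_diagonalForm [FiniteDimensional ℝ V] (p : V →L[ℝ] E) (q : V →L[ℝ] E →L[ℝ] ℝ)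
    (Ω : E →L[ℝ] E →L[ℝ] ℝ) : ContDiff ℝ ∞ (fun j ↦ diagonalForm p q j Ω) := by
  rw [contDiff_clm_apply_iff]
  intro y
  rw [contDiff_clm_apply_iff]
  intro y'
  simp only [diagonalForm_apply]
  have h : ∀ a : E, ContDiff ℝ ∞ (fun j : E →L[ℝ] E ↦ j a) :=
    fun a ↦ contDiff_id.clm_apply contDiff_const
  exact ((Ω.contDiff.comp (h _)).clm_apply contDiff_const).neg.sub ((q y).contDiff.comp (h _))

lemma ContDiff.clm_prodMap {X V' : Type*} [NormedAddCommGroup X] [NormedSpace ℝ X]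
    [NormedAddCommGroup V'] [NormedSpace ℝ V'] {A : X → E →L[ℝ] E} {B : X → V →L[ℝ] V'}
    (hA : ContDiff ℝ ∞ A) (hB : ContDiff ℝ ∞ B) :
    ContDiff ℝ ∞ fun x ↦ (A x).prodMap (B x) :=
  (ContinuousLinearMap.prodMapL ℝ E E V V').contDiff.comp (hA.prodMk hB)

lemma contDiff_linearJ : ContDiff ℝ ∞ fun j : E →L[ℝ] E ↦ linearJ j := by
  have h : ContDiff ℝ ∞ fun j : E →L[ℝ] E ↦ (ContinuousLinearMap.compL ℝ E E ℝ).flip j :=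
    ContinuousLinearMap.contDiff _
  exact ContDiff.clm_prodMap (A := fun j : E →L[ℝ] E ↦ j) contDiff_id h

/-- The derivative of a field of bilinear forms in terms of its values. -/
lemma DifferentiableAt.fderiv_bilin_apply {B : V → V →L[ℝ] V →L[ℝ] ℝ} {z : V}
    (hB : DifferentiableAt ℝ B z) {b : V → ℝ} {v w : V}
    (hb : ∀ᶠ y in 𝓝 z, B y v w = b y) (u : V) : fderiv ℝ B z u v w = fderiv ℝ b z u := by
  have h1 : DifferentiableAt ℝ (fun y ↦ B y v) z := hB.clm_apply (differentiableAt_const v)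
  rw [← hB.fderiv_clm_apply_const, ← h1.fderiv_clm_apply_const]
  exact congr($(Filter.EventuallyEq.fderiv_eq hb) u)

end ModelSmoothness

section Cotangent

open Set Filter Topology

variable {E : Type*} [NormedAddCommGroup E] [NormedSpace ℝ E] [FiniteDimensional ℝ E]
  {M : Type*} [TopologicalSpace M] [ChartedSpace E M] [IsManifold 𝓘(ℝ, E) ∞ M]
  {e : OpenPartialHomeomorph M E}
  {D : CovariantDerivative 𝓘(ℝ, E) E (TangentSpace 𝓘(ℝ, E) : M → Type _)}
  {J : EndField 𝓘(ℝ, E) M} {g : BilinField 𝓘(ℝ, E) M}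

namespace IsSpecialChart

variable {Ω : E →L[ℝ] E →L[ℝ] ℝ} (he : IsSpecialChart J g D e Ω)
include he

omit [FiniteDimensional ℝ E] in
lemma contDiffAt_chartEnd_fst {z : E × (E →L[ℝ] ℝ)} (hz : z.1 ∈ e.target) :
    ContDiffAt ℝ ∞ (fun z : E × (E →L[ℝ] ℝ) ↦ chartEnd e J z.1) z :=
  (he.contDiffOn_chartEnd'.contDiffAt (e.open_target.mem_nhds hz)).comp z contDiffAt_fst

omit [FiniteDimensional ℝ E] in
lemma contDiffAt_linearJ {z : E × (E →L[ℝ] ℝ)} (hz : z.1 ∈ e.target) :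
    ContDiffAt ℝ ∞ (fun z : E × (E →L[ℝ] ℝ) ↦ linearJ (chartEnd e J z.1)) z :=
  (contDiff_linearJ (E := E)).contDiffAt.comp z (he.contDiffAt_chartEnd_fst hz)

lemma contDiffAt_linearMetric {z : E × (E →L[ℝ] ℝ)} (hz : z.1 ∈ e.target) :
    ContDiffAt ℝ ∞ (fun z : E × (E →L[ℝ] ℝ) ↦ linearMetric (chartEnd e J z.1) Ω) z :=
  (contDiff_diagonalForm _ _ Ω).contDiffAt.comp z (he.contDiffAt_chartEnd_fst hz)

omit [FiniteDimensional ℝ E] in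
lemma eventually_isLinearKahler {z : E × (E →L[ℝ] ℝ)} (hz : z.1 ∈ e.target) :
    ∀ᶠ y in 𝓝 z, IsLinearKahler (chartEnd e J y.1) Ω := by
  filter_upwards [(e.open_target.preimage continuous_fst).mem_nhds hz] with y hy using
    he.isLinearKahler _ hy

end IsSpecialChart

namespace IsSpecialPseudoKahler

variable [T2Space M] (h : IsSpecialPseudoKahler J g D)
include h

lemma cotangentJ_sq (ξ : CotangentBundle E M) (w : TangentSpace (cotangentModel E) ξ) :
    cotangentJ D J ξ (cotangentJ D J ξ w) = - w := by
  have : CompleteSpace E := FiniteDimensional.complete ℝ E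
  obtain ⟨e, Ω, hξ, he⟩ := h.exists_isSpecialChart ξ.proj
  refine he.isSmoothChart_cotangent.mvfderiv_injective hξ ?_
  refine (he.mvfderiv_cotangentJ hξ _).trans ?_
  rw [he.mvfderiv_cotangentJ hξ, (he.isLinearKahler _ (e.map_source hξ)).linearJ_sq]
  exact (ContinuousLinearMap.map_neg _ _).symm

lemma cotangentOmega_sq (ξ : CotangentBundle E M) (w : TangentSpace (cotangentModel E) ξ) :
    cotangentOmega D (fundamentalForm g J) ξ (cotangentOmega D (fundamentalForm g J) ξ w) = w := by
  have : CompleteSpace E := FiniteDimensional.complete ℝ E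
  obtain ⟨e, Ω, hξ, he⟩ := h.exists_isSpecialChart ξ.proj
  have hω := h.fundamentalForm_isInvertible ξ.proj
  refine he.isSmoothChart_cotangent.mvfderiv_injective hξ ?_
  refine (he.mvfderiv_cotangentOmega hξ hω _).trans ?_
  rw [he.mvfderiv_cotangentOmega hξ hω, (he.isLinearKahler _ (e.map_source hξ)).linearOmega_sq]
  rfl

lemma cotangentJ_cotangentOmega (ξ : CotangentBundle E M)
    (w : TangentSpace (cotangentModel E) ξ) :
    cotangentJ D J ξ (cotangentOmega D (fundamentalForm g J) ξ w) =
      - cotangentOmega D (fundamentalForm g J) ξ (cotangentJ D J ξ w) := by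
  have : CompleteSpace E := FiniteDimensional.complete ℝ E
  obtain ⟨e, Ω, hξ, he⟩ := h.exists_isSpecialChart ξ.proj
  have hω := h.fundamentalForm_isInvertible ξ.proj
  refine he.isSmoothChart_cotangent.mvfderiv_injective hξ ?_
  refine (he.mvfderiv_cotangentJ hξ _).trans ?_
  rw [he.mvfderiv_cotangentOmega hξ hω,
    (he.isLinearKahler _ (e.map_source hξ)).linearJ_linearOmega, ← he.mvfderiv_cotangentJ hξ,
    ← he.mvfderiv_cotangentOmega hξ hω]
  exact (ContinuousLinearMap.map_neg _ _).symm

lemma cotangentJ_isSmooth : (cotangentJ D J).IsSmooth := by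
  have : CompleteSpace E := FiniteDimensional.complete ℝ E
  intro ξ
  obtain ⟨e, Ω, hξ, he⟩ := h.exists_isSpecialChart ξ.proj
  exact he.isSmoothChart_cotangent.contMDiffAt_endField hξ
    (he.contDiffAt_linearJ (e.map_source hξ)) fun η hη w ↦ he.mvfderiv_cotangentJ hη w

lemma cotangentOmega_isSmooth : (cotangentOmega D (fundamentalForm g J)).IsSmooth := by
  have : CompleteSpace E := FiniteDimensional.complete ℝ E
  intro ξ
  obtain ⟨e, Ω, hξ, he⟩ := h.exists_isSpecialChart ξ.proj
  exact he.isSmoothChart_cotangent.contMDiffAt_endField hξ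
    (contDiffAt_const (c := linearOmega Ω)) fun η hη w ↦
      he.mvfderiv_cotangentOmega hη (h.fundamentalForm_isInvertible _) w

lemma cotangentJ_comp_cotangentOmega_isSmooth :
    EndField.IsSmooth fun ξ : CotangentBundle E M ↦
      cotangentJ D J ξ ∘L cotangentOmega D (fundamentalForm g J) ξ := by
  have : CompleteSpace E := FiniteDimensional.complete ℝ E
  intro ξ
  obtain ⟨e, Ω, hξ, he⟩ := h.exists_isSpecialChart ξ.proj
  refine he.isSmoothChart_cotangent.contMDiffAt_endField hξ
    ((he.contDiffAt_linearJ (e.map_source hξ)).clm_comp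
      (contDiffAt_const (c := linearOmega Ω))) fun η hη w ↦ ?_
  exact (he.mvfderiv_cotangentJ hη _).trans (congrArg (linearJ (chartEnd e J (e η.proj)))
    (he.mvfderiv_cotangentOmega hη (h.fundamentalForm_isInvertible _) w))

lemma isPseudoRiemannian_cotangentMetric : IsPseudoRiemannian (cotangentMetric D g) where
  smooth := by
    have : CompleteSpace E := FiniteDimensional.complete ℝ E
    intro ξ
    obtain ⟨e, Ω, hξ, he⟩ := h.exists_isSpecialChart ξ.proj
    exact he.isSmoothChart_cotangent.contMDiffAt_bilinField hξ
      (he.contDiffAt_linearMetric (e.map_source hξ)) fun η hη w w' ↦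
        he.cotangentMetric_apply hη h.toIsPseudoKahler w w'
  symm ξ w w' := by
    have : CompleteSpace E := FiniteDimensional.complete ℝ E
    obtain ⟨e, Ω, hξ, he⟩ := h.exists_isSpecialChart ξ.proj
    rw [he.cotangentMetric_apply hξ h.toIsPseudoKahler,
      he.cotangentMetric_apply hξ h.toIsPseudoKahler,
      (he.isLinearKahler _ (e.map_source hξ)).linearMetric_symm]
  nondegenerate ξ w hw := by
    have : CompleteSpace E := FiniteDimensional.complete ℝ E
    obtain ⟨e, Ω, hξ, he⟩ := h.exists_isSpecialChart ξ.proj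
    refine he.isSmoothChart_cotangent.mvfderiv_injective hξ ?_
    refine ((he.isLinearKahler _ (e.map_source hξ)).linearMetric_nondegenerate fun y ↦ ?_).trans
      (ContinuousLinearMap.map_zero _).symm
    obtain ⟨w', rfl⟩ := (he.isSmoothChart_cotangent.isInvertible hξ).surjective y
    rw [← hw w']
    exact (he.cotangentMetric_apply hξ h.toIsPseudoKahler w w').symm

lemma isSkew_cotangentJ : IsSkew (cotangentMetric D g) (cotangentJ D J) := by
  have : CompleteSpace E := FiniteDimensional.complete ℝ E
  intro ξ w w'
  obtain ⟨e, Ω, hξ, he⟩ := h.exists_isSpecialChart ξ.proj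
  rw [he.cotangentMetric_apply hξ h.toIsPseudoKahler,
    he.cotangentMetric_apply hξ h.toIsPseudoKahler, he.mvfderiv_cotangentJ hξ,
    he.mvfderiv_cotangentJ hξ, (he.isLinearKahler _ (e.map_source hξ)).linearMetric_linearJ_skew]

lemma isSkew_cotangentOmega :
    IsSkew (cotangentMetric D g) (cotangentOmega D (fundamentalForm g J)) := by
  have : CompleteSpace E := FiniteDimensional.complete ℝ E
  intro ξ w w'
  obtain ⟨e, Ω, hξ, he⟩ := h.exists_isSpecialChart ξ.proj
  have hω := h.fundamentalForm_isInvertible ξ.proj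
  rw [he.cotangentMetric_apply hξ h.toIsPseudoKahler,
    he.cotangentMetric_apply hξ h.toIsPseudoKahler, he.mvfderiv_cotangentOmega hξ hω,
    he.mvfderiv_cotangentOmega hξ hω,
    (he.isLinearKahler _ (e.map_source hξ)).linearMetric_linearOmega_skew]

end IsSpecialPseudoKahler

end Cotangent
end


noncomputable section

section ParaHyperKahler

open Set Filter Topology

variable {E : Type*} [NormedAddCommGroup E] [NormedSpace ℝ E] [FiniteDimensional ℝ E]
  {M : Type*} [TopologicalSpace M] [ChartedSpace E M] [IsManifold 𝓘(ℝ, E) ∞ M]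
  {D : CovariantDerivative 𝓘(ℝ, E) E (TangentSpace 𝓘(ℝ, E) : M → Type _)}
  {J : EndField 𝓘(ℝ, E) M} {g : BilinField 𝓘(ℝ, E) M}

/-- A field of bilinear forms with constant coefficients in a chart is closed in that chart. -/
lemma DifferentiableAt.fderiv_bilin_eq_zero {V : Type*} [NormedAddCommGroup V] [NormedSpace ℝ V]
    {B : V → V →L[ℝ] V →L[ℝ] ℝ} {z : V} (hB : DifferentiableAt ℝ B z) {b : V → V → ℝ}
    (hb : ∀ᶠ y in 𝓝 z, ∀ v w, B y v w = b v w) (u v w : V) : fderiv ℝ B z u v w = 0 := by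
  rw [hB.fderiv_bilin_apply (b := fun _ ↦ b v w) (hb.mono fun y hy ↦ hy v w)]
  simp

lemma DifferentiableAt.fderiv_apply_sub_apply {V W : Type*} [NormedAddCommGroup V]
    [NormedSpace ℝ V] [NormedAddCommGroup W] [NormedSpace ℝ W] {f : V → V →L[ℝ] V} {z : V × W}
    (hf : DifferentiableAt ℝ f z.1) (α β : V →L[ℝ] ℝ) (a b : V) (u : V × W) :
    fderiv ℝ (fun y : V × W ↦ α (f y.1 a) - β (f y.1 b)) z u =
      α (fderiv ℝ f z.1 u.1 a) - β (fderiv ℝ f z.1 u.1 b) := by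
  have h : ∀ (α : V →L[ℝ] ℝ) (a : V), HasFDerivAt (fun y : V × W ↦ α (f y.1 a))
      (α ∘L (ContinuousLinearMap.apply ℝ V a ∘L fderiv ℝ f z.1) ∘L ContinuousLinearMap.fst ℝ V W)
      z := by
    intro α a
    have h1 : HasFDerivAt (fun x ↦ f x a) (ContinuousLinearMap.apply ℝ V a ∘L fderiv ℝ f z.1) z.1 :=
      (ContinuousLinearMap.apply ℝ V a).hasFDerivAt.comp z.1 hf.hasFDerivAt
    have h2 : HasFDerivAt (fun y : V × W ↦ f y.1 a) _ z := h1.comp z hasFDerivAt_fst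
    exact α.hasFDerivAt.comp z h2
  rw [((h α a).fun_sub (h β b)).fderiv]
  rfl

namespace IsSpecialPseudoKahler

variable [T2Space M] (h : IsSpecialPseudoKahler J g D)
include h

lemma isClosedForm_cotangentJ :
    IsClosedForm (fundamentalForm (cotangentMetric D g) (cotangentJ D J)) := by
  have : CompleteSpace E := FiniteDimensional.complete ℝ E
  refine isClosedForm_of_chart fun ξ ↦ ?_
  obtain ⟨e, Ω, hξ, he⟩ := h.exists_isSpecialChart ξ.proj
  have hz : (cotangentChart e ξ).1 ∈ e.target := e.map_source hξ
  have hd := ((he.contDiffAt_linearMetric hz).clm_comp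
    (he.contDiffAt_linearJ hz)).differentiableAt (by simp)
  have hB := hd.fderiv_bilin_eq_zero
    (b := fun y y' ↦ Ω y.1 y'.1 + y.2 (Ω.inverse y'.2))
    ((he.eventually_isLinearKahler hz).mono fun z hz y y' ↦ hz.linearMetric_linearJ y y')
  refine ⟨he.cotangent, _, he.isSmoothChart_cotangent, hξ, hd, ?_, ?_, ?_⟩
  · intro η hη w w'
    refine (he.cotangentMetric_apply hη h.toIsPseudoKahler _ _).trans ?_
    exact congrArg (fun y ↦ linearMetric (chartEnd e J (e η.proj)) Ω y _)
      (he.mvfderiv_cotangentJ hη w)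
  · intro y y'
    have hk := he.isLinearKahler _ hz
    refine (hk.linearMetric_linearJ y y').trans ?_
    refine Eq.trans ?_ (congrArg Neg.neg (hk.linearMetric_linearJ y' y)).symm
    rw [hk.skew, hk.inverse_skew]
    ring
  · intro u v w
    refine (congrArg₂ (· + ·) (congrArg₂ (· - ·) (hB u v w) (hB v u w)) (hB w u v)).trans ?_
    simp

lemma isClosedForm_cotangentJ_comp_cotangentOmega :
    IsClosedForm (fundamentalForm (cotangentMetric D g)
      fun ξ ↦ cotangentJ D J ξ ∘L cotangentOmega D (fundamentalForm g J) ξ) := by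
  have : CompleteSpace E := FiniteDimensional.complete ℝ E
  refine isClosedForm_of_chart fun ξ ↦ ?_
  obtain ⟨e, Ω, hξ, he⟩ := h.exists_isSpecialChart ξ.proj
  have hz : (cotangentChart e ξ).1 ∈ e.target := e.map_source hξ
  have hd := ((he.contDiffAt_linearMetric hz).clm_comp
    ((he.contDiffAt_linearJ hz).clm_comp
      (contDiffAt_const (c := linearOmega Ω)))).differentiableAt (by simp)
  have hB := hd.fderiv_bilin_eq_zero (b := fun y y' ↦ y.2 y'.1 - y'.2 y.1)
    ((he.eventually_isLinearKahler hz).mono fun z hz y y' ↦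
      hz.linearMetric_linearJ_linearOmega y y')
  refine ⟨he.cotangent, _, he.isSmoothChart_cotangent, hξ, hd, ?_, ?_, ?_⟩
  · intro η hη w w'
    refine (he.cotangentMetric_apply hη h.toIsPseudoKahler _ _).trans ?_
    refine congrArg (fun y ↦ linearMetric (chartEnd e J (e η.proj)) Ω y _) ?_
    exact (he.mvfderiv_cotangentJ hη _).trans (congrArg (linearJ (chartEnd e J (e η.proj)))
      (he.mvfderiv_cotangentOmega hη (h.fundamentalForm_isInvertible _) w))
  · intro y y'
    have hk := he.isLinearKahler _ hz
    refine (hk.linearMetric_linearJ_linearOmega y y').trans ?_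
    refine Eq.trans ?_ (congrArg Neg.neg (hk.linearMetric_linearJ_linearOmega y' y)).symm
    ring
  · intro u v w
    refine (congrArg₂ (· + ·) (congrArg₂ (· - ·) (hB u v w) (hB v u w)) (hB w u v)).trans ?_
    simp

lemma isClosedForm_cotangentOmega :
    IsClosedForm (fundamentalForm (cotangentMetric D g)
      (cotangentOmega D (fundamentalForm g J))) := by
  have : CompleteSpace E := FiniteDimensional.complete ℝ E
  refine isClosedForm_of_chart fun ξ ↦ ?_
  obtain ⟨e, Ω, hξ, he⟩ := h.exists_isSpecialChart ξ.proj
  have hz : (cotangentChart e ξ).1 ∈ e.target := e.map_source hξ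
  have hd := ((he.contDiffAt_linearMetric hz).clm_comp
    (contDiffAt_const (c := linearOmega Ω))).differentiableAt (by simp)
  have hj : DifferentiableAt ℝ (chartEnd e J) (cotangentChart e ξ).1 :=
    (he.contDiffOn_chartEnd'.contDiffAt (e.open_target.mem_nhds hz)).differentiableAt (by simp)
  have hB := fun u v w : E × (E →L[ℝ] ℝ) ↦ (hd.fderiv_bilin_apply
    (b := fun z ↦ v.2 (chartEnd e J z.1 w.1) - w.2 (chartEnd e J z.1 v.1))
    ((he.eventually_isLinearKahler hz).mono fun z hz ↦ hz.linearMetric_linearOmega v w) u).trans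
    (hj.fderiv_apply_sub_apply v.2 w.2 w.1 v.1 u)
  refine ⟨he.cotangent, _, he.isSmoothChart_cotangent, hξ, hd, ?_, ?_, ?_⟩
  · intro η hη w w'
    refine (he.cotangentMetric_apply hη h.toIsPseudoKahler _ _).trans ?_
    exact congrArg (fun y ↦ linearMetric (chartEnd e J (e η.proj)) Ω y _)
      (he.mvfderiv_cotangentOmega hη (h.fundamentalForm_isInvertible _) w)
  · intro y y'
    have hk := he.isLinearKahler _ hz
    refine (hk.linearMetric_linearOmega y y').trans ?_
    refine Eq.trans ?_ (congrArg Neg.neg (hk.linearMetric_linearOmega y' y)).symm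
    ring
  · intro u v w
    refine (congrArg₂ (· + ·) (congrArg₂ (· - ·) (hB u v w) (hB v u w)) (hB w u v)).trans ?_
    have hs := he.fderiv_symm _ hz
    rw [hs u.1 v.1, hs u.1 w.1, hs v.1 w.1]
    ring

end IsSpecialPseudoKahler

end ParaHyperKahler
end


noncomputable section

section Main

open Set Filter Topology

variable {E : Type*} [NormedAddCommGroup E] [NormedSpace ℝ E] [FiniteDimensional ℝ E]
  {M : Type*} [TopologicalSpace M] [ChartedSpace E M] [IsManifold 𝓘(ℝ, E) ∞ M]
  {D : CovariantDerivative 𝓘(ℝ, E) E (TangentSpace 𝓘(ℝ, E) : M → Type _)}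
  {J : EndField 𝓘(ℝ, E) M} {g : BilinField 𝓘(ℝ, E) M}

namespace IsSpecialPseudoKahler

variable [T2Space M] (h : IsSpecialPseudoKahler J g D)
include h

theorem isParaComplexStructure_cotangentOmega [Nontrivial E] :
    IsParaComplexStructure (cotangentOmega D (fundamentalForm g J)) where
  toIsAlmostParaComplex := isAlmostParaComplex_of_anticommute h.cotangentOmega_isSmooth
    h.cotangentJ_sq h.cotangentOmega_sq h.cotangentJ_cotangentOmega
  integrable_plus := by
    have : CompleteSpace E := FiniteDimensional.complete ℝ E
    refine isIntegrableDistribution_cotangent fun p ↦ ?_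
    obtain ⟨e, Ω, hp, he⟩ := h.exists_isSpecialChart p
    refine ⟨e, Ω, fun _ ↦ ContinuousLinearMap.id ℝ E, hp, he.toIsSmoothChart, contDiffOn_const,
      fun z _ u v ↦ by simp, fun ξ hξ w ↦ ?_⟩
    rw [mem_plusDistribution_iff, ← (he.isSmoothChart_cotangent.isInvertible hξ).injective.eq_iff]
    refine Iff.trans (Eq.congr_left (he.mvfderiv_cotangentOmega hξ
      (h.fundamentalForm_isInvertible _) w)) ?_
    exact (he.isLinearKahler _ (e.map_source hξ)).linearOmega_eq_iff _
  integrable_minus := by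
    have : CompleteSpace E := FiniteDimensional.complete ℝ E
    refine isIntegrableDistribution_cotangent fun p ↦ ?_
    obtain ⟨e, Ω, hp, he⟩ := h.exists_isSpecialChart p
    refine ⟨e, Ω, fun _ ↦ -ContinuousLinearMap.id ℝ E, hp, he.toIsSmoothChart, contDiffOn_const,
      fun z _ u v ↦ by simp, fun ξ hξ w ↦ ?_⟩
    rw [mem_minusDistribution_iff, ← (he.isSmoothChart_cotangent.isInvertible hξ).injective.eq_iff,
      ContinuousLinearMap.map_neg]
    refine Iff.trans (Eq.congr_left (he.mvfderiv_cotangentOmega hξ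
      (h.fundamentalForm_isInvertible _) w)) ?_
    exact (he.isLinearKahler _ (e.map_source hξ)).linearOmega_eq_neg_iff _

lemma cotangentJ_comp_cotangentOmega_sq (ξ : CotangentBundle E M)
    (w : TangentSpace (cotangentModel E) ξ) :
    (cotangentJ D J ξ ∘L cotangentOmega D (fundamentalForm g J) ξ)
      ((cotangentJ D J ξ ∘L cotangentOmega D (fundamentalForm g J) ξ) w) = w := by
  simp only [ContinuousLinearMap.comp_apply]
  rw [h.cotangentJ_cotangentOmega, h.cotangentJ_sq, ContinuousLinearMap.map_neg,
    h.cotangentOmega_sq, neg_neg]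

lemma cotangentJ_cotangentJ_comp_cotangentOmega (ξ : CotangentBundle E M)
    (w : TangentSpace (cotangentModel E) ξ) :
    cotangentJ D J ξ ((cotangentJ D J ξ ∘L cotangentOmega D (fundamentalForm g J) ξ) w) =
      - (cotangentJ D J ξ ∘L cotangentOmega D (fundamentalForm g J) ξ) (cotangentJ D J ξ w) := by
  simp only [ContinuousLinearMap.comp_apply]
  rw [h.cotangentJ_cotangentOmega, ContinuousLinearMap.map_neg]

omit [T2Space M] in
lemma mvfderiv_cotangentJ_comp_cotangentOmega [CompleteSpace E] {e : OpenPartialHomeomorph M E}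
    {Ω : E →L[ℝ] E →L[ℝ] ℝ} (he : IsSpecialChart J g D e Ω) {ξ : CotangentBundle E M}
    (hξ : ξ.proj ∈ e.source) (w : TangentSpace (cotangentModel E) ξ) :
    mvfderiv (cotangentModel E) (cotangentChart e) ξ
        ((cotangentJ D J ξ ∘L cotangentOmega D (fundamentalForm g J) ξ) w) =
      linearJ (chartEnd e J (e ξ.proj))
        (linearOmega Ω (mvfderiv (cotangentModel E) (cotangentChart e) ξ w)) :=
  (he.mvfderiv_cotangentJ hξ _).trans (congrArg (linearJ (chartEnd e J (e ξ.proj)))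
    (he.mvfderiv_cotangentOmega hξ (h.fundamentalForm_isInvertible _) w))

theorem isParaComplexStructure_cotangentJ_comp_cotangentOmega [Nontrivial E] :
    IsParaComplexStructure fun ξ : CotangentBundle E M ↦
      cotangentJ D J ξ ∘L cotangentOmega D (fundamentalForm g J) ξ where
  toIsAlmostParaComplex :=
    isAlmostParaComplex_of_anticommute h.cotangentJ_comp_cotangentOmega_isSmooth
      h.cotangentJ_sq h.cotangentJ_comp_cotangentOmega_sq
      h.cotangentJ_cotangentJ_comp_cotangentOmega
  integrable_plus := by
    have : CompleteSpace E := FiniteDimensional.complete ℝ E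
    refine isIntegrableDistribution_cotangent fun p ↦ ?_
    obtain ⟨e, Ω, hp, he⟩ := h.exists_isSpecialChart p
    refine ⟨e, Ω, fun z ↦ -chartEnd e J z, hp, he.toIsSmoothChart, he.contDiffOn_chartEnd'.neg,
      fun z hz u v ↦ ?_, fun ξ hξ w ↦ ?_⟩
    · rw [fderiv_fun_neg]
      exact congrArg Neg.neg (he.fderiv_symm z hz u v)
    rw [mem_plusDistribution_iff, ← (he.isSmoothChart_cotangent.isInvertible hξ).injective.eq_iff]
    refine Iff.trans (Eq.congr_left (h.mvfderiv_cotangentJ_comp_cotangentOmega he hξ w)) ?_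
    exact (he.isLinearKahler _ (e.map_source hξ)).linearJ_linearOmega_eq_iff _
  integrable_minus := by
    have : CompleteSpace E := FiniteDimensional.complete ℝ E
    refine isIntegrableDistribution_cotangent fun p ↦ ?_
    obtain ⟨e, Ω, hp, he⟩ := h.exists_isSpecialChart p
    refine ⟨e, Ω, chartEnd e J, hp, he.toIsSmoothChart, he.contDiffOn_chartEnd', he.fderiv_symm,
      fun ξ hξ w ↦ ?_⟩
    rw [mem_minusDistribution_iff, ← (he.isSmoothChart_cotangent.isInvertible hξ).injective.eq_iff,
      ContinuousLinearMap.map_neg]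
    refine Iff.trans (Eq.congr_left (h.mvfderiv_cotangentJ_comp_cotangentOmega he hξ w)) ?_
    exact (he.isLinearKahler _ (e.map_source hξ)).linearJ_linearOmega_eq_neg_iff _

theorem isCanonicalComplexStructure_cotangentJ :
    IsCanonicalComplexStructure J (cotangentJ D J) := by
  have : CompleteSpace E := FiniteDimensional.complete ℝ E
  intro e j he ξ hξ w
  obtain ⟨Γ, -, hΓ⟩ := exists_isChristoffel h.smooth_connection he.isSmoothChart
  exact hΓ.mvfderiv_cotangentJ he.isSmoothChart hξ (he.mfderiv_comp _ hξ)
    (fun u v ↦ hΓ.apply_complex he h.torsion_free h.symmetric (e.map_source hξ) u v) w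

theorem isCanonicalComplexStructure_iff
    (JN : EndField (cotangentModel E) (CotangentBundle E M)) :
    IsCanonicalComplexStructure J JN ↔ JN = cotangentJ D J := by
  have : CompleteSpace E := FiniteDimensional.complete ℝ E
  refine ⟨fun hJN ↦ ?_, fun hJN ↦ hJN ▸ h.isCanonicalComplexStructure_cotangentJ⟩
  funext ξ
  ext1 w
  obtain ⟨e, j, hξ, he⟩ := h.complex.exists_chart ξ.proj
  exact he.isSmoothChart.isSmoothChart_cotangent.mvfderiv_injective hξ
    ((hJN e j he ξ hξ w).trans (h.isCanonicalComplexStructure_cotangentJ e j he ξ hξ w).symm)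

theorem isComplexStructure_cotangentJ : IsComplexStructure (cotangentJ D J) where
  smooth := h.cotangentJ_isSmooth
  sq := h.cotangentJ_sq
  exists_chart ξ := by
    have : CompleteSpace E := FiniteDimensional.complete ℝ E
    obtain ⟨e, j, hξ, he⟩ := h.complex.exists_chart ξ.proj
    have hs := he.isSmoothChart.isSmoothChart_cotangent
    refine ⟨he.isSmoothChart.cotangent, linearJ j, hξ, hs.contMDiffOn, hs.contMDiffOn_symm,
      fun y ↦ ?_, fun η hη w ↦ h.isCanonicalComplexStructure_cotangentJ e j he η hη w⟩
    refine Prod.ext (he.sq _) ?_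
    ext v
    simp [linearJ_apply, he.sq]

theorem isParaHyperKahler_cotangent [Nontrivial E] :
    IsParaHyperKahler (cotangentJ D J) (cotangentOmega D (fundamentalForm g J))
      (fun ξ ↦ cotangentJ D J ξ ∘L cotangentOmega D (fundamentalForm g J) ξ)
      (cotangentMetric D g) where
  eq_comp _ _ := rfl
  anticomm₁₂ := h.cotangentJ_cotangentOmega
  anticomm₁₃ := h.cotangentJ_cotangentJ_comp_cotangentOmega
  anticomm₂₃ ξ w := by
    simp only [ContinuousLinearMap.comp_apply]
    rw [h.cotangentJ_cotangentOmega ξ (cotangentOmega D (fundamentalForm g J) ξ w), neg_neg]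
  types := Or.inl ⟨h.isComplexStructure_cotangentJ, h.isParaComplexStructure_cotangentOmega,
    h.isParaComplexStructure_cotangentJ_comp_cotangentOmega⟩
  metric := h.isPseudoRiemannian_cotangentMetric
  skew₁ := h.isSkew_cotangentJ
  skew₂ := h.isSkew_cotangentOmega
  skew₃ ξ w w' := by
    simp only [ContinuousLinearMap.comp_apply]
    rw [h.isSkew_cotangentJ, h.isSkew_cotangentOmega, neg_neg, h.cotangentJ_cotangentOmega,
      ContinuousLinearMap.map_neg, neg_neg]
  closed₁ := h.isClosedForm_cotangentJ
  closed₂ := h.isClosedForm_cotangentOmega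
  closed₃ := h.isClosedForm_cotangentJ_comp_cotangentOmega

end IsSpecialPseudoKahler

end Main
end


theorem theorem3 {E : Type*} [NormedAddCommGroup E] [NormedSpace ℝ E] [FiniteDimensional ℝ E]
    [Nontrivial E] {M : Type*} [TopologicalSpace M] [T2Space M] [ChartedSpace E M]
    [IsManifold 𝓘(ℝ, E) ∞ M]
    (J : EndField 𝓘(ℝ, E) M) (g : BilinField 𝓘(ℝ, E) M)
    (D : CovariantDerivative 𝓘(ℝ, E) E (TangentSpace 𝓘(ℝ, E) : M → Type _))
    (h : IsSpecialPseudoKahler J g D)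
    (J₁ J₂ J₃ : EndField (cotangentModel E) (CotangentBundle E M))
    (hJ₁ : J₁ = cotangentJ D J)
    (hJ₂ : J₂ = cotangentOmega D (fundamentalForm g J))
    (hJ₃ : J₃ = fun ξ ↦ J₁ ξ ∘L J₂ ξ) :
    IsParaHyperKahler J₁ J₂ J₃ (cotangentMetric D g) ∧
    IsComplexStructure J₁ ∧ IsParaComplexStructure J₂ ∧ IsParaComplexStructure J₃ ∧
    (∀ JN : EndField (cotangentModel E) (CotangentBundle E M),
      IsCanonicalComplexStructure J JN ↔ JN = J₁) := by
  subst hJ₁ hJ₂ hJ₃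
  exact ⟨h.isParaHyperKahler_cotangent, h.isComplexStructure_cotangentJ,
    h.isParaComplexStructure_cotangentOmega,
    h.isParaComplexStructure_cotangentJ_comp_cotangentOmega, h.isCanonicalComplexStructure_iff⟩
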